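/- Let $\mathbf T^3=\mathbf R^3/\mathbf Z^3$ with normalized Lebesgue measure. For $\delta>1$ let $B_\delta$ be the space of (continuous) real functions $f$ on $\mathbf T^3$ with $|f|_\delta:=\sum_{k\in\mathbf Z^3}|\mathcal F f(k)|\,\delta^{|k|}<\infty$, where $\mathcal F f(k)$ are the Fourier coefficients; for vector fields the norms of the components are added. Write $\langle F\rangle=\int_{\mathbf T^3}F\,dx$ and $v(\xi)=\xi/(1+\varepsilon^2|\xi|^2)^{1/2}$, and let $\mathbf P$ be the Leray projection onto divergence-free fields. Let $(M,\mu)$ be a probability space, $\delta_0>\delta_1>1$, $C_0>0$ and $\gamma\in[0,1]$. Let $(\rho_\theta(0))_{\theta\in M}$ and $(\xi_\theta(0))_{\theta\in M}$ be families of functions, respectively vector fields, in $B_{\delta_0}$ (measurable in $\theta$), and for $\varepsilon\in(0,1]$ let $E^0_\varepsilon,B^0_\varepsilon$ be vector fields in $B_{\delta_0}$, such that $$\nabla\cdot E^0_\varepsilon=\int_M\rho_\theta(0)\,d\mu(\theta)-1,\qquad \nabla\cdot B^0_\varepsilon=0,$$ $$\sup_\theta|\rho_\theta(0)|_{\delta_0}\le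 C_0,\qquad \sup_\theta|\xi_\theta(0)|_{\delta_0}\le C_0,\qquad |E^0_\varepsilon|_{\delta_0}+|B^0_\varepsilon|_{\delta_0}\le C_0\varepsilon^{-\gamma}.$$ Then there exist constants $\varepsilon_0>0$ and $C>0$ such that for every $\varepsilon\in(0,\varepsilon_0]$ there exist a time $T>0$ and families $(\rho_\theta)_\theta$, $(\xi_\theta)_\theta$ in $C([0,T],B_{\delta_1})$ which, together with a scalar potential $\phi$ and a vector potential $A$ with $\nabla\cdot A=0$, solve on $[0,T]\times\mathbf T^3$, in the classical sense and for all $\theta\in M$, the relativistic multifluid Vlasov–Maxwell system $$\partial_t\rho_\theta+\nabla\cdot(v(\xi_\theta)\rho_\theta)=0,\qquad \partial_t\xi_\theta+(v(\xi_\theta)\cdot\nabla)\xi_\theta=E+\varepsilon\,v(\xi_\theta)\times B,$$ $$-\Delta\phi=\int_M\rho_\theta\,d\mu(\theta)-1,\qquad \varepsilon^2\partial_t^2A-\Delta A=\varepsilon\,\mathbf P\Big(\int_M v(\xi_\theta)\rho_\theta\,d\mu(\theta)\Big),$$ $$E=-\nabla\phi-\varepsilon\partial_tA,\qquad B=\nabla\times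 A+\langle B^0_\varepsilon\rangle,$$ with initial data $\rho_\theta|_{t=0}=\rho_\theta(0)$, $\xi_\theta|_{t=0}=\xi_\theta(0)$, $E|_{t=0}=E^0_\varepsilon$, $B|_{t=0}=B^0_\varepsilon$, $\langle A|_{t=0}\rangle=0$. Moreover $E,B\in C([0,T],B_{\delta_1})$ and $$\sup_\theta\sup_{[0,T]}|\rho_\theta|_{\delta_1}+\sup_\theta\sup_{[0,T]}|\xi_\theta|_{\delta_1}\le C,\qquad \sup_{[0,T]}|E|_{\delta_1}+\sup_{[0,T]}|B|_{\delta_1}\le C\varepsilon^{-\gamma}.$$ In addition there is $T_0>0$, independent of $\varepsilon$, such that one can take $T\ge T_0$ for every $\varepsilon\in(0,\varepsilon_0]$ with $\langle E^0_\varepsilon\rangle=0$. -/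

import Mathlib

open Set Filter Topology MeasureTheory

noncomputable section

namespace VlasovMaxwell

/-- The torus `ℝ³ / ℤ³`; its `volume` is the normalized Lebesgue measure. -/
abbrev T3 : Type := UnitAddTorus (Fin 3)

/-! ### The analytic spaces `B_δ` -/

/-- The `k`-th Fourier coefficient of a real function on the torus. -/
def fourierCoef (f : T3 → ℝ) (k : Fin 3 → ℤ) : ℂ :=
  UnitAddTorus.mFourierCoeff (fun x => (f x : ℂ)) k

/-- The Euclidean length `|k|` of a frequency. -/
def freqNorm (k : Fin 3 → ℤ) : ℝ := Real.sqrt (∑ j, (k j : ℝ) ^ 2)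

/-- `f ∈ B_δ`, that is `∑ₖ |𝓕 f(k)| δ^|k| < ∞`. A function with this property agrees almost
everywhere with a continuous function, and we always take the continuous representative. -/
def MemB (δ : ℝ) (f : T3 → ℝ) : Prop :=
  Continuous f ∧ Summable fun k : Fin 3 → ℤ => ‖fourierCoef f k‖ * δ ^ freqNorm k

/-- The norm `|f|_δ = ∑ₖ |𝓕 f(k)| δ^|k|`, for `f ∈ B_δ`. -/
def bNorm (δ : ℝ) (f : T3 → ℝ) : ℝ :=
  ∑' k : Fin 3 → ℤ, ‖fourierCoef f k‖ * δ ^ freqNorm k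

/-- A vector field belongs to `B_δ` if its components do. -/
def MemBVec (δ : ℝ) (F : T3 → Fin 3 → ℝ) : Prop :=
  ∀ i, MemB δ fun x => F x i

/-- The norm `|F|_δ` of a vector field: the sum of the norms of its components. -/
def bNormVec (δ : ℝ) (F : T3 → Fin 3 → ℝ) : ℝ :=
  ∑ i, bNorm δ fun x => F x i

/-- `u ∈ C([0,T], B_δ)` for a time-dependent function `u`. -/
def ContInB (T δ : ℝ) (u : ℝ → T3 → ℝ) : Prop :=
  ∀ t ∈ Icc 0 T, MemB δ (u t) ∧
    Tendsto (fun s => bNorm δ fun x => u s x - u t x) (𝓝[Icc 0 T] t) (𝓝 0)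

/-- `F ∈ C([0,T], B_δ)` for a time-dependent vector field `F`. -/
def ContInBVec (T δ : ℝ) (F : ℝ → T3 → Fin 3 → ℝ) : Prop :=
  ∀ i, ContInB T δ fun t x => F t x i

/-! ### Differential operators and the Leray projection on the torus -/

/-- The partial derivative `∂ᵢ f`. -/
def pderiv (i : Fin 3) (f : T3 → ℝ) (x : T3) : ℝ :=
  deriv (fun s : ℝ => f (x + Pi.single i (s : UnitAddCircle))) 0

/-- The gradient. -/
def grad (f : T3 → ℝ) (x : T3) (i : Fin 3) : ℝ := pderiv i f x

/-- The divergence. -/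
def divergence (F : T3 → Fin 3 → ℝ) (x : T3) : ℝ :=
  ∑ i, pderiv i (fun y => F y i) x

/-- The curl. -/
def curl (F : T3 → Fin 3 → ℝ) (x : T3) : Fin 3 → ℝ :=
  ![pderiv 1 (fun y => F y 2) x - pderiv 2 (fun y => F y 1) x,
    pderiv 2 (fun y => F y 0) x - pderiv 0 (fun y => F y 2) x,
    pderiv 0 (fun y => F y 1) x - pderiv 1 (fun y => F y 0) x]

/-- The Laplacian. -/
def laplacian (f : T3 → ℝ) (x : T3) : ℝ := ∑ i, pderiv i (pderiv i f) x

/-- The spatial mean `⟨F⟩`. -/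
def mean (F : T3 → Fin 3 → ℝ) (i : Fin 3) : ℝ := ∫ x, F x i

/-- The Leray projection, given by its Fourier multiplier `Id - k ⊗ k / |k|²` (the identity for
`k = 0`, as `0 / 0 = 0` here), for fields with absolutely summable Fourier coefficients. -/
def leray (F : T3 → Fin 3 → ℝ) (x : T3) (i : Fin 3) : ℝ :=
  (∑' k : Fin 3 → ℤ,
    (fourierCoef (fun y => F y i) k -
      (k i : ℂ) * (∑ j, (k j : ℂ) * fourierCoef (fun y => F y j) k) / (∑ j, (k j : ℂ) ^ 2)) *
      UnitAddTorus.mFourier k x).re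

/-! ### The relativistic multifluid Vlasov-Maxwell system -/

/-- The relativistic velocity `v(ξ) = ξ / (1 + ε²|ξ|²)^(1/2)`. -/
def vel (ε : ℝ) (ξ : Fin 3 → ℝ) (i : Fin 3) : ℝ :=
  ξ i / Real.sqrt (1 + ε ^ 2 * ∑ j, ξ j ^ 2)

/-- The total density `∫_M ρ_θ μ(dθ)`. -/
def density {M : Type*} [MeasurableSpace M] (μ : Measure M) (ρ : M → T3 → ℝ) (x : T3) : ℝ :=
  ∫ θ, ρ θ x ∂μ

/-- The total current `∫_M v(ξ_θ) ρ_θ μ(dθ)`. -/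
def current {M : Type*} [MeasurableSpace M] (μ : Measure M) (ε : ℝ)
    (ρ : M → T3 → ℝ) (ξ : M → T3 → Fin 3 → ℝ) (x : T3) (i : Fin 3) : ℝ :=
  ∫ θ, vel ε (ξ θ x) i * ρ θ x ∂μ

/-- The electric field `E = -∇φ - ε ∂ₜA`; the argument `At` is `∂ₜA`. -/
def elec (ε : ℝ) (φ : ℝ → T3 → ℝ) (At : ℝ → T3 → Fin 3 → ℝ) (t : ℝ) (x : T3) (i : Fin 3) : ℝ :=
  -grad (φ t) x i - ε * At t x i

/-- The magnetic field `B = ∇ × A + ⟨B⁰⟩`. -/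
def magn (B0 : T3 → Fin 3 → ℝ) (A : ℝ → T3 → Fin 3 → ℝ) (t : ℝ) (x : T3) (i : Fin 3) : ℝ :=
  curl (A t) x i + mean B0 i

/-- `(ρ_θ, ξ_θ)` in `C([0,T], B_δ)`, with scalar potential `φ` and vector potential `A` in Coulomb
gauge, is a classical solution on `[0,T]` of the multifluid Vlasov-Maxwell system with initial
data `(ρ_θ(0), ξ_θ(0), E⁰, B⁰)`. The fields `At` and `Att` are the first two time derivatives
of `A`. -/
structure IsSolution {M : Type*} [MeasurableSpace M] (μ : Measure M) (ε T δ : ℝ)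
    (ρ0 : M → T3 → ℝ) (ξ0 : M → T3 → Fin 3 → ℝ) (E0 B0 : T3 → Fin 3 → ℝ)
    (ρ : M → ℝ → T3 → ℝ) (ξ : M → ℝ → T3 → Fin 3 → ℝ)
    (φ : ℝ → T3 → ℝ) (A At Att : ℝ → T3 → Fin 3 → ℝ) : Prop where
  /-- regularity of the unknowns -/
  cont_rho : ∀ θ, ContInB T δ (ρ θ)
  cont_xi : ∀ θ, ContInBVec T δ (ξ θ)
  cont_phi : ContInB T δ φ
  cont_A : ContInBVec T δ A
  /-- the fields belong to `C([0,T], B_δ)` -/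
  cont_E : ContInBVec T δ (elec ε φ At)
  cont_B : ContInBVec T δ (magn B0 A)
  /-- the total density and the total current are well defined, and the latter is in `B_δ` -/
  integrable_rho : ∀ t ∈ Icc 0 T, ∀ x, Integrable (fun θ => ρ θ t x) μ
  integrable_current : ∀ t ∈ Icc 0 T, ∀ x i,
    Integrable (fun θ => vel ε (ξ θ t x) i * ρ θ t x) μ
  mem_current : ∀ t ∈ Icc 0 T, MemBVec δ (current μ ε (fun θ => ρ θ t) (fun θ => ξ θ t))
  /-- `∂ₜ ρ_θ + ∇ · (v(ξ_θ) ρ_θ) = 0` -/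
  continuity : ∀ θ, ∀ t ∈ Icc 0 T, ∀ x,
    HasDerivWithinAt (fun s => ρ θ s x)
      (-divergence (fun y i => vel ε (ξ θ t y) i * ρ θ t y) x) (Icc 0 T) t
  /-- `∂ₜ ξ_θ + (v(ξ_θ) · ∇) ξ_θ = E + ε v(ξ_θ) × B` -/
  momentum : ∀ θ, ∀ t ∈ Icc 0 T, ∀ x i,
    HasDerivWithinAt (fun s => ξ θ s x i)
      (-(∑ j, vel ε (ξ θ t x) j * pderiv j (fun y => ξ θ t y i) x)
        + elec ε φ At t x i
        + ε * crossProduct (vel ε (ξ θ t x)) (magn B0 A t x) i) (Icc 0 T) t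
  /-- `-Δ φ = ∫_M ρ_θ μ(dθ) - 1` -/
  poisson : ∀ t ∈ Icc 0 T, ∀ x,
    -laplacian (φ t) x = density μ (fun θ => ρ θ t) x - 1
  /-- `ε² ∂ₜ² A - Δ A = ε P (∫_M v(ξ_θ) ρ_θ μ(dθ))` -/
  deriv_A : ∀ t ∈ Icc 0 T, ∀ x i,
    HasDerivWithinAt (fun s => A s x i) (At t x i) (Icc 0 T) t
  deriv_At : ∀ t ∈ Icc 0 T, ∀ x i,
    HasDerivWithinAt (fun s => At s x i) (Att t x i) (Icc 0 T) t
  wave : ∀ t ∈ Icc 0 T, ∀ x i,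
    ε ^ 2 * Att t x i - laplacian (fun y => A t y i) x
      = ε * leray (current μ ε (fun θ => ρ θ t) (fun θ => ξ θ t)) x i
  /-- the Coulomb gauge `∇ · A = 0` -/
  gauge : ∀ t ∈ Icc 0 T, ∀ x, divergence (A t) x = 0
  /-- initial conditions -/
  init_rho : ∀ θ, ρ θ 0 = ρ0 θ
  init_xi : ∀ θ, ξ θ 0 = ξ0 θ
  /-- `E|ₜ₌₀ = E⁰`, that is `ε ∂ₜA|ₜ₌₀ = -E⁰ - ∇φ|ₜ₌₀` -/
  init_E : ∀ x i, ε * At 0 x i = -E0 x i - grad (φ 0) x i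
  /-- `B|ₜ₌₀ = B⁰`, with `A|ₜ₌₀` of zero mean -/
  init_B : ∀ x i, curl (A 0) x i = B0 x i - mean B0 i
  init_mean_A : ∀ i, mean (A 0) i = 0

end VlasovMaxwell

end

open VlasovMaxwell

/-!
The equations are solved for the Fourier coefficients, in the Banach space of families bounded by
multiples of `exp (-(a - λ t) |k|)`, up to a polynomial factor which makes it an algebra. As the
strip of analyticity shrinks with speed `λ`, an integration in time gains one derivative, with a
constant `T + 1 / λ`, and this pays for the derivative lost in the transport terms. The nonlinearity
`1 / √(1 + ε² |ξ|²)` is replaced by an unknown `1 + h` subject to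
`(1 + h)² (1 + ε² |ξ|²) = 1`, so that all the terms become polynomial.

The wave propagators `cos (|2πk| t / ε)` and `sin (|2πk| t / ε) / |2πk|` are bounded uniformly in
`ε`, except for the second one at `k = 0`, where its limit `t / ε` forces `T` to be of order `ε`
unless the electric field has mean zero. The remaining singular term is the contribution of size
`ε^(-γ)` of the fields: in `ε v × B` it is compensated by the factor `ε`, and `-ε ∂ₜA` is removed
from the momentum equation by taking `ξ + ε A` as the unknown. On a suitable ball the resulting
integral equations are then a contraction, with constants which do not depend on `ε`.
-/

noncomputable section

namespace VlasovMaxwell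

open scoped ComplexConjugate

/-- The frequencies of the Fourier series on the torus `T3`. -/
abbrev Freq : Type := Fin 3 → ℤ

/-! ### Frequencies and summable weights -/

lemma freqNorm_nonneg (k : Freq) : 0 ≤ freqNorm k := Real.sqrt_nonneg _

lemma freqNorm_sq (k : Freq) : freqNorm k ^ 2 = ∑ j, (k j : ℝ) ^ 2 :=
  Real.sq_sqrt (Finset.sum_nonneg fun _ _ => sq_nonneg _)

@[simp] lemma freqNorm_zero : freqNorm 0 = 0 := by simp [freqNorm]

@[simp] lemma freqNorm_neg (k : Freq) : freqNorm (-k) = freqNorm k := by simp [freqNorm]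

lemma freqNorm_eq_norm (k : Freq) :
    freqNorm k = ‖(WithLp.toLp 2 fun j => (k j : ℝ) : EuclideanSpace ℝ (Fin 3))‖ := by
  simp [freqNorm, EuclideanSpace.norm_eq]

lemma freqNorm_add_le (j k : Freq) : freqNorm (j + k) ≤ freqNorm j + freqNorm k := by
  simp only [freqNorm_eq_norm]
  refine le_trans (le_of_eq ?_) (norm_add_le _ _)
  congr 1
  ext i
  simp

lemma freqNorm_le_add_sub (j k : Freq) : freqNorm k ≤ freqNorm j + freqNorm (k - j) := by
  simpa using freqNorm_add_le j (k - j)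

lemma abs_le_freqNorm (k : Freq) (j : Fin 3) : |(k j : ℝ)| ≤ freqNorm k :=
  Real.abs_le_sqrt <| Finset.single_le_sum (f := fun j => (k j : ℝ) ^ 2)
    (fun _ _ => sq_nonneg _) (Finset.mem_univ j)

lemma one_le_freqNorm {k : Freq} (hk : k ≠ 0) : 1 ≤ freqNorm k := by
  obtain ⟨j, hj⟩ := Function.ne_iff.mp hk
  refine le_trans ?_ (abs_le_freqNorm k j)
  exact_mod_cast Int.one_le_abs hj

lemma rpow_freqNorm_pos {δ : ℝ} (hδ : 0 < δ) (k : Freq) : 0 < δ ^ freqNorm k :=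
  Real.rpow_pos_of_pos hδ _

lemma one_le_rpow_freqNorm {δ : ℝ} (hδ : 1 ≤ δ) (k : Freq) : 1 ≤ δ ^ freqNorm k :=
  Real.one_le_rpow hδ (freqNorm_nonneg k)

lemma summable_pi_prod {α : Type*} {f : α → ℝ} (hf : Summable f) (h0 : 0 ≤ f) (n : ℕ) :
    Summable fun k : Fin n → α => ∏ i, f (k i) := by
  induction n with
  | zero => exact (hasSum_fintype _).summable
  | succ n ih =>
    rw [← (Fin.consEquiv fun _ : Fin (n + 1) => α).summable_iff]
    refine (hf.mul_of_nonneg ih h0 fun k => Finset.prod_nonneg fun i _ => h0 _).congr fun x => ?_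
    simp [Fin.consEquiv, Fin.prod_univ_succ]

lemma summable_one_add_abs_sq_inv : Summable fun n : ℤ => ((1 + |(n : ℝ)|) ^ 2)⁻¹ := by
  have h := (Real.summable_one_div_int_pow (p := 2)).2 (by norm_num)
  refine (h.add (hasSum_ite_eq (0 : ℤ) (1 : ℝ)).summable).of_nonneg_of_le
    (fun n => by positivity) fun n => ?_
  by_cases hn : n = 0
  · simp [hn]
  · have : 0 < |(n : ℝ)| := abs_pos.2 (by exact_mod_cast hn)
    simp only [hn, if_false, add_zero, ← sq_abs (n : ℝ), one_div]
    gcongr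
    linarith

/-- The decay `(1 + |k|)⁻⁶`, summable over the frequencies. -/
def decay (k : Freq) : ℝ := ((1 + freqNorm k) ^ 6)⁻¹

lemma decay_pos (k : Freq) : 0 < decay k := by
  have := freqNorm_nonneg k
  unfold decay
  positivity

lemma summable_decay : Summable decay := by
  refine (summable_pi_prod summable_one_add_abs_sq_inv (fun n => by positivity) 3).of_nonneg_of_le
    (fun k => (decay_pos k).le) fun k => ?_
  have hle : ∏ i, (1 + |(k i : ℝ)|) ^ 2 ≤ (1 + freqNorm k) ^ 6 := by
    rw [show (6 : ℕ) = 2 * 3 from rfl, pow_mul, ← Fin.prod_const]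
    gcongr
    exact abs_le_freqNorm _ _
  rw [decay, Finset.prod_inv_distrib]
  gcongr

lemma decay_mul_decay_le (j k : Freq) :
    decay j * decay (k - j) ≤ 32 * decay k * (decay j + decay (k - j)) := by
  have hj := freqNorm_nonneg j
  have hk := freqNorm_nonneg k
  have hkj := freqNorm_nonneg (k - j)
  have hconvex : (1 + freqNorm k) ^ 6 ≤
      32 * ((1 + freqNorm j) ^ 6 + (1 + freqNorm (k - j)) ^ 6) := by
    have h := add_pow_le (a := 1 + freqNorm j) (b := 1 + freqNorm (k - j))
      (by positivity) (by positivity) 6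
    norm_num only at h
    refine (pow_le_pow_left₀ (by positivity) ?_ 6).trans h
    linarith [freqNorm_le_add_sub j k]
  have hx : 0 < (1 + freqNorm j) ^ 6 := by positivity
  have hy : 0 < (1 + freqNorm (k - j)) ^ 6 := by positivity
  have hz : 0 < (1 + freqNorm k) ^ 6 := by positivity
  unfold decay
  generalize (1 + freqNorm j) ^ 6 = x at *
  generalize (1 + freqNorm (k - j)) ^ 6 = y at *
  generalize (1 + freqNorm k) ^ 6 = z at *
  calc x⁻¹ * y⁻¹ = z * (x * y * z)⁻¹ := by field_simp
    _ ≤ 32 * (x + y) * (x * y * z)⁻¹ := by gcongr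
    _ = 32 * z⁻¹ * (x⁻¹ + y⁻¹) := by field_simp; ring

/-- A summable polynomial weight, normalized so that it dominates its convolution square. -/
def polyWeight (k : Freq) : ℝ := decay k / (64 * ∑' j, decay j)

lemma tsum_decay_pos : 0 < ∑' k, decay k :=
  summable_decay.tsum_pos (fun k => (decay_pos k).le) 0 (decay_pos 0)

lemma polyWeight_pos (k : Freq) : 0 < polyWeight k :=
  div_pos (decay_pos k) (mul_pos (by norm_num) tsum_decay_pos)

@[simp] lemma polyWeight_neg (k : Freq) : polyWeight (-k) = polyWeight k := by
  simp [polyWeight, decay]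

lemma summable_polyWeight : Summable polyWeight := summable_decay.div_const _

lemma tsum_polyWeight : ∑' k, polyWeight k = 1 / 64 := by
  have := tsum_decay_pos
  simp only [polyWeight, tsum_div_const]
  field_simp

lemma polyWeight_mul_le (j k : Freq) :
    polyWeight j * polyWeight (k - j) ≤
      32 * polyWeight k * (polyWeight j + polyWeight (k - j)) := by
  have hS := tsum_decay_pos
  unfold polyWeight
  generalize ∑' j, decay j = S at *
  calc decay j / (64 * S) * (decay (k - j) / (64 * S))
      = decay j * decay (k - j) / (64 * S) ^ 2 := by ring
    _ ≤ 32 * decay k * (decay j + decay (k - j)) / (64 * S) ^ 2 :=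
      div_le_div_of_nonneg_right (decay_mul_decay_le j k) (by positivity)
    _ = _ := by ring

lemma hasSum_polyWeight_add_sub (k : Freq) :
    HasSum (fun j => polyWeight j + polyWeight (k - j)) (1 / 32) := by
  have h : HasSum polyWeight (1 / 64) := tsum_polyWeight ▸ summable_polyWeight.hasSum
  exact (show (1 / 64 + 1 / 64 : ℝ) = 1 / 32 by norm_num) ▸
    h.add ((Equiv.subLeft k).hasSum_iff.2 h)

lemma summable_polyWeight_mul (k : Freq) :
    Summable fun j => polyWeight j * polyWeight (k - j) :=
  ((hasSum_polyWeight_add_sub k).summable.mul_left _).of_nonneg_of_le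
    (fun _ => (mul_pos (polyWeight_pos _) (polyWeight_pos _)).le) fun j => polyWeight_mul_le j k

lemma tsum_polyWeight_mul_le (k : Freq) :
    ∑' j, polyWeight j * polyWeight (k - j) ≤ polyWeight k := by
  have h := (hasSum_polyWeight_add_sub k).mul_left (32 * polyWeight k)
  refine ((summable_polyWeight_mul k).tsum_le_tsum (fun j => polyWeight_mul_le j k)
    h.summable).trans ?_
  rw [h.tsum_eq]
  linarith

lemma exists_pow_mul_exp_le (n : ℕ) {c : ℝ} (hc : 0 < c) :
    ∃ K > 0, ∀ r : ℝ, 0 ≤ r → (1 + r) ^ n * Real.exp (-c * r) ≤ K := by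
  refine ⟨n.factorial / c ^ n * Real.exp c, by positivity, fun r hr => ?_⟩
  have h := Real.pow_div_factorial_le_exp (c * (1 + r)) (by positivity) n
  rw [div_le_iff₀ (by positivity), mul_pow] at h
  have hexp : Real.exp (c * (1 + r)) * Real.exp (-c * r) = Real.exp c := by
    rw [← Real.exp_add]
    congr 1
    ring
  calc (1 + r) ^ n * Real.exp (-c * r)
      = (c ^ n * (1 + r) ^ n) * Real.exp (-c * r) / c ^ n := by field_simp
    _ ≤ (Real.exp (c * (1 + r)) * n.factorial) * Real.exp (-c * r) / c ^ n := by gcongr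
    _ = n.factorial / c ^ n * Real.exp c := by rw [← hexp]; ring

/-! ### Functions given by their Fourier series -/

/-- The symmetry `a (-k) = conj (a k)` of the Fourier coefficients of a real function. -/
def IsHermitian {G : Type*} [Neg G] (a : G → ℂ) : Prop := ∀ k, a (-k) = conj (a k)

namespace IsHermitian

variable {G : Type*} [Neg G] {a b : G → ℂ}

lemma add (ha : IsHermitian a) (hb : IsHermitian b) : IsHermitian fun k => a k + b k :=
  fun k => by simp only [ha k, hb k, map_add]

lemma neg (ha : IsHermitian a) : IsHermitian fun k => -a k :=
  fun k => by simp only [ha k, map_neg]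

lemma sub (ha : IsHermitian a) (hb : IsHermitian b) : IsHermitian fun k => a k - b k :=
  fun k => by simp only [ha k, hb k, map_sub]

lemma mul (ha : IsHermitian a) (hb : IsHermitian b) : IsHermitian fun k => a k * b k :=
  fun k => by simp only [ha k, hb k, map_mul]

lemma sum {ι : Type*} {s : Finset ι} {a : ι → G → ℂ} (ha : ∀ i, IsHermitian (a i)) :
    IsHermitian fun k => ∑ i ∈ s, a i k :=
  fun k => by simp only [ha _ k, map_sum]

end IsHermitian

section Synthesis

variable {d : Type*} [Fintype d] {a b : (d → ℤ) → ℂ}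

/-- The real function on the torus with Hermitian Fourier coefficients `a`; for other `a` it is
the real part of the Fourier series. -/
def fourierSynthesis (a : (d → ℤ) → ℂ) (x : UnitAddTorus d) : ℝ :=
  (∑' k, a k * UnitAddTorus.mFourier k x).re

lemma norm_mFourier_apply (k : d → ℤ) (x : UnitAddTorus d) :
    ‖UnitAddTorus.mFourier k x‖ = 1 := by
  simp only [UnitAddTorus.mFourier, ContinuousMap.coe_mk, norm_prod, fourier_apply,
    Circle.norm_coe, Finset.prod_const_one]

lemma norm_mul_mFourier (z : ℂ) (k : d → ℤ) (x : UnitAddTorus d) :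
    ‖z * UnitAddTorus.mFourier k x‖ = ‖z‖ := by
  rw [norm_mul, norm_mFourier_apply, mul_one]

lemma summable_mul_mFourier (ha : Summable fun k => ‖a k‖) (x : UnitAddTorus d) :
    Summable fun k => a k * UnitAddTorus.mFourier k x :=
  Summable.of_norm (ha.congr fun _ => (norm_mul_mFourier _ _ _).symm)

lemma ofReal_fourierSynthesis (ha : IsHermitian a) (x : UnitAddTorus d) :
    (fourierSynthesis a x : ℂ) = ∑' k, a k * UnitAddTorus.mFourier k x := by
  refine Complex.conj_eq_iff_re.1 ?_
  rw [Complex.conj_tsum, ← (Equiv.neg (d → ℤ)).tsum_eq]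
  refine tsum_congr fun k => ?_
  rw [Equiv.neg_apply, UnitAddTorus.mFourier_neg, ha k]
  simp

lemma abs_fourierSynthesis_le (ha : Summable fun k => ‖a k‖) (x : UnitAddTorus d) :
    |fourierSynthesis a x| ≤ ∑' k, ‖a k‖ := by
  refine (Complex.abs_re_le_norm _).trans ((norm_tsum_le_tsum_norm ?_).trans ?_)
  · exact ha.congr fun k => (norm_mul_mFourier _ _ _).symm
  · exact le_of_eq (tsum_congr fun k => norm_mul_mFourier _ _ _)

lemma continuous_fourierSynthesis (ha : Summable fun k => ‖a k‖) :
    Continuous (fourierSynthesis a) :=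
  Complex.continuous_re.comp (continuous_tsum (fun k => by fun_prop) ha
    fun k x => (norm_mul_mFourier _ _ _).le)

lemma fourierSynthesis_add (ha : Summable fun k => ‖a k‖) (hb : Summable fun k => ‖b k‖)
    (x : UnitAddTorus d) :
    fourierSynthesis (fun k => a k + b k) x = fourierSynthesis a x + fourierSynthesis b x := by
  simp only [fourierSynthesis, add_mul]
  rw [(summable_mul_mFourier ha x).tsum_add (summable_mul_mFourier hb x), Complex.add_re]

lemma fourierSynthesis_neg (a : (d → ℤ) → ℂ) (x : UnitAddTorus d) :
    fourierSynthesis (fun k => -a k) x = -fourierSynthesis a x := by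
  simp only [fourierSynthesis, neg_mul, tsum_neg, Complex.neg_re]

lemma fourierSynthesis_sub (ha : Summable fun k => ‖a k‖) (hb : Summable fun k => ‖b k‖)
    (x : UnitAddTorus d) :
    fourierSynthesis (fun k => a k - b k) x = fourierSynthesis a x - fourierSynthesis b x := by
  simp only [sub_eq_add_neg]
  rw [fourierSynthesis_add ha (by simpa only [norm_neg] using hb), fourierSynthesis_neg]

lemma fourierSynthesis_const_mul (r : ℝ) (a : (d → ℤ) → ℂ) (x : UnitAddTorus d) :
    fourierSynthesis (fun k => (r : ℂ) * a k) x = r * fourierSynthesis a x := by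
  simp only [fourierSynthesis, mul_assoc, tsum_mul_left, Complex.re_ofReal_mul]

lemma fourierSynthesis_sum {ι : Type*} (s : Finset ι) {a : ι → (d → ℤ) → ℂ}
    (ha : ∀ i ∈ s, Summable fun k => ‖a i k‖) (x : UnitAddTorus d) :
    fourierSynthesis (fun k => ∑ i ∈ s, a i k) x = ∑ i ∈ s, fourierSynthesis (a i) x := by
  simp only [fourierSynthesis, Finset.sum_mul]
  rw [Summable.tsum_finsetSum fun i hi => summable_mul_mFourier (ha i hi) x, Complex.re_sum]

lemma summable_norm_ite_zero {ι E : Type*} [Zero ι] [DecidableEq ι] [SeminormedAddCommGroup E]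
    (c : E) : Summable fun k : ι => ‖if k = 0 then c else 0‖ :=
  summable_of_ne_finset_zero (s := {0}) fun k hk => by simp_all

lemma fourierSynthesis_ite_zero (c : ℂ) (x : UnitAddTorus d) :
    fourierSynthesis (fun k => if k = 0 then c else 0) x = c.re := by
  rw [fourierSynthesis, tsum_eq_single 0 fun k hk => by simp [hk]]
  simp [UnitAddTorus.mFourier_zero]

/-- The discrete convolution, giving the Fourier coefficients of a product. -/
def coefConv {G : Type*} [AddGroup G] (a b : G → ℂ) (k : G) : ℂ := ∑' j, a j * b (k - j)

lemma tsum_mul_tsum_eq_tsum_tsum_sub {G R : Type*} [AddCommGroup G] [NormedRing R]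
    [CompleteSpace R] {f g : G → R} (hf : Summable fun k => ‖f k‖)
    (hg : Summable fun k => ‖g k‖) :
    (∑' k, f k) * ∑' k, g k = ∑' k, ∑' j, f j * g (k - j) := by
  let shear : G × G ≃ G × G :=
    (Equiv.prodComm G G).trans (Equiv.prodShear (Equiv.refl G) fun j => Equiv.subRight j)
  have hfg : Summable fun z : G × G => f z.1 * g z.2 := summable_mul_of_summable_norm hf hg
  rw [tsum_mul_tsum_of_summable_norm hf hg, ← shear.tsum_eq]
  exact (shear.summable_iff.2 hfg).tsum_prod

lemma fourierSynthesis_coefConv (ha : Summable fun k => ‖a k‖) (hb : Summable fun k => ‖b k‖)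
    (ha' : IsHermitian a) (hb' : IsHermitian b) (x : UnitAddTorus d) :
    fourierSynthesis (coefConv a b) x = fourierSynthesis a x * fourierSynthesis b x := by
  have h := congrArg Complex.re (tsum_mul_tsum_eq_tsum_tsum_sub
    (summable_mul_mFourier ha x).norm (summable_mul_mFourier hb x).norm)
  rw [← ofReal_fourierSynthesis ha', ← ofReal_fourierSynthesis hb', Complex.re_mul_ofReal,
    Complex.ofReal_re] at h
  rw [h, fourierSynthesis]
  congr 1
  refine tsum_congr fun k => ?_
  rw [coefConv, ← tsum_mul_right]
  refine tsum_congr fun j => ?_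
  rw [← add_sub_cancel j k, UnitAddTorus.mFourier_add, add_sub_cancel]
  ring

lemma mFourier_add_single [DecidableEq d] (k : d → ℤ) (x : UnitAddTorus d) (i : d) (s : ℝ) :
    UnitAddTorus.mFourier k (x + Pi.single i (s : UnitAddCircle))
      = UnitAddTorus.mFourier k x * Complex.exp (2 * Real.pi * Complex.I * k i * s) := by
  have hfactor (j : d) : fourier (k j) ((x + Pi.single i (s : UnitAddCircle) : UnitAddTorus d) j)
      = fourier (k j) (x j) * if j = i then Complex.exp (2 * Real.pi * Complex.I * k i * s)
        else 1 := by
    have hadd (y z : UnitAddCircle) :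
        fourier (k j) (y + z) = fourier (k j) y * fourier (k j) z := by
      simp [fourier_apply, smul_add, AddCircle.toCircle_add]
    rw [Pi.add_apply, hadd]
    split_ifs with hj
    · subst hj
      rw [Pi.single_eq_same, fourier_coe_apply]
      simp
    · rw [Pi.single_eq_of_ne hj]
      simp
  simp only [UnitAddTorus.mFourier, ContinuousMap.coe_mk, hfactor, Finset.prod_mul_distrib]
  simp

lemma volume_unitAddTorus :
    (volume : Measure (UnitAddTorus d)) = Measure.pi fun _ => AddCircle.haarAddCircle := by
  rw [volume_pi]
  congr 1
  funext i
  rw [AddCircle.volume_eq_smul_haarAddCircle]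
  simp

instance : IsProbabilityMeasure (volume : Measure (UnitAddTorus d)) := by
  rw [volume_unitAddTorus]
  infer_instance

lemma mFourierCoeff_eq_integral_volume (f : UnitAddTorus d → ℂ) (k : d → ℤ) :
    UnitAddTorus.mFourierCoeff f k = ∫ x, UnitAddTorus.mFourier (-k) x * f x := by
  rw [volume_unitAddTorus]
  rfl

lemma integral_mFourier (k : d → ℤ) :
    ∫ x, UnitAddTorus.mFourier k x = if k = 0 then 1 else 0 := by
  split_ifs with hk
  · simp [hk, UnitAddTorus.mFourier_zero]
  · obtain ⟨j, hj⟩ := Function.ne_iff.mp hk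
    have hfactor : ∫ x : UnitAddCircle, fourier (k j) x ∂AddCircle.haarAddCircle = 0 :=
      integral_eq_zero_of_add_right_eq_neg (g := ((1 / 2 / k j : ℝ) : UnitAddCircle)) fun x => by
        simpa using fourier_add_half_inv_index (T := 1) hj one_pos x
    rw [volume_unitAddTorus]
    simp only [UnitAddTorus.mFourier, ContinuousMap.coe_mk]
    rw [integral_fintype_prod_eq_prod (𝕜 := ℂ)]
    exact Finset.prod_eq_zero (Finset.mem_univ j) hfactor

lemma mFourierCoeff_fourierSynthesis (ha : Summable fun k => ‖a k‖) (hh : IsHermitian a)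
    (k : d → ℤ) : UnitAddTorus.mFourierCoeff (fun x => (fourierSynthesis a x : ℂ)) k = a k := by
  classical
  have hprod (j : d → ℤ) (x : UnitAddTorus d) :
      UnitAddTorus.mFourier (-k) x * (a j * UnitAddTorus.mFourier j x)
        = a j * UnitAddTorus.mFourier (-k + j) x := by
    rw [mul_left_comm, ← UnitAddTorus.mFourier_add]
  have horth (j : d → ℤ) :
      ∫ x, a j * UnitAddTorus.mFourier (-k + j) x = if j = k then a k else 0 := by
    rw [integral_const_mul, integral_mFourier]
    split_ifs with hk hj hj <;> simp_all [neg_add_eq_zero]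
  have hint (j : d → ℤ) :
      Integrable fun x => UnitAddTorus.mFourier (-k) x * (a j * UnitAddTorus.mFourier j x) :=
    Continuous.integrable_of_hasCompactSupport (by fun_prop) (HasCompactSupport.of_compactSpace _)
  rw [mFourierCoeff_eq_integral_volume]
  simp only [ofReal_fourierSynthesis hh, ← tsum_mul_left]
  rw [← integral_tsum_of_summable_integral_norm hint (by simpa [norm_mFourier_apply] using ha)]
  simp only [hprod, horth, tsum_ite_eq]

lemma isHermitian_mFourierCoeff (f : UnitAddTorus d → ℝ) :
    IsHermitian (UnitAddTorus.mFourierCoeff fun x => (f x : ℂ)) := by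
  intro k
  rw [mFourierCoeff_eq_integral_volume, mFourierCoeff_eq_integral_volume, ← integral_conj]
  refine integral_congr_ae (Eventually.of_forall fun x => ?_)
  simp [UnitAddTorus.mFourier_neg]

lemma fourierSynthesis_mFourierCoeff {f : UnitAddTorus d → ℝ} (hf : Continuous f)
    (hs : Summable fun k => ‖UnitAddTorus.mFourierCoeff (fun x => (f x : ℂ)) k‖) :
    fourierSynthesis (UnitAddTorus.mFourierCoeff fun x => (f x : ℂ)) = f := by
  funext x
  have h := (UnitAddTorus.hasSum_mFourier_series_apply_of_summable
    (f := ⟨fun x => (f x : ℂ), by fun_prop⟩) (Summable.of_norm hs) x).tsum_eq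
  simp only [smul_eq_mul, ContinuousMap.coe_mk] at h
  exact (congrArg Complex.re h).trans (Complex.ofReal_re _)

end Synthesis

/-- The symbol of the partial derivative `∂ᵢ`. -/
def derivSymbol (i : Fin 3) (k : Freq) : ℂ := 2 * Real.pi * Complex.I * k i

lemma norm_derivSymbol_le (i : Fin 3) (k : Freq) :
    ‖derivSymbol i k‖ ≤ 2 * Real.pi * freqNorm k := by
  have hnorm : ‖derivSymbol i k‖ = 2 * Real.pi * |(k i : ℝ)| := by
    simp [derivSymbol, abs_of_pos Real.pi_pos]
  rw [hnorm]
  have := Real.pi_pos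
  gcongr
  exact abs_le_freqNorm k i

lemma derivSymbol_neg (i : Fin 3) (k : Freq) : derivSymbol i (-k) = conj (derivSymbol i k) := by
  simp [derivSymbol, Complex.conj_ofReal, Complex.conj_ofNat]

lemma isHermitian_derivSymbol_mul {a : Freq → ℂ} (ha : IsHermitian a) (i : Fin 3) :
    IsHermitian fun k => derivSymbol i k * a k :=
  IsHermitian.mul (derivSymbol_neg i) ha

lemma pderiv_fourierSynthesis {a : Freq → ℂ} (ha : Summable fun k => ‖a k‖) {i : Fin 3}
    (hd : Summable fun k => ‖derivSymbol i k * a k‖) (x : T3) :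
    pderiv i (fourierSynthesis a) x = fourierSynthesis (fun k => derivSymbol i k * a k) x := by
  have hterm (k : Freq) (s : ℝ) : HasDerivAt
      (fun s : ℝ => a k * UnitAddTorus.mFourier k (x + Pi.single i (s : UnitAddCircle)))
      (derivSymbol i k * a k *
        UnitAddTorus.mFourier k (x + Pi.single i (s : UnitAddCircle))) s := by
    simp only [mFourier_add_single]
    refine ((((Complex.ofRealCLM.hasDerivAt (x := s)).const_mul
      (2 * Real.pi * Complex.I * k i)).cexp.const_mul
        (UnitAddTorus.mFourier k x)).const_mul (a k)).congr_deriv ?_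
    simp only [Complex.ofRealCLM_apply, Complex.ofReal_one, mul_one, derivSymbol]
    ring
  have hseries := hasDerivAt_tsum (y₀ := 0) hd hterm
    (fun k s => (norm_mul_mFourier _ _ _).le) (summable_mul_mFourier ha _) 0
  have hre := (Complex.reCLM.hasFDerivAt.comp_hasDerivAt (0 : ℝ) hseries).deriv
  exact Eq.trans rfl (hre.trans (by simp [fourierSynthesis]))

lemma fourierCoef_fourierSynthesis {a : Freq → ℂ} (ha : Summable fun k => ‖a k‖)
    (hh : IsHermitian a) (k : Freq) : fourierCoef (fourierSynthesis a) k = a k :=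
  mFourierCoeff_fourierSynthesis ha hh k

lemma isHermitian_fourierCoef (f : T3 → ℝ) : IsHermitian (fourierCoef f) :=
  isHermitian_mFourierCoeff f

lemma fourierSynthesis_fourierCoef {f : T3 → ℝ} (hf : Continuous f)
    (hs : Summable fun k => ‖fourierCoef f k‖) : fourierSynthesis (fourierCoef f) = f :=
  fourierSynthesis_mFourierCoeff hf hs

lemma mean_eq_fourierCoef (F : T3 → Fin 3 → ℝ) (i : Fin 3) :
    (mean F i : ℂ) = fourierCoef (fun x => F x i) 0 := by
  rw [fourierCoef, mFourierCoeff_eq_integral_volume, mean, ← integral_complex_ofReal]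
  simp [UnitAddTorus.mFourier_zero]

lemma mean_eq_re_fourierCoef (F : T3 → Fin 3 → ℝ) (i : Fin 3) :
    mean F i = (fourierCoef (fun x => F x i) 0).re := by
  rw [← mean_eq_fourierCoef, Complex.ofReal_re]

lemma summable_norm_of_rpow {δ : ℝ} (hδ : 1 ≤ δ) {a : Freq → ℂ}
    (ha : Summable fun k => ‖a k‖ * δ ^ freqNorm k) : Summable fun k => ‖a k‖ :=
  ha.of_nonneg_of_le (fun _ => norm_nonneg _) fun k =>
    le_mul_of_one_le_right (norm_nonneg _) (one_le_rpow_freqNorm hδ k)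

lemma memB_fourierSynthesis {δ : ℝ} (hδ : 1 ≤ δ) {a : Freq → ℂ} (hh : IsHermitian a)
    (ha : Summable fun k => ‖a k‖ * δ ^ freqNorm k) : MemB δ (fourierSynthesis a) := by
  have hsum := summable_norm_of_rpow hδ ha
  exact ⟨continuous_fourierSynthesis hsum,
    by simpa only [fourierCoef_fourierSynthesis hsum hh] using ha⟩

lemma bNorm_fourierSynthesis (δ : ℝ) {a : Freq → ℂ} (hh : IsHermitian a)
    (ha : Summable fun k => ‖a k‖) :
    bNorm δ (fourierSynthesis a) = ∑' k, ‖a k‖ * δ ^ freqNorm k := by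
  simp only [bNorm, fourierCoef_fourierSynthesis ha hh]

lemma MemB.summable {δ : ℝ} (hδ : 1 ≤ δ) {f : T3 → ℝ} (hf : MemB δ f) :
    Summable fun k => ‖fourierCoef f k‖ := summable_norm_of_rpow hδ hf.2

lemma MemB.fourierSynthesis_fourierCoef {δ : ℝ} (hδ : 1 ≤ δ) {f : T3 → ℝ} (hf : MemB δ f) :
    fourierSynthesis (fourierCoef f) = f :=
  VlasovMaxwell.fourierSynthesis_fourierCoef hf.1 (hf.summable hδ)

lemma MemB.norm_fourierCoef_le {δ : ℝ} (hδ : 0 < δ) {f : T3 → ℝ} (hf : MemB δ f) (k : Freq) :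
    ‖fourierCoef f k‖ ≤ bNorm δ f * Real.exp (-Real.log δ * freqNorm k) := by
  have h : ‖fourierCoef f k‖ * δ ^ freqNorm k ≤ bNorm δ f :=
    hf.2.le_tsum k fun j _ => mul_nonneg (norm_nonneg _) (rpow_freqNorm_pos hδ j).le
  rw [Real.rpow_def_of_pos hδ] at h
  rw [neg_mul, Real.exp_neg]
  exact (le_div_iff₀ (Real.exp_pos _)).2 h

lemma bNorm_nonneg {δ : ℝ} (hδ : 0 < δ) (f : T3 → ℝ) : 0 ≤ bNorm δ f :=
  tsum_nonneg fun k => mul_nonneg (norm_nonneg _) (rpow_freqNorm_pos hδ k).le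

lemma bNormVec_nonneg {δ : ℝ} (hδ : 0 < δ) (F : T3 → Fin 3 → ℝ) : 0 ≤ bNormVec δ F :=
  Finset.sum_nonneg fun _ _ => bNorm_nonneg hδ _

lemma bNormVec_le {δ c : ℝ} {F : T3 → Fin 3 → ℝ} (h : ∀ i, bNorm δ (fun x => F x i) ≤ c) :
    bNormVec δ F ≤ 3 * c :=
  (Finset.sum_le_card_nsmul _ _ c fun i _ => h i).trans_eq (by simp)

lemma bNorm_le_bNormVec {δ : ℝ} (hδ : 0 < δ) (F : T3 → Fin 3 → ℝ) (i : Fin 3) :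
    bNorm δ (fun x => F x i) ≤ bNormVec δ F :=
  Finset.single_le_sum (f := fun i => bNorm δ fun x => F x i)
    (fun _ _ => bNorm_nonneg hδ _) (Finset.mem_univ i)

/-! ### Time-dependent series -/

section TimeDependent

variable {E : Type*} [NormedAddCommGroup E] [NormedSpace ℝ E] [CompleteSpace E]

lemma exists_hasDerivAt_eqOn_Icc {f f' : ℝ → E} {a b : ℝ} (hab : a < b)
    (hf : ∀ t ∈ Icc a b, HasDerivWithinAt f (f' t) (Icc a b) t) (hc : ContinuousOn f' (Icc a b)) :
    ∃ g : ℝ → E, (∀ t, HasDerivAt g (f' (projIcc a b hab.le t)) t) ∧ EqOn g f (Icc a b) := by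
  have hcont : Continuous fun t => f' (projIcc a b hab.le t) :=
    (continuousOn_iff_continuous_domRestrict.1 hc).Icc_extend'
  have hderiv (t : ℝ) : HasDerivAt
      (fun s => f a + ∫ r in a..s, f' (projIcc a b hab.le r)) (f' (projIcc a b hab.le t)) t :=
    (hcont.integral_hasStrictDerivAt a t).hasDerivAt.const_add _
  refine ⟨_, hderiv, eq_of_derivWithin_eq
    (fun t _ => (hderiv t).differentiableAt.differentiableWithinAt)
    (fun t ht => (hf t ht).differentiableWithinAt) (fun t ht => ?_) (by simp)⟩
  have ht' := Ico_subset_Icc_self ht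
  have hu := uniqueDiffOn_Icc hab t ht'
  rw [(hderiv t).hasDerivWithinAt.derivWithin hu, (hf t ht').derivWithin hu,
    projIcc_of_mem hab.le ht']

lemma hasDerivWithinAt_tsum_Icc {ι : Type*} {f f' : ι → ℝ → E} {u : ι → ℝ} {a b : ℝ} (hab : a < b)
    (hf : ∀ i, ∀ t ∈ Icc a b, HasDerivWithinAt (f i) (f' i t) (Icc a b) t)
    (hc : ∀ i, ContinuousOn (f' i) (Icc a b)) (hu : Summable u)
    (hbound : ∀ i, ∀ t ∈ Icc a b, ‖f' i t‖ ≤ u i) (ha : Summable fun i => f i a)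
    {t : ℝ} (ht : t ∈ Icc a b) :
    HasDerivWithinAt (fun s => ∑' i, f i s) (∑' i, f' i t) (Icc a b) t := by
  choose g hg hgf using fun i => exists_hasDerivAt_eqOn_Icc hab (hf i) (hc i)
  have hga : Summable fun i => g i a := by simpa only [hgf _ (left_mem_Icc.2 hab.le)] using ha
  have hseries := hasDerivAt_tsum hu hg (fun i s => hbound i _ (projIcc a b hab.le s).2) hga t
  refine (hseries.hasDerivWithinAt.congr (fun s hs => ?_) ?_).congr_deriv ?_
  · simp only [hgf _ hs]
  · simp only [hgf _ ht]
  · simp only [projIcc_of_mem hab.le ht]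

lemma hasDerivWithinAt_fourierSynthesis {d : Type*} [Fintype d] {T : ℝ} (hT : 0 < T)
    {a a' : (d → ℤ) → ℝ → ℂ} {u : (d → ℤ) → ℝ}
    (ha : ∀ k, ∀ t ∈ Icc 0 T, HasDerivWithinAt (a k) (a' k t) (Icc 0 T) t)
    (hc : ∀ k, ContinuousOn (a' k) (Icc 0 T)) (hu : Summable u)
    (hbound : ∀ k, ∀ t ∈ Icc 0 T, ‖a' k t‖ ≤ u k) (h0 : Summable fun k => ‖a k 0‖)
    (x : UnitAddTorus d) {t : ℝ} (ht : t ∈ Icc 0 T) :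
    HasDerivWithinAt (fun s => fourierSynthesis (fun k => a k s) x)
      (fourierSynthesis (fun k => a' k t) x) (Icc 0 T) t := by
  have hseries := hasDerivWithinAt_tsum_Icc hT
    (f := fun k s => a k s * UnitAddTorus.mFourier k x)
    (f' := fun k s => a' k s * UnitAddTorus.mFourier k x) (fun k s hs => (ha k s hs).mul_const _)
    (fun k => (hc k).mul continuousOn_const) hu
    (fun k s hs => (norm_mul_mFourier _ _ _).trans_le (hbound k s hs))
    (summable_mul_mFourier h0 x) ht
  exact Complex.reCLM.hasFDerivAt.comp_hasDerivWithinAt t hseries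

end TimeDependent

/-! ### Measurability of integrals and series with a parameter -/

section Measurability

variable {M : Type*} [MeasurableSpace M] {μ : Measure M}
  {E : Type*} [NormedAddCommGroup E]

/- A Carathéodory family which is only almost everywhere measurable in `θ` has, off a null set
independent of `i`, a Carathéodory modification: it suffices to handle `i` in a countable dense
set. -/
lemma exists_stronglyMeasurable_modification {ι : Type*} [TopologicalSpace ι]
    [FrechetUrysohnSpace ι] [TopologicalSpace.SeparableSpace ι] {u : ι → M → E}
    (hc : ∀ θ, Continuous fun i => u i θ) (hm : ∀ i, AEStronglyMeasurable (u i) μ) :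
    ∃ w : ι → M → E, (∀ θ, Continuous fun i => w i θ) ∧ (∀ i, StronglyMeasurable (w i)) ∧
      ∀ᵐ θ ∂μ, ∀ i, u i θ = w i θ := by
  obtain ⟨D, hD, hdense⟩ := TopologicalSpace.exists_countable_dense ι
  have hae : ∀ᵐ θ ∂μ, ∀ d ∈ D, u d θ = (hm d).mk (u d) θ :=
    (ae_ball_iff hD).2 fun d _ => (hm d).ae_eq_mk
  obtain ⟨N, hsub, hN, hN0⟩ := exists_measurable_superset_of_null (ae_iff.1 hae)
  have heq : ∀ θ ∉ N, ∀ d ∈ D, u d θ = (hm d).mk (u d) θ := fun θ hθ => by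
    by_contra hne
    exact hθ (hsub hne)
  have hwc (θ : M) : Continuous fun i => Nᶜ.indicator (u i) θ := by
    by_cases hθ : θ ∈ N
    · simpa [hθ] using continuous_const
    · simpa [hθ] using hc θ
  have hwD : ∀ d ∈ D, StronglyMeasurable (Nᶜ.indicator (u d)) := fun d hd => by
    rw [indicator_congr (s := Nᶜ) fun θ hθ => heq θ hθ d hd]
    exact (hm d).stronglyMeasurable_mk.indicator hN.compl
  refine ⟨fun i => Nᶜ.indicator (u i), hwc, fun i => ?_, ?_⟩
  · obtain ⟨d, hd, hdi⟩ := mem_closure_iff_seq_limit.1 (hdense i)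
    exact stronglyMeasurable_of_tendsto atTop (fun n => hwD _ (hd n))
      (tendsto_pi_nhds.2 fun θ => ((hwc θ).tendsto i).comp hdi)
  · filter_upwards [measure_eq_zero_iff_ae_notMem.1 hN0] with θ hθ i
    simp [hθ]

lemma aestronglyMeasurable_integral_of_continuous [NormedSpace ℝ E] {ι : Type*}
    [TopologicalSpace ι] [TopologicalSpace.MetrizableSpace ι] [MeasurableSpace ι]
    [SecondCountableTopology ι] [OpensMeasurableSpace ι] (ν : Measure ι) [SFinite ν] {u : ι → M → E}
    (hc : ∀ θ, Continuous fun i => u i θ) (hm : ∀ i, AEStronglyMeasurable (u i) μ) :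
    AEStronglyMeasurable (fun θ => ∫ i, u i θ ∂ν) μ := by
  obtain ⟨w, hwc, hwm, huw⟩ := exists_stronglyMeasurable_modification hc hm
  have hjoint := stronglyMeasurable_uncurry_of_continuous_of_stronglyMeasurable hwc hwm
  refine ⟨fun θ => ∫ i, w i θ ∂ν, StronglyMeasurable.integral_prod_right (f := fun θ i => w i θ)
    (hjoint.comp_measurable measurable_swap), ?_⟩
  filter_upwards [huw] with θ hθ
  simp only [hθ]

lemma aestronglyMeasurable_tsum {ι : Type*} [Countable ι] {f : ι → M → E}
    (hm : ∀ j, AEStronglyMeasurable (f j) μ) (hs : ∀ θ, Summable fun j => f j θ) :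
    AEStronglyMeasurable (fun θ => ∑' j, f j θ) μ :=
  aestronglyMeasurable_of_tendsto_ae (atTop : Filter (Finset ι))
    (fun s => Finset.aestronglyMeasurable_fun_sum s fun j _ => hm j)
    (Eventually.of_forall fun θ => (hs θ).hasSum)

lemma integral_fourierSynthesis {d : Type*} [Fintype d] [IsFiniteMeasure μ] {a : M → (d → ℤ) → ℂ}
    {w : (d → ℤ) → ℝ} (hm : ∀ k, AEStronglyMeasurable (fun θ => a θ k) μ) (hw : Summable w)
    (ha : ∀ θ k, ‖a θ k‖ ≤ w k) (x : UnitAddTorus d) :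
    ∫ θ, fourierSynthesis (a θ) x ∂μ = fourierSynthesis (fun k => ∫ θ, a θ k ∂μ) x := by
  have hbound (k : d → ℤ) (θ : M) : ‖a θ k * UnitAddTorus.mFourier k x‖ ≤ w k := by
    simpa only [norm_mul_mFourier] using ha θ k
  have hint (k : d → ℤ) : Integrable (fun θ => a θ k * UnitAddTorus.mFourier k x) μ :=
    .of_bound ((hm k).mul_const _) (w k) (Eventually.of_forall (hbound k))
  have hsum (θ : M) : Summable fun k => a θ k * UnitAddTorus.mFourier k x :=
    .of_norm_bounded hw fun k => hbound k θ
  have hswap := hasSum_integral_of_dominated_convergence (fun k _ => w k)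
    (fun k => (hint k).1) (fun k => Eventually.of_forall (hbound k))
    (Eventually.of_forall fun _ => hw) (integrable_const _)
    (Eventually.of_forall fun θ => (hsum θ).hasSum)
  have hre := Complex.reCLM.integral_comp_comm (μ := μ)
    (.of_bound (aestronglyMeasurable_tsum (fun k => (hint k).1) hsum) (∑' k, w k)
      (Eventually.of_forall fun θ => tsum_of_norm_bounded hw.hasSum fun k => hbound k θ))
  refine hre.trans ?_
  rw [← hswap.tsum_eq]
  simp only [integral_mul_const, Complex.reCLM_apply, fourierSynthesis]

lemma IsHermitian.integral {G : Type*} [Neg G] {a : M → G → ℂ} (ha : ∀ θ, IsHermitian (a θ)) :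
    IsHermitian fun k => ∫ θ, a θ k ∂μ := fun k => by
  simp only [ha _ k, integral_conj]

lemma aestronglyMeasurable_fourierCoef {f : M → T3 → ℝ} (hc : ∀ θ, Continuous (f θ))
    (hm : ∀ x, AEStronglyMeasurable (fun θ => f θ x) μ) (k : Freq) :
    AEStronglyMeasurable (fun θ => fourierCoef (f θ) k) μ := by
  simp only [fourierCoef, mFourierCoeff_eq_integral_volume]
  refine aestronglyMeasurable_integral_of_continuous volume (fun θ => ?_) fun x => ?_
  · have := hc θ
    fun_prop
  · exact (Complex.continuous_ofReal.comp_aestronglyMeasurable (hm x)).const_mul _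

end Measurability

/-! ### The space of time-dependent families of Fourier coefficients -/

/- Since `exp (-l (t - s) x)` integrates to at most `1 / (l x)`, integrating in time absorbs the
derivative that the factor `1 + x` stands for. -/
lemma integral_one_add_mul_exp_le {l x t : ℝ} (hl : 0 < l) (hx : 0 ≤ x) (ht : 0 ≤ t) :
    ∫ s in (0 : ℝ)..t, (1 + x) * Real.exp (-(l * (t - s)) * x) ≤ t + 1 / l := by
  have hle : ∀ s ∈ Icc 0 t, (1 + x) * Real.exp (-(l * (t - s)) * x) ≤
      1 + x * Real.exp (-(l * (t - s)) * x) := fun s hs => by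
    have hexp : Real.exp (-(l * (t - s)) * x) ≤ 1 := by
      rw [Real.exp_le_one_iff, neg_mul, neg_nonpos]
      exact mul_nonneg (mul_nonneg hl.le (sub_nonneg.2 hs.2)) hx
    linarith
  have hderiv (s : ℝ) : HasDerivAt (fun s => s + 1 / l * Real.exp (-(l * (t - s)) * x))
      (1 + x * Real.exp (-(l * (t - s)) * x)) s := by
    refine ((hasDerivAt_id s).add
      (((((hasDerivAt_id s).const_sub t).const_mul l).neg.mul_const x).exp.const_mul
        (1 / l))).congr_deriv ?_
    simp only [one_div, id_eq, Pi.neg_apply, neg_mul, mul_neg, mul_one, neg_neg, add_right_inj]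
    field_simp
  calc ∫ s in (0 : ℝ)..t, (1 + x) * Real.exp (-(l * (t - s)) * x)
      ≤ ∫ s in (0 : ℝ)..t, (1 + x * Real.exp (-(l * (t - s)) * x)) :=
        intervalIntegral.integral_mono_on ht
          (Continuous.intervalIntegrable (by fun_prop) _ _)
          (Continuous.intervalIntegrable (by fun_prop) _ _) hle
    _ = t + 1 / l - 1 / l * Real.exp (-(l * t) * x) := by
        rw [intervalIntegral.integral_eq_sub_of_hasDerivAt (fun s _ => hderiv s)
          (Continuous.intervalIntegrable (by fun_prop) _ _)]
        simp
    _ ≤ t + 1 / l := sub_le_self _ (by positivity)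

/-- Parameters of the weights `exp (-(a - λ t) |k|)` on the time interval `[0, T]`: the strip of
analyticity of the unknowns shrinks from the width `a` with speed `λ`, and stays wider than `b`. -/
structure AnalyticScale where
  a : ℝ
  b : ℝ
  lam : ℝ
  T : ℝ
  b_pos : 0 < b
  lam_pos : 0 < lam
  T_pos : 0 < T
  lam_mul_le : lam * T ≤ a - b

namespace AnalyticScale

variable (P : AnalyticScale)

/-- The projection of the time axis to `[0, T]`, by which families on `[0, T]` are extended to all
times. -/
def clamp (t : ℝ) : ℝ := max 0 (min t P.T)

lemma continuous_clamp : Continuous P.clamp := by unfold clamp; fun_prop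

lemma clamp_mem (t : ℝ) : P.clamp t ∈ Icc 0 P.T :=
  ⟨le_max_left _ _, max_le P.T_pos.le (min_le_right _ _)⟩

lemma clamp_of_mem {t : ℝ} (ht : t ∈ Icc 0 P.T) : P.clamp t = t := by
  rw [clamp, min_eq_left ht.2, max_eq_right ht.1]

/-- The width of the analyticity strip at time `t`. -/
def width (t : ℝ) : ℝ := P.a - P.lam * P.clamp t

lemma b_le_width (t : ℝ) : P.b ≤ P.width t := by
  have h1 := (P.clamp_mem t).2
  have h2 := P.lam_pos
  have h3 := P.lam_mul_le
  have : P.lam * P.clamp t ≤ P.lam * P.T := by gcongr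
  unfold width
  linarith

lemma width_nonneg (t : ℝ) : 0 ≤ P.width t := P.b_pos.le.trans (P.b_le_width t)

lemma width_le (t : ℝ) : P.width t ≤ P.a := by
  have h1 := (P.clamp_mem t).1
  have h2 := P.lam_pos
  have : 0 ≤ P.lam * P.clamp t := by positivity
  unfold width
  linarith

/-- The weight of the frequency `k` at time `t`; the factor `polyWeight k` makes the weights
submultiplicative under convolution. -/
def weight (k : Freq) (t : ℝ) : ℝ := polyWeight k * Real.exp (-P.width t * freqNorm k)

lemma weight_pos (k : Freq) (t : ℝ) :
    0 < P.weight k t := mul_pos (polyWeight_pos k) (Real.exp_pos _)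

@[simp] lemma weight_neg (k : Freq) (t : ℝ) : P.weight (-k) t = P.weight k t := by simp [weight]

lemma weight_le (k : Freq) (t : ℝ) :
    P.weight k t ≤ polyWeight k * Real.exp (-P.b * freqNorm k) := by
  have := polyWeight_pos k
  have := P.b_le_width t
  have := freqNorm_nonneg k
  unfold weight
  gcongr

lemma weight_le_polyWeight (k : Freq) (t : ℝ) : P.weight k t ≤ polyWeight k := by
  have h : Real.exp (-P.width t * freqNorm k) ≤ 1 :=
    Real.exp_le_one_iff.2 (mul_nonpos_of_nonpos_of_nonneg (neg_nonpos.2 (P.width_nonneg t))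
      (freqNorm_nonneg k))
  exact mul_le_of_le_one_right (polyWeight_pos k).le h

lemma le_weight (k : Freq) (t : ℝ) :
    polyWeight k * Real.exp (-P.a * freqNorm k) ≤ P.weight k t := by
  have := polyWeight_pos k
  have := P.width_le t
  have := freqNorm_nonneg k
  unfold weight
  gcongr

lemma weight_mul_weight_le (j k : Freq) (t : ℝ) :
    P.weight j t * P.weight (k - j) t ≤
      polyWeight j * polyWeight (k - j) * Real.exp (-P.width t * freqNorm k) := by
  unfold weight
  have h1 := mul_pos (polyWeight_pos j) (polyWeight_pos (k - j))
  have h2 : Real.exp (-P.width t * freqNorm j) * Real.exp (-P.width t * freqNorm (k - j)) ≤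
      Real.exp (-P.width t * freqNorm k) := by
    rw [← Real.exp_add]
    apply Real.exp_le_exp.2
    nlinarith [freqNorm_le_add_sub j k, P.width_nonneg t]
  calc _ = (polyWeight j * polyWeight (k - j)) * (Real.exp (-P.width t * freqNorm j) *
        Real.exp (-P.width t * freqNorm (k - j))) := by ring
    _ ≤ _ := by gcongr

lemma summable_weight_mul_weight (k : Freq) (t : ℝ) :
    Summable fun j => P.weight j t * P.weight (k - j) t :=
  ((summable_polyWeight_mul k).mul_right _).of_nonneg_of_le
    (fun _ => (mul_pos (P.weight_pos _ _) (P.weight_pos _ _)).le) fun j =>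
      P.weight_mul_weight_le j k t

lemma tsum_weight_mul_weight_le (k : Freq) (t : ℝ) :
    ∑' j, P.weight j t * P.weight (k - j) t ≤ P.weight k t := by
  refine ((P.summable_weight_mul_weight k t).tsum_le_tsum (fun j => P.weight_mul_weight_le j k t)
    ((summable_polyWeight_mul k).mul_right _)).trans ?_
  rw [tsum_mul_right]
  exact mul_le_mul_of_nonneg_right (tsum_polyWeight_mul_le k) (Real.exp_pos _).le

lemma continuous_weight (k : Freq) : Continuous (P.weight k) := by
  have := P.continuous_clamp
  unfold weight width
  fun_prop

end AnalyticScale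

section Space

variable {M : Type*} [MeasurableSpace M]

/-- The families of Fourier coefficients of time-dependent real functions with a parameter `θ`, with
continuity in time and measurability in `θ`. -/
structure IsCoef (μ : Measure M) (f : Freq → ℝ → M → ℂ) : Prop where
  cont : ∀ k θ, Continuous fun t => f k t θ
  meas : ∀ k t, AEStronglyMeasurable (fun θ => f k t θ) μ
  herm : ∀ t θ, IsHermitian fun k => f k t θ

variable (μ : Measure M)

/-- The families that satisfy `IsCoef`, as a subspace of the space of bounded families. -/
def coefSubmodule : Submodule ℝ (lp (fun _ : Freq × ℝ × M => ℂ) ⊤) where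
  carrier := {U | IsCoef μ fun k t θ => U (k, t, θ)}
  zero_mem' := ⟨fun _ _ => continuous_const, fun _ _ => aestronglyMeasurable_const,
    fun _ _ _ => by simp⟩
  add_mem' := fun {U V} hU hV => ⟨fun k θ => (hU.cont k θ).add (hV.cont k θ),
    fun k t => (hU.meas k t).add (hV.meas k t),
    fun t θ k => by simpa using congrArg₂ (· + ·) (hU.herm t θ k) (hV.herm t θ k)⟩
  smul_mem' := fun c U hU => ⟨fun k θ => (hU.cont k θ).const_smul c,
    fun k t => (hU.meas k t).const_smul c,
    fun t θ k => by simpa using Or.inl (hU.herm t θ k)⟩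

/-- The Banach space in which the equations are solved: families of coefficients, stored divided by
their weights, so that the space itself does not depend on the weights. -/
def CoefSpace : Type _ := coefSubmodule μ

instance : NormedAddCommGroup (CoefSpace μ) :=
  inferInstanceAs (NormedAddCommGroup (coefSubmodule μ))

instance : NormedSpace ℝ (CoefSpace μ) := inferInstanceAs (NormedSpace ℝ (coefSubmodule μ))

lemma isClosed_coefSubmodule :
    IsClosed (coefSubmodule μ : Set (lp (fun _ : Freq × ℝ × M => ℂ) ⊤)) := by
  refine IsSeqClosed.isClosed fun U V hU hUV => ?_
  have hunif : TendstoUniformly (fun n (z : Freq × ℝ × M) => U n z) (fun z => V z) atTop := by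
    rw [Metric.tendstoUniformly_iff]
    intro ε hε
    filter_upwards [Metric.tendsto_nhds.1 hUV ε hε] with n hn z
    rw [dist_comm]
    refine lt_of_le_of_lt ?_ hn
    rw [dist_eq_norm, dist_eq_norm]
    exact lp.norm_apply_le_norm (by simp) (U n - V) z
  have hpt : ∀ z, Tendsto (fun n => U n z) atTop (𝓝 (V z)) := fun z => hunif.tendsto_at z
  refine ⟨fun k θ => ?_, fun k t => ?_, fun t θ k => ?_⟩
  · exact (hunif.comp fun t => (k, t, θ)).continuous (Frequently.of_forall fun n => (hU n).cont k θ)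
  · exact aestronglyMeasurable_of_tendsto_ae atTop (fun n => (hU n).meas k t)
      (Eventually.of_forall fun θ => hpt _)
  · refine tendsto_nhds_unique (hpt (-k, t, θ)) ?_
    have h2 := (Complex.continuous_conj.tendsto _).comp (hpt (k, t, θ))
    exact h2.congr fun n => ((hU n).herm t θ k).symm

instance : CompleteSpace (CoefSpace μ) :=
  (isClosed_coefSubmodule μ).completeSpace_coe

end Space

namespace AnalyticScale

variable (P : AnalyticScale) {M : Type*} [MeasurableSpace M] {μ : Measure M}

/-- The coefficients of an element of `CoefSpace μ`, which is stored divided by its weights. -/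
def coef (U : CoefSpace μ) (k : Freq) (t : ℝ) (θ : M) : ℂ := P.weight k t * U.1 (k, t, θ)

lemma isCoef_coef (U : CoefSpace μ) : IsCoef μ (P.coef U) where
  cont k θ := (Complex.continuous_ofReal.comp (P.continuous_weight k)).mul (U.2.cont k θ)
  meas k t := (U.2.meas k t).const_mul _
  herm t θ k := by
    have := U.2.herm t θ k
    simp only at this
    simp [coef, this]

lemma norm_coef_le (U : CoefSpace μ) (k : Freq) (t : ℝ) (θ : M) :
    ‖P.coef U k t θ‖ ≤ ‖U‖ * P.weight k t := by
  rw [coef, norm_mul, Complex.norm_real, Real.norm_of_nonneg (P.weight_pos k t).le, mul_comm]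
  have h : ‖U.1 (k, t, θ)‖ ≤ ‖U‖ := lp.norm_apply_le_norm (by simp) U.1 _
  exact mul_le_mul_of_nonneg_right h (P.weight_pos k t).le

lemma norm_le_of_coef (U : CoefSpace μ) {B : ℝ} (hB : 0 ≤ B)
    (h : ∀ k t θ, ‖P.coef U k t θ‖ ≤ B * P.weight k t) : ‖U‖ ≤ B := by
  refine lp.norm_le_of_forall_le hB fun z => ?_
  have h1 := h z.1 z.2.1 z.2.2
  rw [coef, norm_mul, Complex.norm_real, Real.norm_of_nonneg (P.weight_pos _ _).le, mul_comm] at h1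
  exact le_of_mul_le_mul_right h1 (P.weight_pos _ _)

lemma isCoef_normalized {f : Freq → ℝ → M → ℂ} (hf : IsCoef μ f) :
    IsCoef μ fun k t θ => ((P.weight k t)⁻¹ : ℝ) * f k t θ where
  cont k θ := (Complex.continuous_ofReal.comp
    ((P.continuous_weight k).inv₀ fun t => (P.weight_pos k t).ne')).mul (hf.cont k θ)
  meas k t := (hf.meas k t).const_mul _
  herm t θ k := by
    have := hf.herm t θ k
    simp only at this
    simp [this]

lemma memℓp_normalized {N : Type*} {f : Freq → ℝ → N → ℂ}
    (hB : ∃ B, ∀ k t θ, ‖f k t θ‖ ≤ B * P.weight k t) :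
    Memℓp (fun z : Freq × ℝ × N => (((P.weight z.1 z.2.1)⁻¹ : ℝ) : ℂ) * f z.1 z.2.1 z.2.2) ⊤ := by
  obtain ⟨B, hB⟩ := hB
  refine memℓp_infty ⟨B, ?_⟩
  rintro _ ⟨z, rfl⟩
  have h := P.weight_pos z.1 z.2.1
  simp only [norm_mul, Complex.norm_real, Real.norm_of_nonneg (inv_nonneg.2 h.le)]
  rw [inv_mul_le_iff₀ h, mul_comm]
  exact hB _ _ _

/-- The element of `CoefSpace μ` with prescribed coefficients. -/
def ofCoef (f : Freq → ℝ → M → ℂ) (hf : IsCoef μ f)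
    (hB : ∃ B, ∀ k t θ, ‖f k t θ‖ ≤ B * P.weight k t) : CoefSpace μ :=
  ⟨⟨_, P.memℓp_normalized hB⟩, P.isCoef_normalized hf⟩

@[simp] lemma coef_ofCoef (f : Freq → ℝ → M → ℂ) (hf : IsCoef μ f)
    (hB : ∃ B, ∀ k t θ, ‖f k t θ‖ ≤ B * P.weight k t) : P.coef (P.ofCoef f hf hB) = f := by
  funext k t θ
  have : (P.weight k t : ℂ) ≠ 0 := by exact_mod_cast (P.weight_pos k t).ne'
  simp [coef, ofCoef, this]

lemma coef_injective : Function.Injective (P.coef (μ := μ)) := by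
  intro U V h
  apply Subtype.ext
  apply lp.ext
  funext z
  have h1 : P.coef U z.1 z.2.1 z.2.2 = P.coef V z.1 z.2.1 z.2.2 := by rw [h]
  have : (P.weight z.1 z.2.1 : ℂ) ≠ 0 := by exact_mod_cast (P.weight_pos _ _).ne'
  exact mul_left_cancel₀ this h1

lemma coef_add (U V : CoefSpace μ) (k : Freq) (t : ℝ) (θ : M) :
    P.coef (U + V) k t θ = P.coef U k t θ + P.coef V k t θ :=
  mul_add (P.weight k t : ℂ) (U.1 (k, t, θ)) (V.1 (k, t, θ))

lemma coef_sub (U V : CoefSpace μ) (k : Freq) (t : ℝ) (θ : M) :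
    P.coef (U - V) k t θ = P.coef U k t θ - P.coef V k t θ :=
  mul_sub (P.weight k t : ℂ) (U.1 (k, t, θ)) (V.1 (k, t, θ))

lemma coef_neg (U : CoefSpace μ) (k : Freq) (t : ℝ) (θ : M) :
    P.coef (-U) k t θ = -P.coef U k t θ := mul_neg (P.weight k t : ℂ) (U.1 (k, t, θ))

lemma coef_zero (k : Freq) (t : ℝ) (θ : M) : P.coef (0 : CoefSpace μ) k t θ = 0 :=
  mul_zero (P.weight k t : ℂ)

lemma coef_smul (c : ℝ) (U : CoefSpace μ) (k : Freq) (t : ℝ) (θ : M) :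
    P.coef (c • U) k t θ = c * P.coef U k t θ := mul_left_comm (P.weight k t : ℂ) c (U.1 (k, t, θ))

lemma coef_sum {ι : Type*} (s : Finset ι) (U : ι → CoefSpace μ) (k : Freq) (t : ℝ) (θ : M) :
    P.coef (∑ i ∈ s, U i) k t θ = ∑ i ∈ s, P.coef (U i) k t θ := by
  classical
  induction s using Finset.induction_on with
  | empty => simp [coef_zero]
  | insert i s hi ih => rw [Finset.sum_insert hi, Finset.sum_insert hi, coef_add, ih]

lemma summable_coef (U : CoefSpace μ) (t : ℝ) (θ : M) : Summable fun k => ‖P.coef U k t θ‖ :=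
  (summable_polyWeight.mul_left ‖U‖).of_nonneg_of_le (fun _ => norm_nonneg _) fun k =>
    (P.norm_coef_le U k t θ).trans
      (mul_le_mul_of_nonneg_left (P.weight_le_polyWeight k t) (norm_nonneg _))

/-! ### Operators on the space of coefficients -/

/-- The operator on `CoefSpace μ` given by a map on families of coefficients. -/
def operator (F : CoefSpace μ → Freq → ℝ → M → ℂ) {C : ℝ} (hC : 0 ≤ C)
    (hF : ∀ U, IsCoef μ (F U))
    (hadd : ∀ U V k t θ, F (U + V) k t θ = F U k t θ + F V k t θ)
    (hsmul : ∀ (c : ℝ) U k t θ, F (c • U) k t θ = c * F U k t θ)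
    (hbound : ∀ U k t θ, ‖F U k t θ‖ ≤ C * ‖U‖ * P.weight k t) : CoefSpace μ →L[ℝ] CoefSpace μ :=
  LinearMap.mkContinuous
    { toFun := fun U => P.ofCoef (F U) (hF U) ⟨_, hbound U⟩
      map_add' := fun U V => P.coef_injective (by
        funext k t θ
        simp only [coef_add, coef_ofCoef, hadd])
      map_smul' := fun c U => P.coef_injective (by
        funext k t θ
        simp only [coef_smul, coef_ofCoef, RingHom.id_apply, hsmul]) }
    C fun U => P.norm_le_of_coef _ (mul_nonneg hC (norm_nonneg _)) fun k t θ => by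
      simpa using hbound U k t θ

section Operator

variable {F : CoefSpace μ → Freq → ℝ → M → ℂ} {C : ℝ} {hC : 0 ≤ C} {hF : ∀ U, IsCoef μ (F U)}
  {hadd : ∀ U V k t θ, F (U + V) k t θ = F U k t θ + F V k t θ}
  {hsmul : ∀ (c : ℝ) U k t θ, F (c • U) k t θ = c * F U k t θ}
  {hbound : ∀ U k t θ, ‖F U k t θ‖ ≤ C * ‖U‖ * P.weight k t}

lemma coef_operator (U : CoefSpace μ) (k : Freq) (t : ℝ) (θ : M) :
    P.coef (P.operator F hC hF hadd hsmul hbound U) k t θ = F U k t θ := by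
  simp [operator]

lemma norm_operator_apply_le (U : CoefSpace μ) :
    ‖P.operator F hC hF hadd hsmul hbound U‖ ≤ C * ‖U‖ :=
  P.norm_le_of_coef _ (mul_nonneg hC (norm_nonneg _)) fun k t θ => by
    simpa only [coef_operator] using hbound U k t θ

end Operator

lemma norm_coef_mul_coef_le (U V : CoefSpace μ) (j k : Freq) (t : ℝ) (θ : M) :
    ‖P.coef U j t θ * P.coef V (k - j) t θ‖ ≤ ‖U‖ * ‖V‖ * (P.weight j t * P.weight (k - j) t) := by
  rw [norm_mul]
  calc _ ≤ (‖U‖ * P.weight j t) * (‖V‖ * P.weight (k - j) t) := by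
        have := P.weight_pos j t
        gcongr <;> exact P.norm_coef_le _ _ _ _
    _ = _ := by ring

lemma norm_coef_mul_coef_le_polyWeight (U V : CoefSpace μ) (j k : Freq) (t : ℝ) (θ : M) :
    ‖P.coef U j t θ * P.coef V (k - j) t θ‖ ≤ ‖U‖ * ‖V‖ * (polyWeight j * polyWeight (k - j)) := by
  refine (P.norm_coef_mul_coef_le U V j k t θ).trans ?_
  have := P.weight_pos (k - j) t
  have := polyWeight_pos j
  gcongr <;> exact P.weight_le_polyWeight _ _

lemma summable_coef_mul_coef (U V : CoefSpace μ) (k : Freq) (t : ℝ) (θ : M) :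
    Summable fun j => P.coef U j t θ * P.coef V (k - j) t θ :=
  Summable.of_norm_bounded ((P.summable_weight_mul_weight k t).mul_left _) fun j =>
    P.norm_coef_mul_coef_le U V j k t θ

lemma norm_coefConv_le (U V : CoefSpace μ) (k : Freq) (t : ℝ) (θ : M) :
    ‖coefConv (fun j => P.coef U j t θ) (fun j => P.coef V j t θ) k‖ ≤
      ‖U‖ * ‖V‖ * P.weight k t := by
  refine (tsum_of_norm_bounded ((P.summable_weight_mul_weight k t).mul_left _).hasSum fun j =>
    P.norm_coef_mul_coef_le U V j k t θ).trans ?_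
  rw [tsum_mul_left]
  exact mul_le_mul_of_nonneg_left (P.tsum_weight_mul_weight_le k t) (by positivity)

lemma isCoef_coefConv (U V : CoefSpace μ) :
    IsCoef μ fun k t θ => coefConv (fun j => P.coef U j t θ) (fun j => P.coef V j t θ) k where
  cont k θ := continuous_tsum
    (fun j => ((P.isCoef_coef U).cont j θ).mul ((P.isCoef_coef V).cont (k - j) θ))
    ((summable_polyWeight_mul k).mul_left _) fun j t =>
      P.norm_coef_mul_coef_le_polyWeight U V j k t θ
  meas k t := aestronglyMeasurable_tsum
    (fun j => ((P.isCoef_coef U).meas j t).mul ((P.isCoef_coef V).meas (k - j) t))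
    fun θ => P.summable_coef_mul_coef U V k t θ
  herm t θ k := by
    simp only [coefConv]
    rw [← (Equiv.neg Freq).tsum_eq, Complex.conj_tsum]
    refine tsum_congr fun j => ?_
    have h1 := (P.isCoef_coef U).herm t θ j
    have h2 := (P.isCoef_coef V).herm t θ (k - j)
    simp only at h1 h2
    rw [Equiv.neg_apply, map_mul, ← h1, ← h2]
    congr 2
    abel

/-- The product, whose coefficients are given by a convolution. -/
def mul : CoefSpace μ →L[ℝ] CoefSpace μ →L[ℝ] CoefSpace μ :=
  LinearMap.mkContinuous₂
    (LinearMap.mk₂ ℝ (fun U V => P.ofCoef _ (P.isCoef_coefConv U V)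
        ⟨_, P.norm_coefConv_le U V⟩)
      (fun U U' V => P.coef_injective (by
        funext k t θ
        simp only [coef_add, coef_ofCoef, coefConv, add_mul]
        exact (P.summable_coef_mul_coef U V k t θ).tsum_add (P.summable_coef_mul_coef U' V k t θ)))
      (fun c U V => P.coef_injective (by
        funext k t θ
        simp only [coef_smul, coef_ofCoef, coefConv, mul_assoc, tsum_mul_left]))
      (fun U V V' => P.coef_injective (by
        funext k t θ
        simp only [coef_add, coef_ofCoef, coefConv, mul_add]
        exact (P.summable_coef_mul_coef U V k t θ).tsum_add (P.summable_coef_mul_coef U V' k t θ)))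
      (fun c U V => P.coef_injective (by
        funext k t θ
        simp only [coef_smul, coef_ofCoef, coefConv, mul_left_comm _ (c : ℂ), tsum_mul_left])))
    1 fun U V => by
      rw [one_mul]
      refine P.norm_le_of_coef _ (by positivity) fun k t θ => ?_
      simpa using P.norm_coefConv_le U V k t θ

@[simp] lemma coef_mul (U V : CoefSpace μ) (k : Freq) (t : ℝ) (θ : M) :
    P.coef (P.mul U V) k t θ = coefConv (fun j => P.coef U j t θ) (fun j => P.coef V j t θ) k := by
  simp [mul]

lemma norm_mul_le (U V : CoefSpace μ) : ‖P.mul U V‖ ≤ ‖U‖ * ‖V‖ := by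
  refine P.norm_le_of_coef _ (by positivity) fun k t θ => ?_
  simpa using P.norm_coefConv_le U V k t θ

/-- Bounded symbols of operators that preserve real functions. -/
structure IsSymbol (H : ℝ) (p : Freq → ℂ) : Prop where
  herm : IsHermitian p
  bound : ∀ k, ‖p k‖ ≤ H

lemma IsSymbol.nonneg {H : ℝ} {p : Freq → ℂ} (hp : IsSymbol H p) : 0 ≤ H :=
  (norm_nonneg _).trans (hp.bound 0)

lemma isCoef_multiplier {H : ℝ} {p : Freq → ℂ} (hp : IsSymbol H p) (U : CoefSpace μ) :
    IsCoef μ fun k t θ => p k * P.coef U k t θ where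
  cont k θ := ((P.isCoef_coef U).cont k θ).const_mul _
  meas k t := ((P.isCoef_coef U).meas k t).const_mul _
  herm t θ := hp.herm.mul ((P.isCoef_coef U).herm t θ)

lemma norm_multiplier_le {H : ℝ} {p : Freq → ℂ} (hp : IsSymbol H p) (U : CoefSpace μ)
    (k : Freq) (t : ℝ) (θ : M) : ‖p k * P.coef U k t θ‖ ≤ H * ‖U‖ * P.weight k t := by
  rw [norm_mul, mul_assoc]
  exact mul_le_mul (hp.bound k) (P.norm_coef_le U k t θ) (norm_nonneg _) hp.nonneg

/-- The Fourier multiplier with symbol `p`. -/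
def multiplier {H : ℝ} {p : Freq → ℂ} (hp : IsSymbol H p) : CoefSpace μ →L[ℝ] CoefSpace μ :=
  P.operator (fun U k t θ => p k * P.coef U k t θ) hp.nonneg (P.isCoef_multiplier hp)
    (fun U V k t θ => by simp only [coef_add, mul_add])
    (fun c U k t θ => by simp only [coef_smul, mul_left_comm])
    (P.norm_multiplier_le hp)

@[simp] lemma coef_multiplier {H : ℝ} {p : Freq → ℂ} (hp : IsSymbol H p) (U : CoefSpace μ)
    (k : Freq) (t : ℝ) (θ : M) : P.coef (P.multiplier hp U) k t θ = p k * P.coef U k t θ :=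
  P.coef_operator U k t θ

lemma norm_multiplier_apply_le {H : ℝ} {p : Freq → ℂ} (hp : IsSymbol H p) (U : CoefSpace μ) :
    ‖P.multiplier hp U‖ ≤ H * ‖U‖ := P.norm_operator_apply_le U

variable [IsProbabilityMeasure μ]

lemma integrable_coef (U : CoefSpace μ) (k : Freq) (t : ℝ) :
    Integrable (fun θ => P.coef U k t θ) μ :=
  Integrable.of_bound ((P.isCoef_coef U).meas k t) _
    (Eventually.of_forall fun θ => P.norm_coef_le U k t θ)

lemma norm_average_le (U : CoefSpace μ) (k : Freq) (t : ℝ) :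
    ‖∫ θ, P.coef U k t θ ∂μ‖ ≤ ‖U‖ * P.weight k t := by
  have := norm_integral_le_of_norm_le_const (μ := μ)
    (Eventually.of_forall fun θ => P.norm_coef_le U k t θ)
  simpa using this

lemma isCoef_average (U : CoefSpace μ) :
    IsCoef μ fun k t _ => ∫ θ, P.coef U k t θ ∂μ where
  cont k _ := continuous_of_dominated (bound := fun _ => ‖U‖ * polyWeight k)
    (fun t => (P.isCoef_coef U).meas k t)
    (fun t => Eventually.of_forall fun θ => (P.norm_coef_le U k t θ).trans
      (mul_le_mul_of_nonneg_left (P.weight_le_polyWeight k t) (norm_nonneg _)))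
    (integrable_const _) (Eventually.of_forall fun θ => (P.isCoef_coef U).cont k θ)
  meas _ _ := aestronglyMeasurable_const
  herm t _ := IsHermitian.integral fun θ => (P.isCoef_coef U).herm t θ

/-- The average over the parameter `θ`. -/
def average : CoefSpace μ →L[ℝ] CoefSpace μ :=
  P.operator (fun U k t _ => ∫ θ, P.coef U k t θ ∂μ) zero_le_one P.isCoef_average
    (fun U V k t _ => by
      simp only [coef_add, integral_add (P.integrable_coef U k t) (P.integrable_coef V k t)])
    (fun c U k t _ => by simp only [coef_smul, integral_const_mul])
    (fun U k t _ => by simpa only [one_mul] using P.norm_average_le U k t)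

@[simp] lemma coef_average (U : CoefSpace μ) (k : Freq) (t : ℝ) (θ : M) :
    P.coef (P.average U) k t θ = ∫ θ', P.coef U k t θ' ∂μ := P.coef_operator U k t θ

lemma norm_average_apply_le (U : CoefSpace μ) : ‖P.average U‖ ≤ ‖U‖ :=
  (P.norm_operator_apply_le U).trans_eq (one_mul _)

end AnalyticScale

/-! ### Convolution in time -/

namespace AnalyticScale

variable (P : AnalyticScale) {M : Type*} [MeasurableSpace M] {μ : Measure M}

/-- Convolution kernels in time that lose at most one derivative. -/
structure IsKernel (H : ℝ) (h : Freq → ℝ → ℂ) : Prop where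
  nonneg : 0 ≤ H
  cont : ∀ k, Continuous (h k)
  herm : ∀ t, IsHermitian fun k => h k t
  bound : ∀ k, ∀ t ∈ Icc 0 P.T, ‖h k t‖ ≤ H * (1 + freqNorm k)

/-- The norm of an integration in time against a kernel that loses one derivative; it is small when
`T` is small and `λ` is large. -/
def gain : ℝ := P.T + 1 / P.lam

lemma gain_nonneg : 0 ≤ P.gain := by
  have := P.T_pos
  have := P.lam_pos
  unfold gain
  positivity

lemma weight_eq_mul {s t : ℝ} (hs : s ∈ Icc 0 P.T) (k : Freq) :
    P.weight k s = P.weight k t * Real.exp (-(P.lam * (P.clamp t - s)) * freqNorm k) := by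
  unfold weight width
  rw [P.clamp_of_mem hs, mul_assoc, ← Real.exp_add]
  congr 2
  ring

variable {P} {H : ℝ} {h : Freq → ℝ → ℂ}

lemma continuous_kernel_mul (hh : P.IsKernel H h) (U : CoefSpace μ) (k : Freq) (t : ℝ) (θ : M) :
    Continuous fun s => h k (P.clamp t - s) * P.coef U k s θ :=
  ((hh.cont k).comp (by fun_prop)).mul ((P.isCoef_coef U).cont k θ)

lemma norm_duhamel_le (hh : P.IsKernel H h) (U : CoefSpace μ) (k : Freq) (t : ℝ) (θ : M) :
    ‖∫ s in (0 : ℝ)..P.clamp t, h k (P.clamp t - s) * P.coef U k s θ‖ ≤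
      H * P.gain * ‖U‖ * P.weight k t := by
  have hc := P.clamp_mem t
  have hk := freqNorm_nonneg k
  have hle : ∀ s ∈ Ioc 0 (P.clamp t), ‖h k (P.clamp t - s) * P.coef U k s θ‖ ≤
      H * ‖U‖ * P.weight k t * ((1 + freqNorm k) *
        Real.exp (-(P.lam * (P.clamp t - s)) * freqNorm k)) := by
    intro s hs
    have hs' : s ∈ Icc 0 P.T := ⟨hs.1.le, hs.2.trans hc.2⟩
    have h1 := hh.bound k (P.clamp t - s) ⟨sub_nonneg.2 hs.2, by linarith [hs.1, hc.2]⟩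
    have h2 := P.norm_coef_le U k s θ
    rw [P.weight_eq_mul (t := t) hs'] at h2
    rw [norm_mul]
    have hH := hh.nonneg
    calc _ ≤ (H * (1 + freqNorm k)) * (‖U‖ * (P.weight k t *
          Real.exp (-(P.lam * (P.clamp t - s)) * freqNorm k))) :=
          mul_le_mul h1 h2 (norm_nonneg _) (by positivity)
      _ = _ := by ring
  refine (intervalIntegral.norm_integral_le_of_norm_le hc.1
    (Eventually.of_forall hle) (Continuous.intervalIntegrable (by fun_prop) _ _)).trans ?_
  rw [intervalIntegral.integral_const_mul]
  have h3 := (integral_one_add_mul_exp_le P.lam_pos hk hc.1).trans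
    (add_le_add_left hc.2 (1 / P.lam))
  have h4 : 0 ≤ H * ‖U‖ * P.weight k t :=
    mul_nonneg (mul_nonneg hh.nonneg (norm_nonneg _)) (P.weight_pos k t).le
  calc _ ≤ H * ‖U‖ * P.weight k t * P.gain := mul_le_mul_of_nonneg_left h3 h4
    _ = _ := by ring

lemma isCoef_duhamel (hh : P.IsKernel H h) (U : CoefSpace μ) :
    IsCoef μ fun k t θ => ∫ s in (0 : ℝ)..P.clamp t, h k (P.clamp t - s) * P.coef U k s θ where
  cont k θ := by
    have hcl := P.continuous_clamp
    refine intervalIntegral.continuous_parametric_intervalIntegral_of_continuous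
      (f := fun t s => h k (P.clamp t - s) * P.coef U k s θ) ?_ hcl
    have h1 := hh.cont k
    have h2 := (P.isCoef_coef U).cont k θ
    exact (h1.comp ((hcl.comp continuous_fst).sub continuous_snd)).mul (h2.comp continuous_snd)
  meas k t := by
    simp only [intervalIntegral.integral_of_le (P.clamp_mem t).1]
    exact aestronglyMeasurable_integral_of_continuous _
      (fun θ => continuous_kernel_mul hh U k t θ)
      fun s => ((P.isCoef_coef U).meas k s).const_mul _
  herm t θ := by
    simp only [intervalIntegral.integral_of_le (P.clamp_mem t).1]
    exact IsHermitian.integral fun s => (hh.herm _).mul ((P.isCoef_coef U).herm s θ)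

/-- The time convolution with a kernel. -/
def duhamel (hh : P.IsKernel H h) : CoefSpace μ →L[ℝ] CoefSpace μ :=
  P.operator
    (fun U k t θ => ∫ s in (0 : ℝ)..P.clamp t, h k (P.clamp t - s) * P.coef U k s θ)
    (mul_nonneg hh.nonneg P.gain_nonneg) (isCoef_duhamel hh)
    (fun U V k t θ => by
      simp only [coef_add, mul_add, intervalIntegral.integral_add
        ((continuous_kernel_mul hh U k t θ).intervalIntegrable _ _)
        ((continuous_kernel_mul hh V k t θ).intervalIntegrable _ _)])
    (fun c U k t θ => by
      simp only [coef_smul, mul_left_comm _ (c : ℂ), intervalIntegral.integral_const_mul])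
    (norm_duhamel_le hh)

@[simp] lemma coef_duhamel (hh : P.IsKernel H h) (U : CoefSpace μ) (k : Freq) (t : ℝ) (θ : M) :
    P.coef (duhamel hh U) k t θ =
      ∫ s in (0 : ℝ)..P.clamp t, h k (P.clamp t - s) * P.coef U k s θ := P.coef_operator U k t θ

lemma norm_duhamel_apply_le (hh : P.IsKernel H h) (U : CoefSpace μ) :
    ‖duhamel hh U‖ ≤ H * P.gain * ‖U‖ := P.norm_operator_apply_le U

end AnalyticScale

/-! ### The wave propagators -/

/-- The angular frequency `2 π |k|`. -/
def angularFreq (k : Freq) : ℝ := 2 * Real.pi * freqNorm k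

lemma angularFreq_nonneg (k : Freq) : 0 ≤ angularFreq k := by
  have := freqNorm_nonneg k
  have := Real.pi_pos
  unfold angularFreq
  positivity

lemma angularFreq_pos {k : Freq} (hk : k ≠ 0) : 0 < angularFreq k := by
  have := one_le_freqNorm hk
  have := Real.pi_pos
  unfold angularFreq
  positivity

@[simp] lemma angularFreq_zero : angularFreq 0 = 0 := by simp [angularFreq]

@[simp] lemma angularFreq_neg (k : Freq) : angularFreq (-k) = angularFreq k := by simp [angularFreq]

lemma one_le_angularFreq {k : Freq} (hk : k ≠ 0) : 1 ≤ angularFreq k := by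
  have := one_le_freqNorm hk
  have := Real.pi_gt_three
  unfold angularFreq
  nlinarith

/-- The Fourier multiplier of the cosine propagator of `ε² ∂ₜ² + |2πk|²`. -/
def waveCos (ε : ℝ) (k : Freq) (t : ℝ) : ℝ := Real.cos (angularFreq k * t / ε)

/-- The Fourier multiplier of the sine propagator of `ε² ∂ₜ² + |2πk|²`; at `k = 0` it is the limit
`t / ε` of `sin (|2πk| t / ε) / |2πk|`. -/
def waveSin (ε : ℝ) (k : Freq) (t : ℝ) : ℝ :=
  if k = 0 then t / ε else Real.sin (angularFreq k * t / ε) / angularFreq k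

@[simp] lemma waveCos_neg (ε : ℝ) (k : Freq) (t : ℝ) :
    waveCos ε (-k) t = waveCos ε k t := by simp [waveCos]

@[simp] lemma waveSin_neg (ε : ℝ) (k : Freq) (t : ℝ) :
    waveSin ε (-k) t = waveSin ε k t := by simp [waveSin]

lemma continuous_waveCos (ε : ℝ) (k : Freq) : Continuous (waveCos ε k) := by
  unfold waveCos
  fun_prop

lemma continuous_waveSin (ε : ℝ) (k : Freq) : Continuous (waveSin ε k) := by
  unfold waveSin
  split_ifs <;> fun_prop

lemma abs_waveCos_le (ε : ℝ) (k : Freq) (t : ℝ) : |waveCos ε k t| ≤ 1 := Real.abs_cos_le_one _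

lemma angularFreq_mul_abs_waveSin_le (ε : ℝ) (k : Freq) (t : ℝ) :
    angularFreq k * |waveSin ε k t| ≤ 1 := by
  unfold waveSin
  split_ifs with hk
  · simp [hk]
  · rw [abs_div, abs_of_pos (angularFreq_pos hk), mul_div_cancel₀ _ (angularFreq_pos hk).ne']
    exact Real.abs_sin_le_one _

lemma abs_waveSin_le_one {ε : ℝ} {k : Freq} (hk : k ≠ 0) (t : ℝ) : |waveSin ε k t| ≤ 1 := by
  have h1 := angularFreq_mul_abs_waveSin_le ε k t
  have h2 := one_le_angularFreq hk
  nlinarith [abs_nonneg (waveSin ε k t)]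

@[simp] lemma waveCos_zero (ε : ℝ) (k : Freq) : waveCos ε k 0 = 1 := by simp [waveCos]

@[simp] lemma waveSin_zero (ε : ℝ) (k : Freq) : waveSin ε k 0 = 0 := by simp [waveSin]

lemma hasDerivAt_waveCos (ε : ℝ) (k : Freq) (t : ℝ) :
    HasDerivAt (waveCos ε k) (-(angularFreq k ^ 2 / ε) * waveSin ε k t) t := by
  have h := (((hasDerivAt_id t).const_mul (angularFreq k)).div_const ε).cos
  refine h.congr_deriv ?_
  unfold waveSin
  split_ifs with hk
  · simp [hk]
  · have := angularFreq_pos hk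
    simp only [id_eq, mul_one, neg_mul, neg_inj]
    field_simp

lemma hasDerivAt_waveSin (ε : ℝ) (k : Freq) (t : ℝ) :
    HasDerivAt (waveSin ε k) (waveCos ε k t / ε) t := by
  by_cases hk : k = 0
  · have h := (hasDerivAt_id t).div_const ε
    have e : waveSin ε k = fun x => id x / ε := by funext x; simp [waveSin, hk]
    rw [e]
    exact h.congr_deriv (by simp [waveCos, hk])
  · have h :=
    (((hasDerivAt_id t).const_mul (angularFreq k)).div_const ε).sin.div_const (angularFreq k)
    have e : waveSin ε k = fun x => Real.sin (angularFreq k * id x / ε) / angularFreq k := by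
      funext x; simp [waveSin, hk]
    rw [e]
    refine h.congr_deriv ?_
    have := angularFreq_pos hk
    simp only [id_eq, mul_one, waveCos]
    field_simp

lemma waveSin_sub (ε : ℝ) (k : Freq) (t s : ℝ) :
    waveSin ε k (t - s) = waveSin ε k t * waveCos ε k s - waveCos ε k t * waveSin ε k s := by
  unfold waveSin waveCos
  split_ifs with hk
  · simp [hk]; ring
  · rw [mul_sub, sub_div, Real.sin_sub]; ring

lemma waveCos_sub (ε : ℝ) (k : Freq) (t s : ℝ) :
    waveCos ε k (t - s) = waveCos ε k t * waveCos ε k s + angularFreq k ^ 2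
      * (waveSin ε k t * waveSin ε k s) := by
  unfold waveSin waveCos
  split_ifs with hk
  · simp [hk]
  · have := angularFreq_pos hk
    rw [mul_sub, sub_div, Real.cos_sub]
    field_simp

lemma waveCos_sq_add (ε : ℝ) (k : Freq) (t : ℝ) :
    waveCos ε k t ^ 2 + angularFreq k ^ 2 * waveSin ε k t ^ 2 = 1 := by
  have := waveCos_sub ε k t t
  rw [sub_self, waveCos_zero] at this
  rw [this]
  ring

section Duhamel

variable {f : ℝ → ℂ}

lemma continuous_waveCos_mul (hf : Continuous f) (ε : ℝ) (k : Freq) :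
    Continuous fun s => (waveCos ε k s : ℂ) * f s :=
  (Complex.continuous_ofReal.comp (continuous_waveCos ε k)).mul hf

lemma continuous_waveSin_mul (hf : Continuous f) (ε : ℝ) (k : Freq) :
    Continuous fun s => (waveSin ε k s : ℂ) * f s :=
  (Complex.continuous_ofReal.comp (continuous_waveSin ε k)).mul hf

lemma integral_waveSin_sub_mul (hf : Continuous f) (ε : ℝ) (k : Freq) (t : ℝ) :
    ∫ s in (0 : ℝ)..t, (waveSin ε k (t - s) : ℂ) * f s =
      waveSin ε k t * (∫ s in (0 : ℝ)..t, (waveCos ε k s : ℂ) * f s)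
        - waveCos ε k t * ∫ s in (0 : ℝ)..t, (waveSin ε k s : ℂ) * f s := by
  rw [← intervalIntegral.integral_const_mul, ← intervalIntegral.integral_const_mul,
    ← intervalIntegral.integral_sub
      (((continuous_waveCos_mul hf ε k).const_mul _).intervalIntegrable _ _)
      (((continuous_waveSin_mul hf ε k).const_mul _).intervalIntegrable _ _)]
  congr 1
  funext s
  rw [waveSin_sub]
  push_cast
  ring

lemma integral_waveCos_sub_mul (hf : Continuous f) (ε : ℝ) (k : Freq) (t : ℝ) :
    ∫ s in (0 : ℝ)..t, (waveCos ε k (t - s) : ℂ) * f s =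
      waveCos ε k t * (∫ s in (0 : ℝ)..t, (waveCos ε k s : ℂ) * f s)
        + angularFreq k ^ 2 * waveSin ε k t * ∫ s in (0 : ℝ)..t, (waveSin ε k s : ℂ) * f s := by
  rw [← intervalIntegral.integral_const_mul, ← intervalIntegral.integral_const_mul,
    ← intervalIntegral.integral_add
      (((continuous_waveCos_mul hf ε k).const_mul _).intervalIntegrable _ _)
      (((continuous_waveSin_mul hf ε k).const_mul _).intervalIntegrable _ _)]
  congr 1
  funext s
  rw [waveCos_sub]
  push_cast
  ring

lemma hasDerivAt_integral_waveSin (hf : Continuous f) (ε : ℝ) (k : Freq) (t : ℝ) :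
    HasDerivAt (fun t => ∫ s in (0 : ℝ)..t, (waveSin ε k (t - s) : ℂ) * f s)
      ((ε : ℂ)⁻¹ * ∫ s in (0 : ℝ)..t, (waveCos ε k (t - s) : ℂ) * f s) t := by
  have hC := ((continuous_waveCos_mul hf ε k).integral_hasStrictDerivAt 0 t).hasDerivAt
  have hS := ((continuous_waveSin_mul hf ε k).integral_hasStrictDerivAt 0 t).hasDerivAt
  have d := ((hasDerivAt_waveSin ε k t).ofReal_comp.mul hC).sub
    ((hasDerivAt_waveCos ε k t).ofReal_comp.mul hS)
  rw [funext (integral_waveSin_sub_mul hf ε k), integral_waveCos_sub_mul hf]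
  refine d.congr_deriv ?_
  push_cast
  ring

lemma hasDerivAt_integral_waveCos (hf : Continuous f) (ε : ℝ) (k : Freq) (t : ℝ) :
    HasDerivAt (fun t => ∫ s in (0 : ℝ)..t, (waveCos ε k (t - s) : ℂ) * f s)
      (f t - angularFreq k ^ 2 * (ε : ℂ)⁻¹ *
        ∫ s in (0 : ℝ)..t, (waveSin ε k (t - s) : ℂ) * f s) t := by
  have hC := ((continuous_waveCos_mul hf ε k).integral_hasStrictDerivAt 0 t).hasDerivAt
  have hS := ((continuous_waveSin_mul hf ε k).integral_hasStrictDerivAt 0 t).hasDerivAt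
  have d := ((hasDerivAt_waveCos ε k t).ofReal_comp.mul hC).add
    (((hasDerivAt_waveSin ε k t).ofReal_comp.const_mul ((angularFreq k : ℂ) ^ 2)).mul hS)
  rw [funext (integral_waveCos_sub_mul hf ε k), integral_waveSin_sub_mul hf]
  refine d.congr_deriv ?_
  have key : (waveCos ε k t : ℂ) ^ 2 + (angularFreq k : ℂ) ^ 2 * (waveSin ε k t : ℂ) ^ 2 = 1 := by
    exact_mod_cast waveCos_sq_add ε k t
  push_cast
  linear_combination f t * key

end Duhamel

open AnalyticScale

/-! ### Symbols of the operators of the system -/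

/-- The symbol of the Leray projection. -/
def leraySymbol (i j : Fin 3) (k : Freq) : ℂ :=
  ((if i = j then 1 else 0) - (k i : ℝ) * (k j : ℝ) / freqNorm k ^ 2 : ℝ)

/-- The symbol of the curl. -/
def curlSymbol (i l : Fin 3) (k : Freq) : ℂ :=
  if l = i + 2 then derivSymbol (i + 1) k else if l = i + 1 then -derivSymbol (i + 2) k else 0

lemma norm_derivSymbol_le_angularFreq (i : Fin 3) (k : Freq) : ‖derivSymbol i k‖ ≤ angularFreq k :=
  norm_derivSymbol_le i k

lemma norm_curlSymbol_le (i l : Fin 3) (k : Freq) : ‖curlSymbol i l k‖ ≤ angularFreq k := by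
  unfold curlSymbol
  split_ifs
  · exact norm_derivSymbol_le_angularFreq _ _
  · rw [norm_neg]
    exact norm_derivSymbol_le_angularFreq _ _
  · simpa using angularFreq_nonneg k

lemma isHermitian_derivSymbol (i : Fin 3) :
    IsHermitian (derivSymbol i) := fun k => derivSymbol_neg i k

lemma isHermitian_curlSymbol (i l : Fin 3) : IsHermitian (curlSymbol i l) := by
  intro k
  unfold curlSymbol
  split_ifs <;> simp [derivSymbol_neg]

lemma isHermitian_ofReal {f : Freq → ℝ} (hf : ∀ k, f (-k) = f k) :
    IsHermitian fun k => (f k : ℂ) := by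
  intro k
  simp [hf]

lemma isSymbol_leraySymbol (i j : Fin 3) : IsSymbol 2 (leraySymbol i j) where
  herm := isHermitian_ofReal fun k => by simp
  bound k := by
    rw [leraySymbol, Complex.norm_real, Real.norm_eq_abs]
    have h1 : |(if i = j then (1 : ℝ) else 0)| ≤ 1 := by split_ifs <;> simp
    have h2 : |(k i : ℝ) * (k j : ℝ) / freqNorm k ^ 2| ≤ 1 := by
      rw [abs_div, abs_mul, abs_of_nonneg (sq_nonneg (freqNorm k))]
      refine div_le_one_of_le₀ ?_ (sq_nonneg _)
      rw [sq]
      exact mul_le_mul (abs_le_freqNorm k i) (abs_le_freqNorm k j) (abs_nonneg _)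
        (freqNorm_nonneg k)
    exact (abs_sub _ _).trans (by linarith)

lemma isSymbol_invOneAddNorm : IsSymbol 1 fun k => ((1 / (1 + freqNorm k) : ℝ) : ℂ) where
  herm := isHermitian_ofReal fun k => by simp
  bound k := by
    have := freqNorm_nonneg k
    rw [Complex.norm_real, Real.norm_of_nonneg (by positivity)]
    exact div_le_one_of_le₀ (by linarith) (by positivity)

lemma isSymbol_derivSymbol_invOneAddNorm (j : Fin 3) :
    IsSymbol 7 fun k => derivSymbol j k * ((1 / (1 + freqNorm k) : ℝ) : ℂ) where
  herm := (isHermitian_derivSymbol j).mul isSymbol_invOneAddNorm.herm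
  bound k := by
    have h0 := freqNorm_nonneg k
    rw [norm_mul, Complex.norm_real, Real.norm_of_nonneg (by positivity), mul_one_div,
      div_le_iff₀ (by positivity)]
    have := norm_derivSymbol_le j k
    nlinarith [Real.pi_lt_d2]

lemma isSymbol_invLaplacian : IsSymbol 1 fun k => ((1 / angularFreq k ^ 2 : ℝ) : ℂ) where
  herm := isHermitian_ofReal fun k => by simp
  bound k := by
    rw [Complex.norm_real, Real.norm_of_nonneg (by positivity)]
    by_cases hk : k = 0
    · simp [hk]
    · have := one_le_angularFreq hk
      exact div_le_one_of_le₀ (one_le_pow₀ this) (by positivity)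

lemma isSymbol_gradPot (i : Fin 3) :
    IsSymbol 1 fun k => derivSymbol i k * ((1 / angularFreq k ^ 2 : ℝ) : ℂ) where
  herm := (isHermitian_derivSymbol i).mul isSymbol_invLaplacian.herm
  bound k := by
    rw [norm_mul, Complex.norm_real, Real.norm_of_nonneg (by positivity)]
    by_cases hk : k = 0
    · simp [hk]
    · have h1 := one_le_angularFreq hk
      have h2 := norm_derivSymbol_le_angularFreq i k
      rw [mul_one_div]
      refine div_le_one_of_le₀ ?_ (by positivity)
      nlinarith

lemma isKernel_derivSymbol (P : AnalyticScale) (j : Fin 3) :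
    P.IsKernel 7 fun k _ => derivSymbol j k where
  nonneg := by norm_num
  cont _ := continuous_const
  herm _ := isHermitian_derivSymbol j
  bound k _ _ := by
    have h0 := freqNorm_nonneg k
    have := norm_derivSymbol_le j k
    nlinarith [Real.pi_lt_d2]

lemma isKernel_one_add_freqNorm (P : AnalyticScale) :
    P.IsKernel 1 fun k _ => ((1 + freqNorm k : ℝ) : ℂ) where
  nonneg := zero_le_one
  cont _ := continuous_const
  herm _ := isHermitian_ofReal fun k => by simp
  bound k _ _ := by
    have h0 := freqNorm_nonneg k
    rw [Complex.norm_real, Real.norm_of_nonneg (by positivity), one_mul]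

lemma abs_mul_waveSin_le {ε : ℝ} (h0 : 0 < ε) (h1 : ε ≤ 1) (k : Freq) {t : ℝ}
    (ht : t ∈ Icc (0 : ℝ) 1) :
    |ε * waveSin ε k t| ≤ 1 := by
  by_cases hk : k = 0
  · have : ε * waveSin ε k t = t := by simp [waveSin, hk]; field_simp
    rw [this, abs_of_nonneg ht.1]
    exact ht.2
  · rw [abs_mul, abs_of_pos h0]
    exact mul_le_one₀ h1 (abs_nonneg _) (abs_waveSin_le_one hk t)

lemma isKernel_one_add_freqNorm_mul_waveSin (P : AnalyticScale) {ε : ℝ} (h0 : 0 < ε) (h1 : ε ≤ 1)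
    (hT : P.T ≤ 1) :
    P.IsKernel 1 fun k t => (((1 + freqNorm k) * (ε * waveSin ε k t) : ℝ) : ℂ) where
  nonneg := zero_le_one
  cont k := by
    have := continuous_waveSin ε k
    fun_prop
  herm t := isHermitian_ofReal fun k => by simp
  bound k t ht := by
    have hk := freqNorm_nonneg k
    rw [Complex.norm_real, Real.norm_eq_abs, abs_mul, abs_of_nonneg
      (by positivity : 0 ≤ 1 + freqNorm k)]
    have := abs_mul_waveSin_le h0 h1 k ⟨ht.1, ht.2.trans hT⟩
    nlinarith

lemma isKernel_curlSymbol_mul_waveSin (P : AnalyticScale) (ε : ℝ) (i l : Fin 3) :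
    P.IsKernel 1 fun k t => curlSymbol i l k * (waveSin ε k t : ℂ) where
  nonneg := zero_le_one
  cont k := by
    have := continuous_waveSin ε k
    fun_prop
  herm t := (isHermitian_curlSymbol i l).mul (isHermitian_ofReal fun k => by simp)
  bound k t _ := by
    have hk := freqNorm_nonneg k
    rw [norm_mul, Complex.norm_real, Real.norm_eq_abs]
    have h1 := mul_le_mul_of_nonneg_right (norm_curlSymbol_le i l k) (abs_nonneg (waveSin ε k t))
    have h2 := angularFreq_mul_abs_waveSin_le ε k t
    linarith

lemma isKernel_waveSin (P : AnalyticScale) {ε : ℝ} (h0 : 0 < ε) (h1 : ε ≤ 1) (hT : P.T ≤ 1) :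
    P.IsKernel (1 / ε) fun k t => (waveSin ε k t : ℂ) where
  nonneg := by positivity
  cont k := by
    have := continuous_waveSin ε k
    fun_prop
  herm t := isHermitian_ofReal fun k => by simp
  bound k t ht := by
    have hk := freqNorm_nonneg k
    have h := abs_mul_waveSin_le h0 h1 k ⟨ht.1, ht.2.trans hT⟩
    rw [abs_mul, abs_of_pos h0] at h
    rw [Complex.norm_real, Real.norm_eq_abs]
    have h2 : |waveSin ε k t| ≤ 1 / ε := by rw [le_div_iff₀ h0]; linarith
    exact h2.trans (le_mul_of_one_le_right (by positivity) (by linarith))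

lemma isKernel_waveCos (P : AnalyticScale) (ε : ℝ) :
    P.IsKernel 1 fun k t => (waveCos ε k t : ℂ) where
  nonneg := zero_le_one
  cont k := by
    have := continuous_waveCos ε k
    fun_prop
  herm t := isHermitian_ofReal fun k => by simp
  bound k t _ := by
    have hk := freqNorm_nonneg k
    rw [Complex.norm_real, Real.norm_eq_abs]
    linarith [abs_waveCos_le ε k t]

/-- The data of the fixed point problem: the weights, the parameter `ε`, and the contributions of
the initial data to the densities, velocities and magnetic field. -/
structure PicardData {M : Type*} [MeasurableSpace M] (μ : Measure M) where
  P : AnalyticScale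
  eps : ℝ
  eps_pos : 0 < eps
  eps_le : eps ≤ 1
  T_le : P.T ≤ 1
  rin : CoefSpace μ
  xin : Fin 3 → CoefSpace μ
  bin : Fin 3 → CoefSpace μ

/-- The unknowns: the density, the velocity field multiplied by `1 + |k|`, and
`h = (1 + ε² |ξ|²)^(-1/2) - 1`. -/
abbrev State {M : Type*} [MeasurableSpace M] (μ : Measure M) : Type _ :=
  CoefSpace μ × (Fin 3 → CoefSpace μ) × CoefSpace μ

namespace PicardData

variable {M : Type*} [MeasurableSpace M] {μ : Measure M}

section Maps

variable [IsProbabilityMeasure μ] (D : PicardData μ)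

/-- The velocity field `ξ`. -/
def xi (i : Fin 3) (u : State μ) : CoefSpace μ := D.P.multiplier isSymbol_invOneAddNorm (u.2.1 i)

/-- The derivative `∂ⱼ ξᵢ`. -/
def dxi (i j : Fin 3) (u : State μ) : CoefSpace μ :=
  D.P.multiplier (isSymbol_derivSymbol_invOneAddNorm j) (u.2.1 i)

/-- The relativistic velocity. -/
def velocity (i : Fin 3) (u : State μ) : CoefSpace μ := D.xi i u + D.P.mul (D.xi i u) u.2.2

/-- The flux `vⱼ ρ`. -/
def flux (j : Fin 3) (u : State μ) : CoefSpace μ := D.P.mul (D.velocity j u) u.1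

/-- The total current. -/
def totalCurrent (j : Fin 3) (u : State μ) : CoefSpace μ := D.P.average (D.flux j u)

/-- The Leray projection of the total current. -/
def lerayCurrent (i : Fin 3) (u : State μ) : CoefSpace μ :=
  ∑ j, D.P.multiplier (isSymbol_leraySymbol i j) (D.totalCurrent j u)

/-- The derivative `∂ᵢ φ` of the scalar potential. -/
def gradPhi (i : Fin 3) (u : State μ) : CoefSpace μ :=
  D.P.multiplier (isSymbol_gradPot i) (D.P.average u.1)

/-- The part of the magnetic field generated by the current. -/
def inducedMagnetic (i : Fin 3) (u : State μ) : CoefSpace μ :=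
  ∑ l, duhamel (isKernel_curlSymbol_mul_waveSin D.P D.eps i l) (D.lerayCurrent l u)

/-- The magnetic field. -/
def magnetic (i : Fin 3) (u : State μ) : CoefSpace μ := D.bin i + D.inducedMagnetic i u

/-- The magnetic force `ε v × B`. -/
def magneticForce (i : Fin 3) (u : State μ) : CoefSpace μ :=
  D.P.mul (D.velocity (i + 1) u) (D.eps • D.magnetic (i + 2) u)
    - D.P.mul (D.velocity (i + 2) u) (D.eps • D.magnetic (i + 1) u)

/-- The right-hand side of the equation for `ξ + ε A`, up to the sign. -/
def force (i : Fin 3) (u : State μ) : CoefSpace μ :=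
  (∑ j, D.P.mul (D.velocity j u) (D.dxi i j u)) + D.gradPhi i u - D.magneticForce i u

/-- The square `|ξ|²`. -/
def xiSq (u : State μ) : CoefSpace μ := ∑ i, D.P.mul (D.xi i u) (D.xi i u)

/-- The term `|ξ|² (1 + h)²` of the equation `(1 + h)² (1 + ε² |ξ|²) = 1`. -/
def lorentzTerm (u : State μ) : CoefSpace μ :=
  D.xiSq u + (2 : ℝ) • D.P.mul (D.xiSq u) u.2.2 + D.P.mul (D.xiSq u) (D.P.mul u.2.2 u.2.2)

/-- The first component of the fixed point map. -/
def picardRho (u : State μ) : CoefSpace μ :=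
  D.rin - ∑ j, duhamel (isKernel_derivSymbol D.P j) (D.flux j u)

/-- The second component of the fixed point map. -/
def picardXi (i : Fin 3) (u : State μ) : CoefSpace μ :=
  D.xin i - duhamel (isKernel_one_add_freqNorm_mul_waveSin D.P D.eps_pos D.eps_le D.T_le)
    (D.lerayCurrent i u)
    - duhamel (isKernel_one_add_freqNorm D.P) (D.force i u)

/-- The third component of the fixed point map: `(1 + h)² (1 + ε² |ξ|²) = 1` is solved for its
linear term `2 h`. -/
def picardH (u : State μ) : CoefSpace μ :=
  (-(1 / 2) : ℝ) • (D.P.mul u.2.2 u.2.2 + D.eps ^ 2 • D.lorentzTerm u)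

/-- The fixed point map. -/
def picard (u : State μ) : State μ := (D.picardRho u, fun i => D.picardXi i u, D.picardH u)

end Maps

/-- The domain of the fixed point map. -/
def domain (μ : Measure M) (R : ℝ) : Set (State μ) :=
  {u | ‖u.1‖ ≤ R ∧ (∀ i, ‖u.2.1 i‖ ≤ R) ∧ ‖u.2.2‖ ≤ 1 / 4}

/-- Bounded Lipschitz maps on `domain μ R`, with bounds by a power of `Q`. -/
structure Tame (R Q : ℝ) (n : ℕ) (f : State μ → CoefSpace μ) : Prop where
  bound : ∀ u ∈ domain μ R, ‖f u‖ ≤ Q ^ n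
  lip : ∀ u ∈ domain μ R, ∀ v ∈ domain μ R, ‖f u - f v‖ ≤ Q ^ n * ‖u - v‖

section Tame

variable {R Q : ℝ} {m n : ℕ} {f g : State μ → CoefSpace μ}

lemma Tame.mono (hQ : 8 ≤ Q) (hf : Tame R Q m f) (hmn : m ≤ n) : Tame R Q n f := by
  have h : Q ^ m ≤ Q ^ n := pow_le_pow_right₀ (by linarith) hmn
  exact ⟨fun u hu => (hf.bound u hu).trans h, fun u hu v hv =>
    (hf.lip u hu v hv).trans (mul_le_mul_of_nonneg_right h (norm_nonneg _))⟩

lemma Tame.add (hQ : 8 ≤ Q) (hf : Tame R Q n f) (hg : Tame R Q n g) :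
    Tame R Q (n + 1) fun u => f u + g u := by
  have hp : 0 < Q ^ n := by positivity
  have h2 : 2 * Q ^ n ≤ Q ^ (n + 1) := by rw [pow_succ]; nlinarith
  refine ⟨fun u hu => ?_, fun u hu v hv => ?_⟩
  · exact (norm_add_le _ _).trans (by linarith [hf.bound u hu, hg.bound u hu])
  · rw [add_sub_add_comm]
    refine (norm_add_le _ _).trans ?_
    have := mul_le_mul_of_nonneg_right h2 (norm_nonneg (u - v))
    linarith [hf.lip u hu v hv, hg.lip u hu v hv]

lemma Tame.neg (hf : Tame R Q n f) : Tame R Q n fun u => -f u := by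
  refine ⟨fun u hu => by simpa using hf.bound u hu, fun u hu v hv => ?_⟩
  rw [neg_sub_neg, norm_sub_rev]
  exact hf.lip u hu v hv

lemma Tame.sub (hQ : 8 ≤ Q) (hf : Tame R Q n f) (hg : Tame R Q n g) :
    Tame R Q (n + 1) fun u => f u - g u := by
  simpa only [sub_eq_add_neg] using hf.add hQ hg.neg

lemma Tame.sum {F : Fin 3 → State μ → CoefSpace μ} (hQ : 8 ≤ Q) (hF : ∀ i, Tame R Q n (F i)) :
    Tame R Q (n + 2) fun u => ∑ i, F i u := by
  simp only [Fin.sum_univ_three]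
  exact ((hF 0).add hQ (hF 1)).add hQ ((hF 2).mono hQ (Nat.le_succ n))

lemma Tame.clm_apply (hQ : 8 ≤ Q) (hf : Tame R Q n f) {L : CoefSpace μ →L[ℝ] CoefSpace μ}
    (hL : ∀ U, ‖L U‖ ≤ Q * ‖U‖) : Tame R Q (n + 1) fun u => L (f u) := by
  have hQ0 : 0 ≤ Q := by linarith
  refine ⟨fun u hu => ?_, fun u hu v hv => ?_⟩
  · rw [pow_succ, mul_comm]
    exact (hL _).trans (mul_le_mul_of_nonneg_left (hf.bound u hu) hQ0)
  · rw [← map_sub, pow_succ, mul_comm (Q ^ n), mul_assoc]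
    exact (hL _).trans (mul_le_mul_of_nonneg_left (hf.lip u hu v hv) hQ0)

lemma Tame.smul (hQ : 8 ≤ Q) (hf : Tame R Q n f) {c : ℝ} (hc : |c| ≤ 2) :
    Tame R Q (n + 1) fun u => c • f u :=
  hf.clm_apply hQ (L := c • ContinuousLinearMap.id ℝ _) fun U => by
    simp only [smul_apply, ContinuousLinearMap.id_apply, norm_smul,
      Real.norm_eq_abs]
    exact mul_le_mul_of_nonneg_right (by linarith) (norm_nonneg _)

lemma Tame.multiplier (P : AnalyticScale) (hQ : 8 ≤ Q) (hf : Tame R Q n f) {C : ℝ} {σ : Freq → ℂ}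
    (hσ : IsSymbol C σ) (hC : C ≤ 8) : Tame R Q (n + 1) fun u => P.multiplier hσ (f u) :=
  hf.clm_apply hQ fun U => (P.norm_multiplier_apply_le hσ U).trans
    (mul_le_mul_of_nonneg_right (hC.trans hQ) (norm_nonneg U))

lemma Tame.average [IsProbabilityMeasure μ] (P : AnalyticScale) (hQ : 8 ≤ Q)
    (hf : Tame R Q n f) : Tame R Q (n + 1) fun u => P.average (f u) :=
  hf.clm_apply hQ fun U => (P.norm_average_apply_le U).trans
    (le_mul_of_one_le_left (norm_nonneg U) (by linarith))

lemma norm_mul_sub_mul_le (P : AnalyticScale) (U U' V V' : CoefSpace μ) :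
    ‖P.mul U V - P.mul U' V'‖ ≤ ‖U - U'‖ * ‖V‖ + ‖U'‖ * ‖V - V'‖ := by
  have : P.mul U V - P.mul U' V' = P.mul (U - U') V + P.mul U' (V - V') := by
    simp only [map_sub, sub_apply]; abel
  rw [this]
  exact (norm_add_le _ _).trans (add_le_add (P.norm_mul_le _ _) (P.norm_mul_le _ _))

lemma Tame.mul (P : AnalyticScale) (hQ : 8 ≤ Q) (hf : Tame R Q m f) (hg : Tame R Q n g) :
    Tame R Q (m + n + 1) fun u => P.mul (f u) (g u) := by
  have hQm : 0 < Q ^ m := by positivity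
  refine ⟨fun u hu => ?_, fun u hu v hv => ?_⟩
  · calc _ ≤ ‖f u‖ * ‖g u‖ := P.norm_mul_le _ _
      _ ≤ Q ^ m * Q ^ n := mul_le_mul (hf.bound u hu) (hg.bound u hu) (norm_nonneg _) hQm.le
      _ ≤ _ := by
        rw [← pow_add]
        exact pow_le_pow_right₀ (by linarith) (Nat.le_succ _)
  · calc _ ≤ ‖f u - f v‖ * ‖g u‖ + ‖f v‖ * ‖g u - g v‖ := norm_mul_sub_mul_le P _ _ _ _
      _ ≤ (Q ^ m * ‖u - v‖) * Q ^ n + Q ^ m * (Q ^ n * ‖u - v‖) :=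
        add_le_add (mul_le_mul (hf.lip u hu v hv) (hg.bound u hu) (norm_nonneg _) (by positivity))
          (mul_le_mul (hf.bound v hv) (hg.lip u hu v hv) (norm_nonneg _) hQm.le)
      _ = 2 * (Q ^ (m + n) * ‖u - v‖) := by rw [pow_add]; ring
      _ ≤ Q * (Q ^ (m + n) * ‖u - v‖) := by gcongr; linarith
      _ = _ := by ring

lemma Tame.const (hQ : 8 ≤ Q) {U : CoefSpace μ} (hU : ‖U‖ ≤ Q) : Tame R Q 1 fun _ => U :=
  ⟨fun _ _ => by simpa using hU, fun u _ v _ => by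
    simp only [sub_self, norm_zero, pow_one]; positivity⟩

lemma tame_fst (hQ : 8 ≤ Q) (hR : R ≤ Q) : Tame R Q 1 fun u : State μ => u.1 := by
  refine ⟨fun u hu => by simpa using hu.1.trans hR, fun u _ v _ => ?_⟩
  rw [pow_one]
  exact (norm_fst_le (u - v)).trans (le_mul_of_one_le_left (norm_nonneg _) (by linarith))

lemma tame_snd_fst (hQ : 8 ≤ Q) (hR : R ≤ Q) (i : Fin 3) :
    Tame R Q 1 fun u : State μ => u.2.1 i := by
  refine ⟨fun u hu => by simpa using (hu.2.1 i).trans hR, fun u _ v _ => ?_⟩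
  rw [pow_one]
  exact ((norm_le_pi_norm (u - v).2.1 i).trans ((norm_fst_le _).trans (norm_snd_le _))).trans
    (le_mul_of_one_le_left (norm_nonneg _) (by linarith))

lemma tame_snd_snd (hQ : 8 ≤ Q) : Tame R Q 1 fun u : State μ => u.2.2 := by
  refine ⟨fun u hu => by rw [pow_one]; exact hu.2.2.trans (by linarith), fun u _ v _ => ?_⟩
  rw [pow_one]
  exact ((norm_snd_le _).trans (norm_snd_le (u - v))).trans
    (le_mul_of_one_le_left (norm_nonneg _) (by linarith))

/-- The smallness assumptions under which the fixed point map is a contraction. -/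
structure Small (D : PicardData μ) (R Q : ℝ) : Prop where
  le_Q : 8 ≤ Q
  R_le : R ≤ Q
  R_nonneg : 0 ≤ R
  rin_le : ‖D.rin‖ + 1 ≤ R
  xin_le : ∀ i, ‖D.xin i‖ + 1 ≤ R
  bin_le : ∀ i, ‖D.eps • D.bin i‖ ≤ R
  gain_le : D.P.gain * Q ^ 30 ≤ 1
  eps_small : D.eps ^ 2 * Q ^ 30 ≤ 1

variable {D : PicardData μ}

lemma Small.gain_le_one (h : Small D R Q) : D.P.gain ≤ 1 := by
  have h1 := h.gain_le
  have h2 : 1 ≤ Q ^ 30 := one_le_pow₀ (by linarith [h.le_Q])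
  nlinarith [D.P.gain_nonneg]

lemma Small.mul_pow_le (h : Small D R Q) {x : ℝ} (hx : 0 ≤ x) (hxQ : x * Q ^ 30 ≤ 1) {n : ℕ}
    (hn : n ≤ 28) :
    x * Q ^ n ≤ 1 / 64 := by
  have hQ := h.le_Q
  have h1 : Q ^ n ≤ Q ^ 28 := pow_le_pow_right₀ (by linarith) hn
  have h2 : x * Q ^ n ≤ x * Q ^ 28 := mul_le_mul_of_nonneg_left h1 hx
  have h3 : 0 ≤ x * Q ^ 28 := by positivity
  have h4 : x * Q ^ 28 * 64 ≤ x * Q ^ 30 :=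
    calc x * Q ^ 28 * 64 ≤ x * Q ^ 28 * Q ^ 2 := mul_le_mul_of_nonneg_left (by nlinarith) h3
      _ = x * Q ^ 30 := by ring
  linarith

lemma Tame.duhamel_small {H : ℝ} {p : Freq → ℝ → ℂ} (h : Small D R Q) (hp : D.P.IsKernel H p)
    (hH : H ≤ 8) (hf : Tame R Q n f) (hn : n ≤ 26) {u v : State μ} (hu : u ∈ domain μ R)
    (hv : v ∈ domain μ R) :
    ‖duhamel hp (f u)‖ ≤ 1 / 64 ∧ ‖duhamel hp (f u) - duhamel hp (f v)‖ ≤ 1 / 64 * ‖u - v‖ := by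
  have hg := D.P.gain_nonneg
  have hQ := h.le_Q
  have hs : H * D.P.gain * Q ^ n ≤ 1 / 64 := by
    refine le_trans ?_ (h.mul_pow_le hg h.gain_le (n := n + 1) (by omega))
    rw [pow_succ]
    have : H * (D.P.gain * Q ^ n) ≤ Q * (D.P.gain * Q ^ n) := by gcongr; linarith
    linarith
  have hHg : 0 ≤ H * D.P.gain := mul_nonneg hp.nonneg hg
  constructor
  · exact (norm_duhamel_apply_le hp _).trans
      ((mul_le_mul_of_nonneg_left (hf.bound u hu) hHg).trans hs)
  · rw [← map_sub]
    refine (norm_duhamel_apply_le hp _).trans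
      ((mul_le_mul_of_nonneg_left (hf.lip u hu v hv) hHg).trans ?_)
    rw [← mul_assoc]
    exact mul_le_mul_of_nonneg_right hs (norm_nonneg _)

lemma isClosed_domain (R : ℝ) : IsClosed (domain μ R) := by
  simp only [domain, Set.ofPred_and, Set.ofPred_forall]
  exact (isClosed_le (by fun_prop) continuous_const).inter
    ((isClosed_iInter fun i => isClosed_le (by fun_prop) continuous_const).inter
      (isClosed_le (by fun_prop) continuous_const))

lemma tame_xi (h : Small D R Q) (i : Fin 3) : Tame R Q 2 (D.xi i) :=
  (tame_snd_fst h.le_Q h.R_le i).multiplier D.P h.le_Q isSymbol_invOneAddNorm (by norm_num)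

lemma tame_dxi (h : Small D R Q) (i j : Fin 3) : Tame R Q 2 (D.dxi i j) :=
  (tame_snd_fst h.le_Q h.R_le i).multiplier D.P h.le_Q (isSymbol_derivSymbol_invOneAddNorm j)
    (by norm_num)

lemma tame_velocity (h : Small D R Q) (i : Fin 3) : Tame R Q 5 (D.velocity i) :=
  ((tame_xi h i).mono h.le_Q (by norm_num)).add h.le_Q
    ((tame_xi h i).mul D.P h.le_Q (tame_snd_snd h.le_Q))

lemma tame_flux (h : Small D R Q) (j : Fin 3) : Tame R Q 7 (D.flux j) :=
  (tame_velocity h j).mul D.P h.le_Q (tame_fst h.le_Q h.R_le)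

lemma tame_lorentzTerm (h : Small D R Q) : Tame R Q 14 D.lorentzTerm := by
  have h1 : Tame R Q 7 D.xiSq := Tame.sum h.le_Q fun i =>
    (tame_xi h i).mul D.P h.le_Q (tame_xi h i)
  have h2 : Tame R Q 10 fun u => (2 : ℝ) • D.P.mul (D.xiSq u) u.2.2 :=
    (h1.mul D.P h.le_Q (tame_snd_snd h.le_Q)).smul h.le_Q (by norm_num)
  have h3 : Tame R Q 11 fun u => D.P.mul (D.xiSq u) (D.P.mul u.2.2 u.2.2) :=
    h1.mul D.P h.le_Q ((tame_snd_snd h.le_Q).mul D.P h.le_Q (tame_snd_snd h.le_Q))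
  exact (((h1.mono h.le_Q (by norm_num)).add h.le_Q h2).add h.le_Q h3).mono h.le_Q (by norm_num)

lemma picardRho_bounds (h : Small D R Q) {u v : State μ} (hu : u ∈ domain μ R) (hv : v ∈ domain μ R)
    :
    ‖D.picardRho u‖ ≤ R ∧ ‖D.picardRho u - D.picardRho v‖ ≤ 1 / 2 * ‖u - v‖ := by
  have hj := fun j => (tame_flux h j).duhamel_small h (isKernel_derivSymbol D.P j) (by norm_num)
    (by norm_num) hu hv
  constructor
  · refine (norm_sub_le _ _).trans ((add_le_add_right (norm_sum_le _ _) _).trans ?_)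
    rw [Fin.sum_univ_three]
    linarith [(hj 0).1, (hj 1).1, (hj 2).1, h.rin_le]
  · have : D.picardRho u - D.picardRho v = -∑ j, (duhamel (isKernel_derivSymbol D.P j) (D.flux j u)
        - duhamel (isKernel_derivSymbol D.P j) (D.flux j v)) := by
      rw [picardRho, picardRho, Finset.sum_sub_distrib]; abel
    rw [this, norm_neg]
    refine (norm_sum_le _ _).trans ?_
    rw [Fin.sum_univ_three]
    linarith [(hj 0).2, (hj 1).2, (hj 2).2, norm_nonneg (u - v)]

lemma picardH_bounds (h : Small D R Q) {u v : State μ} (hu : u ∈ domain μ R) (hv : v ∈ domain μ R) :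
    ‖D.picardH u‖ ≤ 1 / 4 ∧ ‖D.picardH u - D.picardH v‖ ≤ 1 / 2 * ‖u - v‖ := by
  have hs := h.mul_pow_le (sq_nonneg D.eps) h.eps_small (n := 14) (by norm_num)
  have hl := tame_lorentzTerm h
  have hn : ‖(-(1 / 2) : ℝ)‖ = 1 / 2 := by norm_num
  have hu2 := hu.2.2
  have hv2 := hv.2.2
  constructor
  · rw [picardH, norm_smul, hn]
    have h1 := D.P.norm_mul_le u.2.2 u.2.2
    have h2 : ‖D.eps ^ 2 • D.lorentzTerm u‖ ≤ 1 / 64 := by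
      rw [norm_smul, Real.norm_of_nonneg (sq_nonneg _)]
      exact (mul_le_mul_of_nonneg_left (hl.bound u hu) (sq_nonneg _)).trans hs
    have h3 := norm_add_le (D.P.mul u.2.2 u.2.2) (D.eps ^ 2 • D.lorentzTerm u)
    nlinarith [norm_nonneg u.2.2]
  · have e :
    D.picardH u - D.picardH v = (-(1 / 2) : ℝ) • ((D.P.mul u.2.2 u.2.2 - D.P.mul v.2.2 v.2.2)
        + D.eps ^ 2 • (D.lorentzTerm u - D.lorentzTerm v)) := by
      rw [picardH, picardH, ← smul_sub, add_sub_add_comm, ← smul_sub]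
    rw [e, norm_smul, hn]
    have h1 := norm_mul_sub_mul_le D.P u.2.2 v.2.2 u.2.2 v.2.2
    have h2 : ‖D.eps ^ 2 • (D.lorentzTerm u - D.lorentzTerm v)‖ ≤ 1 / 64 * ‖u - v‖ := by
      rw [norm_smul, Real.norm_of_nonneg (sq_nonneg _)]
      refine (mul_le_mul_of_nonneg_left (hl.lip u hu v hv) (sq_nonneg _)).trans ?_
      rw [← mul_assoc]
      exact mul_le_mul_of_nonneg_right hs (norm_nonneg _)
    have h3 := norm_add_le (D.P.mul u.2.2 u.2.2 - D.P.mul v.2.2 v.2.2)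
      (D.eps ^ 2 • (D.lorentzTerm u - D.lorentzTerm v))
    have h4 : ‖u.2.2 - v.2.2‖ ≤ ‖u - v‖ := (norm_snd_le _).trans (norm_snd_le (u - v))
    nlinarith [norm_nonneg (u.2.2 - v.2.2), norm_nonneg u.2.2, norm_nonneg v.2.2]

variable [IsProbabilityMeasure μ]

lemma tame_totalCurrent (h : Small D R Q) (j : Fin 3) : Tame R Q 8 (D.totalCurrent j) :=
  (tame_flux h j).average D.P h.le_Q

lemma tame_lerayCurrent (h : Small D R Q) (i : Fin 3) : Tame R Q 11 (D.lerayCurrent i) :=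
  Tame.sum h.le_Q fun j =>
    (tame_totalCurrent h j).multiplier D.P h.le_Q (isSymbol_leraySymbol i j) (by norm_num)

lemma tame_gradPhi (h : Small D R Q) (i : Fin 3) : Tame R Q 3 (D.gradPhi i) :=
  ((tame_fst h.le_Q h.R_le).average D.P h.le_Q).multiplier D.P h.le_Q (isSymbol_gradPot i)
    (by norm_num)

lemma tame_inducedMagnetic (h : Small D R Q) (i : Fin 3) : Tame R Q 14 (D.inducedMagnetic i) :=
  Tame.sum h.le_Q fun l => (tame_lerayCurrent h l).clm_apply h.le_Q fun U =>
    (norm_duhamel_apply_le _ U).trans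
      (mul_le_mul_of_nonneg_right (by linarith [h.le_Q, h.gain_le_one]) (norm_nonneg _))

lemma tame_magnetic (h : Small D R Q) (i : Fin 3) :
    Tame R Q 16 fun u => D.eps • D.magnetic i u := by
  simp only [magnetic, smul_add]
  refine ((Tame.const h.le_Q ((h.bin_le i).trans h.R_le)).mono h.le_Q (by norm_num)).add h.le_Q
    ((tame_inducedMagnetic h i).smul h.le_Q ?_)
  rw [abs_of_pos D.eps_pos]
  linarith [D.eps_le]

lemma tame_magneticForce (h : Small D R Q) (i : Fin 3) : Tame R Q 23 (D.magneticForce i) :=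
  ((tame_velocity h _).mul D.P h.le_Q (tame_magnetic h _)).sub h.le_Q
    ((tame_velocity h _).mul D.P h.le_Q (tame_magnetic h _))

lemma tame_force (h : Small D R Q) (i : Fin 3) : Tame R Q 24 (D.force i) := by
  have h1 : Tame R Q 10 fun u => ∑ j, D.P.mul (D.velocity j u) (D.dxi i j u) :=
    Tame.sum h.le_Q fun j => (tame_velocity h j).mul D.P h.le_Q (tame_dxi h i j)
  exact ((h1.add h.le_Q ((tame_gradPhi h i).mono h.le_Q (by norm_num))).mono h.le_Q
    (by norm_num)).sub h.le_Q (tame_magneticForce h i)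

lemma picardXi_bounds (h : Small D R Q) {u v : State μ} (hu : u ∈ domain μ R) (hv : v ∈ domain μ R)
    (i : Fin 3) :
    ‖D.picardXi i u‖ ≤ R ∧ ‖D.picardXi i u - D.picardXi i v‖ ≤ 1 / 2 * ‖u - v‖ := by
  have h1 :=
    (tame_lerayCurrent h i).duhamel_small h
      (isKernel_one_add_freqNorm_mul_waveSin D.P D.eps_pos D.eps_le D.T_le)
    (by norm_num) (by norm_num) hu hv
  have h2 :=
    (tame_force h i).duhamel_small h (isKernel_one_add_freqNorm D.P) (by norm_num) (by norm_num) hu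
      hv
  constructor
  · refine (norm_sub_le _ _).trans ((add_le_add_left (norm_sub_le _ _) _).trans ?_)
    linarith [h1.1, h2.1, h.xin_le i]
  · have : D.picardXi i u - D.picardXi i v =
        -(duhamel (isKernel_one_add_freqNorm_mul_waveSin D.P D.eps_pos D.eps_le D.T_le)
          (D.lerayCurrent i u)
          - duhamel (isKernel_one_add_freqNorm_mul_waveSin D.P D.eps_pos D.eps_le D.T_le)
            (D.lerayCurrent i v))
        -
          (duhamel (isKernel_one_add_freqNorm D.P) (D.force i u) - duhamel
            (isKernel_one_add_freqNorm D.P) (D.force i v)) := by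
      rw [picardXi, picardXi]; abel
    rw [this]
    refine (norm_sub_le _ _).trans ?_
    rw [norm_neg]
    linarith [h1.2, h2.2, norm_nonneg (u - v)]

lemma mapsTo_picard (h : Small D R Q) : MapsTo D.picard (domain μ R) (domain μ R) := fun _ hu =>
  ⟨(picardRho_bounds h hu hu).1, fun i => (picardXi_bounds h hu hu i).1,
    (picardH_bounds h hu hu).1⟩

lemma contractingWith_picard (h : Small D R Q) :
    ContractingWith (1 / 2) ((mapsTo_picard h).restrict D.picard (domain μ R) (domain μ R)) := by
  refine ⟨by norm_num, LipschitzWith.of_dist_le_mul fun u v => ?_⟩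
  have half : ((1 / 2 : NNReal) : ℝ) = 1 / 2 := by norm_num
  rw [Subtype.dist_eq, Subtype.dist_eq, dist_eq_norm, dist_eq_norm, half]
  have hn : 0 ≤ 1 / 2 * ‖u.1 - v.1‖ := by positivity
  exact norm_prod_le_iff.2 ⟨(picardRho_bounds h u.2 v.2).2, norm_prod_le_iff.2
    ⟨(pi_norm_le_iff_of_nonneg hn).2 fun i => (picardXi_bounds h u.2 v.2 i).2,
      (picardH_bounds h u.2 v.2).2⟩⟩

lemma exists_fixedPoint (h : Small D R Q) : ∃ u ∈ domain μ R, D.picard u = u := by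
  have h0 : (0 : State μ) ∈ domain μ R :=
    ⟨by simpa using h.R_nonneg, fun i => by simpa using h.R_nonneg, by simp⟩
  obtain ⟨u, hu, hfix, -⟩ := (contractingWith_picard h).exists_fixedPoint'
    (isClosed_domain R).isComplete (mapsTo_picard h) h0 (edist_ne_top _ _)
  exact ⟨u, hu, hfix⟩

end Tame

end PicardData

lemma angularFreq_le_mul_one_add (k : Freq) : angularFreq k ≤ 7 * (1 + freqNorm k) := by
  unfold angularFreq
  nlinarith [Real.pi_lt_d2, freqNorm_nonneg k]

lemma norm_derivSymbol_le_mul_one_add (i : Fin 3) (k : Freq) :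
    ‖derivSymbol i k‖ ≤ 7 * (1 + freqNorm k) :=
  (norm_derivSymbol_le_angularFreq i k).trans (angularFreq_le_mul_one_add k)

namespace AnalyticScale

variable (P : AnalyticScale) {M : Type*} [MeasurableSpace M] {μ : Measure M}

/-! ### From coefficients to functions -/

/-- The function whose Fourier coefficients are given by an element of the space. -/
def realize (U : CoefSpace μ) (t : ℝ) (θ : M) : T3 → ℝ := fourierSynthesis fun k => P.coef U k t θ

lemma realize_add (U V : CoefSpace μ) (t : ℝ) (θ : M) (x : T3) :
    P.realize (U + V) t θ x = P.realize U t θ x + P.realize V t θ x := by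
  simp only [realize, coef_add]
  exact fourierSynthesis_add (P.summable_coef U t θ) (P.summable_coef V t θ) x

lemma realize_sub (U V : CoefSpace μ) (t : ℝ) (θ : M) (x : T3) :
    P.realize (U - V) t θ x = P.realize U t θ x - P.realize V t θ x := by
  simp only [realize, coef_sub]
  exact fourierSynthesis_sub (P.summable_coef U t θ) (P.summable_coef V t θ) x

lemma realize_neg (U : CoefSpace μ) (t : ℝ) (θ : M) (x : T3) :
    P.realize (-U) t θ x = -P.realize U t θ x := by
  simp only [realize, coef_neg]
  exact fourierSynthesis_neg _ x

lemma realize_smul (c : ℝ) (U : CoefSpace μ) (t : ℝ) (θ : M) (x : T3) :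
    P.realize (c • U) t θ x = c * P.realize U t θ x := by
  simp only [realize, coef_smul]
  exact fourierSynthesis_const_mul _ _ x

lemma realize_sum {ι : Type*} (s : Finset ι) (U : ι → CoefSpace μ) (t : ℝ) (θ : M) (x : T3) :
    P.realize (∑ i ∈ s, U i) t θ x = ∑ i ∈ s, P.realize (U i) t θ x := by
  simp only [realize, coef_sum]
  exact fourierSynthesis_sum s (fun i _ => P.summable_coef (U i) t θ) x

lemma realize_mul (U V : CoefSpace μ) (t : ℝ) (θ : M) (x : T3) :
    P.realize (P.mul U V) t θ x = P.realize U t θ x * P.realize V t θ x := by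
  simp only [realize, coef_mul]
  exact fourierSynthesis_coefConv (P.summable_coef U t θ) (P.summable_coef V t θ)
    ((P.isCoef_coef U).herm t θ)
    ((P.isCoef_coef V).herm t θ) x

lemma exists_summable_pow_mul_norm_coef_le (U : CoefSpace μ) (n : ℕ) : ∃ w : Freq → ℝ, Summable w ∧
    ∀ k t θ, (1 + freqNorm k) ^ n * ‖P.coef U k t θ‖ ≤ w k := by
  obtain ⟨K, _, hb⟩ := exists_pow_mul_exp_le n P.b_pos
  refine ⟨fun k => ‖U‖ * K * polyWeight k, summable_polyWeight.mul_left _, fun k t θ => ?_⟩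
  have h0 := freqNorm_nonneg k
  have hw := polyWeight_pos k
  calc _ ≤ (1 + freqNorm k) ^ n * (‖U‖ * (polyWeight k * Real.exp (-P.b * freqNorm k))) := by
        gcongr
        exact (P.norm_coef_le U k t θ).trans (by gcongr; exact P.weight_le k t)
    _ = ‖U‖ * polyWeight k * ((1 + freqNorm k) ^ n * Real.exp (-P.b * freqNorm k)) := by ring
    _ ≤ ‖U‖ * polyWeight k * K := by gcongr; exact hb _ h0
    _ = _ := by ring

lemma exists_summable_norm_mul_coef_le {p : Freq → ℂ} {C : ℝ} {n : ℕ}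
    (hp : ∀ k, ‖p k‖ ≤ C * (1 + freqNorm k) ^ n) (U : CoefSpace μ) :
    ∃ w : Freq → ℝ, Summable w ∧ ∀ k t θ, ‖p k * P.coef U k t θ‖ ≤ w k := by
  obtain ⟨w, hw, hb⟩ := P.exists_summable_pow_mul_norm_coef_le U n
  have hC : 0 ≤ C := by simpa using (norm_nonneg _).trans (hp 0)
  refine ⟨fun k => C * w k, hw.mul_left C, fun k t θ => ?_⟩
  calc ‖p k * P.coef U k t θ‖ ≤ C * (1 + freqNorm k) ^ n * ‖P.coef U k t θ‖ := by
        rw [norm_mul]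
        gcongr
        exact hp k
    _ ≤ C * w k := by
        rw [mul_assoc]
        gcongr
        exact hb k t θ

lemma summable_mul_coef {p : Freq → ℂ} {C : ℝ} {n : ℕ} (hp : ∀ k, ‖p k‖ ≤ C * (1 + freqNorm k) ^ n)
    (U : CoefSpace μ) (t : ℝ) (θ : M) : Summable fun k => ‖p k * P.coef U k t θ‖ :=
  let ⟨_, hw, hb⟩ := P.exists_summable_norm_mul_coef_le hp U
  hw.of_nonneg_of_le (fun _ => norm_nonneg _) fun k => hb k t θ

lemma summable_derivSymbol_coef (U : CoefSpace μ) (t : ℝ) (θ : M) (i : Fin 3) :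
    Summable fun k => ‖derivSymbol i k * P.coef U k t θ‖ :=
  P.summable_mul_coef (n := 1) (by simpa using norm_derivSymbol_le_mul_one_add i) U t θ

lemma summable_derivSymbol_derivSymbol_coef (U : CoefSpace μ) (t : ℝ) (θ : M) (i j : Fin 3) :
    Summable fun k => ‖derivSymbol j k * (derivSymbol i k * P.coef U k t θ)‖ := by
  simp only [← mul_assoc]
  refine P.summable_mul_coef (C := 7 * 7) (n := 2) (fun k => ?_) U t θ
  have := freqNorm_nonneg k
  rw [norm_mul]
  calc _ ≤ (7 * (1 + freqNorm k)) * (7 * (1 + freqNorm k)) := by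
        gcongr <;> exact norm_derivSymbol_le_mul_one_add _ k
    _ = _ := by ring

lemma pderiv_realize (U : CoefSpace μ) (t : ℝ) (θ : M) (i : Fin 3) :
    pderiv i (P.realize U t θ) = fourierSynthesis fun k => derivSymbol i k * P.coef U k t θ :=
  funext fun x =>
    pderiv_fourierSynthesis (P.summable_coef U t θ) (P.summable_derivSymbol_coef U t θ i) x

lemma laplacian_realize (U : CoefSpace μ) (t : ℝ) (θ : M) (x : T3) :
    laplacian (P.realize U t θ) x =
      ∑ i, fourierSynthesis (fun k => derivSymbol i k * (derivSymbol i k * P.coef U k t θ)) x := by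
  refine Finset.sum_congr rfl fun i _ => ?_
  rw [pderiv_realize]
  exact pderiv_fourierSynthesis (P.summable_derivSymbol_coef U t θ i)
    (P.summable_derivSymbol_derivSymbol_coef U t θ i i) x

lemma weight_mul_rpow_le {δ : ℝ} (hδ : 1 < δ) (hb : Real.log δ ≤ P.b) (k : Freq) (t : ℝ) :
    P.weight k t * δ ^ freqNorm k ≤ polyWeight k := by
  have h0 := freqNorm_nonneg k
  have hw := polyWeight_pos k
  rw [Real.rpow_def_of_pos (by linarith)]
  calc _ ≤ polyWeight k * Real.exp (-P.b * freqNorm k) * Real.exp (P.b * freqNorm k) := by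
        have := P.weight_pos k t
        gcongr
        exact P.weight_le k t
    _ = polyWeight k := by
        rw [mul_assoc, ← Real.exp_add]
        simp

lemma norm_coef_mul_rpow_le {δ : ℝ} (hδ : 1 < δ) (hb : Real.log δ ≤ P.b) (U : CoefSpace μ)
    (k : Freq) (t : ℝ) (θ : M) : ‖P.coef U k t θ‖ * δ ^ freqNorm k ≤ ‖U‖ * polyWeight k := by
  have := rpow_freqNorm_pos (by linarith : 0 < δ) k
  calc _ ≤ ‖U‖ * P.weight k t * δ ^ freqNorm k := by gcongr; exact P.norm_coef_le U k t θ
    _ = ‖U‖ * (P.weight k t * δ ^ freqNorm k) := by ring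
    _ ≤ _ := by gcongr; exact P.weight_mul_rpow_le hδ hb k t

lemma summable_coef_mul_rpow {δ : ℝ} (hδ : 1 < δ) (hb : Real.log δ ≤ P.b) (U : CoefSpace μ)
    (t : ℝ) (θ : M) : Summable fun k => ‖P.coef U k t θ‖ * δ ^ freqNorm k :=
  (summable_polyWeight.mul_left ‖U‖).of_nonneg_of_le
    (fun k => mul_nonneg (norm_nonneg _) (rpow_freqNorm_pos (by linarith) k).le)
    fun k => P.norm_coef_mul_rpow_le hδ hb U k t θ

lemma memB_realize {δ : ℝ} (hδ : 1 < δ) (hb : Real.log δ ≤ P.b) (U : CoefSpace μ) (t : ℝ) (θ : M) :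
    MemB δ (P.realize U t θ) :=
  memB_fourierSynthesis hδ.le ((P.isCoef_coef U).herm t θ) (P.summable_coef_mul_rpow hδ hb U t θ)

lemma bNorm_realize_le {δ : ℝ} (hδ : 1 < δ) (hb : Real.log δ ≤ P.b) (U : CoefSpace μ) (t : ℝ)
    (θ : M) :
    bNorm δ (P.realize U t θ) ≤ ‖U‖ := by
  rw [realize, bNorm_fourierSynthesis δ ((P.isCoef_coef U).herm t θ) (P.summable_coef U t θ)]
  refine ((P.summable_coef_mul_rpow hδ hb U t θ).tsum_le_tsum
    (fun k => P.norm_coef_mul_rpow_le hδ hb U k t θ) (summable_polyWeight.mul_left _)).trans ?_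
  rw [tsum_mul_left]
  exact mul_le_of_le_one_right (norm_nonneg _) (tsum_polyWeight.trans_le (by norm_num))

lemma abs_realize_le (U : CoefSpace μ) (t : ℝ) (θ : M) (x : T3) : |P.realize U t θ x| ≤ ‖U‖ := by
  refine (abs_fourierSynthesis_le (P.summable_coef U t θ) x).trans ?_
  refine ((P.summable_coef U t θ).tsum_le_tsum (fun k => (P.norm_coef_le U k t θ).trans
    (mul_le_mul_of_nonneg_left (P.weight_le_polyWeight k t) (norm_nonneg _)))
      (summable_polyWeight.mul_left _)).trans ?_
  rw [tsum_mul_left]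
  exact mul_le_of_le_one_right (norm_nonneg _) (tsum_polyWeight.trans_le (by norm_num))

lemma bNorm_realize_sub_realize (δ : ℝ) (U : CoefSpace μ) (s t : ℝ) (θ : M) :
    bNorm δ (fun x => P.realize U s θ x - P.realize U t θ x) =
      ∑' k, ‖P.coef U k s θ - P.coef U k t θ‖ * δ ^ freqNorm k := by
  have hsub : (fun x => P.realize U s θ x - P.realize U t θ x) =
      fourierSynthesis fun k => P.coef U k s θ - P.coef U k t θ :=
    funext fun x => (fourierSynthesis_sub (P.summable_coef U s θ) (P.summable_coef U t θ) x).symm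
  rw [hsub, bNorm_fourierSynthesis δ
    (((P.isCoef_coef U).herm s θ).sub ((P.isCoef_coef U).herm t θ))]
  exact ((P.summable_coef U s θ).add (P.summable_coef U t θ)).of_nonneg_of_le
    (fun _ => norm_nonneg _) fun k => norm_sub_le _ _

lemma contInB_realize {δ : ℝ} (hδ : 1 < δ) (hb : Real.log δ ≤ P.b) (U : CoefSpace μ) (θ : M)
    (T : ℝ) : ContInB T δ fun t => P.realize U t θ := by
  intro t _
  refine ⟨P.memB_realize hδ hb U t θ, ?_⟩
  simp only [P.bNorm_realize_sub_realize δ U]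
  rw [← tsum_zero (β := Freq)]
  refine tendsto_tsum_of_dominated_convergence (bound := fun k => 2 * (‖U‖ * polyWeight k))
    ((summable_polyWeight.mul_left _).mul_left _) (fun k => ?_) (Eventually.of_forall fun s k => ?_)
  · have hc : Continuous fun s => ‖P.coef U k s θ - P.coef U k t θ‖ * δ ^ freqNorm k :=
      (((P.isCoef_coef U).cont k θ).sub continuous_const).norm.mul continuous_const
    have hlim := hc.tendsto t
    simp only [sub_self, norm_zero, zero_mul] at hlim
    exact hlim.mono_left nhdsWithin_le_nhds
  · have hp := rpow_freqNorm_pos (by linarith : 0 < δ) k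
    rw [norm_mul, norm_norm, Real.norm_of_nonneg hp.le]
    calc _ ≤ (‖P.coef U k s θ‖ + ‖P.coef U k t θ‖) * δ ^ freqNorm k := by
          gcongr; exact norm_sub_le _ _
      _ ≤ _ := by
          linarith [P.norm_coef_mul_rpow_le hδ hb U k s θ, P.norm_coef_mul_rpow_le hδ hb U k t θ]

section Average

variable [IsProbabilityMeasure μ]

lemma integrable_realize (U : CoefSpace μ) (t : ℝ) (x : T3) :
    Integrable (fun θ => P.realize U t θ x) μ := by
  refine Integrable.of_bound ?_ ‖U‖ (Eventually.of_forall fun θ => P.abs_realize_le U t θ x)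
  exact Complex.continuous_re.comp_aestronglyMeasurable (aestronglyMeasurable_tsum
    (fun k => ((P.isCoef_coef U).meas k t).mul_const _)
    fun θ => summable_mul_mFourier (P.summable_coef U t θ) x)

lemma realize_average (U : CoefSpace μ) (t : ℝ) (θ : M) (x : T3) :
    P.realize (P.average U) t θ x = ∫ θ', P.realize U t θ' x ∂μ := by
  simp only [realize, coef_average]
  exact (integral_fourierSynthesis (fun k => (P.isCoef_coef U).meas k t)
    (summable_polyWeight.mul_left ‖U‖) (fun θ k => (P.norm_coef_le U k t θ).trans
      (mul_le_mul_of_nonneg_left (P.weight_le_polyWeight k t) (norm_nonneg _))) x).symm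

end Average

end AnalyticScale

/-! ### Identities for the symbols -/

lemma ofReal_freqNorm_sq (k : Freq) : (freqNorm k : ℂ) ^ 2 = ∑ j, (k j : ℂ) ^ 2 := by
  exact_mod_cast congrArg (fun r : ℝ => (r : ℂ)) (freqNorm_sq k)

lemma norm_angularFreq_sq_le (k : Freq) :
    ‖(angularFreq k : ℂ) ^ 2‖ ≤ 49 * (1 + freqNorm k) ^ 2 := by
  rw [norm_pow, Complex.norm_of_nonneg (angularFreq_nonneg k)]
  calc _ ≤ (7 * (1 + freqNorm k)) ^ 2 :=
        pow_le_pow_left₀ (angularFreq_nonneg k) (angularFreq_le_mul_one_add k) 2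
    _ = _ := by ring

lemma sum_derivSymbol_sq (k : Freq) :
    ∑ i, derivSymbol i k * derivSymbol i k = -((angularFreq k : ℂ) ^ 2) := by
  have h := ofReal_freqNorm_sq k
  simp only [Fin.sum_univ_three, derivSymbol, angularFreq] at h ⊢
  push_cast
  rw [mul_pow, h]
  linear_combination (4 * (Real.pi : ℂ) ^ 2 * ((k 0 : ℂ) ^ 2 + (k 1 : ℂ) ^ 2 + (k 2 : ℂ) ^ 2)) *
    Complex.I_sq

@[simp] lemma derivSymbol_zero (i : Fin 3) : derivSymbol i 0 = 0 := by simp [derivSymbol]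

@[simp] lemma curlSymbol_zero (i l : Fin 3) : curlSymbol i l 0 = 0 := by simp [curlSymbol]

lemma sum_curlSymbol_mul (i : Fin 3) (k : Freq) (a : Fin 3 → ℂ) :
    ∑ l, curlSymbol i l k * a l = derivSymbol (i + 1) k * a (i + 2) - derivSymbol (i + 2) k * a
      (i + 1) := by
  fin_cases i <;> simp [Fin.sum_univ_three, curlSymbol] <;> ring

lemma sum_derivSymbol_curlSymbol (k : Freq) (a : Fin 3 → ℂ) :
    ∑ i, derivSymbol i k * ∑ l, curlSymbol i l k * a l = 0 := by
  simp_rw [sum_curlSymbol_mul]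
  simp only [Fin.sum_univ_three]
  simp only [Fin.isValue, zero_add, show (1 : Fin 3) + 1 = 2 from rfl,
    show (1 : Fin 3) + 2 = 0 from rfl, show (2 : Fin 3) + 1 = 0 from rfl,
    show (2 : Fin 3) + 2 = 1 from rfl]
  ring

lemma sum_curlSymbol_curlSymbol (i : Fin 3) (k : Freq) (a : Fin 3 → ℂ)
    (ha : ∑ i, derivSymbol i k * a i = 0) :
    ∑ l, curlSymbol i l k * ∑ m, curlSymbol l m k * a m = (angularFreq k : ℂ) ^ 2 * a i := by
  rw [← neg_neg ((angularFreq k : ℂ) ^ 2), ← sum_derivSymbol_sq]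
  simp only [sum_curlSymbol_mul]
  simp only [Fin.sum_univ_three] at ha ⊢
  fin_cases i <;> simp only [Fin.zero_eta, Fin.mk_one, Fin.reduceFinMk, Fin.isValue, zero_add,
    show (1 : Fin 3) + 1 = 2 from rfl, show (1 : Fin 3) + 2 = 0 from rfl,
    show (2 : Fin 3) + 1 = 0 from rfl, show (2 : Fin 3) + 2 = 1 from rfl]
  · linear_combination derivSymbol 0 k * ha
  · linear_combination derivSymbol 1 k * ha
  · linear_combination derivSymbol 2 k * ha

lemma sum_leraySymbol_mul (i : Fin 3) (k : Freq) (c : Fin 3 → ℂ) :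
    ∑ j, leraySymbol i j k * c j =
      c i - (k i : ℂ) * (∑ j, (k j : ℂ) * c j) / ∑ j, (k j : ℂ) ^ 2 := by
  rw [← ofReal_freqNorm_sq]
  have e : ∀ j, leraySymbol i j k * c j = (if i = j then c j else 0) -
      (k i : ℂ) * ((k j : ℂ) * c j) / (freqNorm k : ℂ) ^ 2 := by
    intro j
    unfold leraySymbol
    split_ifs <;> push_cast <;> ring
  simp only [e, Finset.sum_sub_distrib, Finset.sum_ite_eq, Finset.mem_univ, if_true,
    Finset.mul_sum, Finset.sum_div]

lemma sum_derivSymbol_leraySymbol (k : Freq) (c : Fin 3 → ℂ) :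
    ∑ i, derivSymbol i k * ∑ j, leraySymbol i j k * c j = 0 := by
  by_cases hk : k = 0
  · simp [hk]
  have h0 : ∑ j, (k j : ℂ) ^ 2 ≠ 0 := by
    rw [← ofReal_freqNorm_sq]
    exact pow_ne_zero 2 (by exact_mod_cast (zero_lt_one.trans_le (one_le_freqNorm hk)).ne')
  simp only [sum_leraySymbol_mul]
  simp only [Fin.sum_univ_three, derivSymbol] at h0 ⊢
  field_simp
  ring

lemma curl_eq (F : T3 → Fin 3 → ℝ) (x : T3) (i : Fin 3) :
    curl F x i = pderiv (i + 1) (fun y => F y (i + 2)) x - pderiv (i + 2) (fun y => F y (i + 1))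
      x := by
  fin_cases i <;> rfl

lemma crossProduct_eq (v w : Fin 3 → ℝ) (i : Fin 3) :
    crossProduct v w i = v (i + 1) * w (i + 2) - v (i + 2) * w (i + 1) := by
  fin_cases i <;> simp [cross_apply]

lemma vel_eq_of_lorentz {ε h : ℝ} {ξ : Fin 3 → ℝ}
    (hh : h = -(1 / 2) * (h * h + ε ^ 2 * ((∑ j, ξ j ^ 2) * (1 + h) ^ 2))) (hpos : -1 < h)
    (i : Fin 3) : vel ε ξ i = ξ i + ξ i * h := by
  have h1 : (1 + ε ^ 2 * ∑ j, ξ j ^ 2) = ((1 + h)⁻¹) ^ 2 := by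
    have : 0 < 1 + h := by linarith
    rw [inv_pow]
    exact eq_inv_of_mul_eq_one_left (by linarith)
  have h2 : Real.sqrt (1 + ε ^ 2 * ∑ j, ξ j ^ 2) = (1 + h)⁻¹ := by
    rw [h1, Real.sqrt_sq (inv_nonneg.2 (by linarith))]
  rw [vel, h2, div_inv_eq_mul]
  ring

/-! ### Free electromagnetic fields -/

/-- The initial vector potential of a magnetic field with coefficients `b`. -/
def potCoef (b : Fin 3 → Freq → ℂ) (i : Fin 3) (k : Freq) : ℂ :=
  (∑ l, curlSymbol i l k * b l k) * ((1 / angularFreq k ^ 2 : ℝ) : ℂ)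

/-- The initial value of `ε ∂ₜ A`, for an electric field with coefficients `e` and a density with
coefficients `n`. -/
def velCoef (e : Fin 3 → Freq → ℂ) (n : Freq → ℂ) (i : Fin 3) (k : Freq) : ℂ :=
  -e i k - derivSymbol i k * ((1 / angularFreq k ^ 2 : ℝ) : ℂ) * n k

/-- The free evolution of the vector potential. -/
def freePot (ε : ℝ) (p q : Freq → ℂ) (k : Freq) (t : ℝ) : ℂ :=
  waveCos ε k t * p k + waveSin ε k t * q k

/-- The free evolution of `ε ∂ₜ A`. -/
def freeVel (ε : ℝ) (p q : Freq → ℂ) (k : Freq) (t : ℝ) : ℂ :=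
  -((angularFreq k : ℂ) ^ 2 * waveSin ε k t * p k) + waveCos ε k t * q k

lemma hasDerivAt_freePot {ε : ℝ} (p q : Freq → ℂ) (k : Freq) (t : ℝ) :
    HasDerivAt (freePot ε p q k) ((ε : ℂ)⁻¹ * freeVel ε p q k t) t := by
  have d := ((hasDerivAt_waveCos ε k t).ofReal_comp.mul_const (p k)).add
    ((hasDerivAt_waveSin ε k t).ofReal_comp.mul_const (q k))
  refine d.congr_deriv ?_
  unfold freeVel
  push_cast
  ring

lemma hasDerivAt_freeVel {ε : ℝ} (p q : Freq → ℂ) (k : Freq) (t : ℝ) :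
    HasDerivAt (freeVel ε p q k) (-((angularFreq k : ℂ) ^ 2 * (ε : ℂ)⁻¹ * freePot ε p q k t))
      t := by
  have d := ((((hasDerivAt_waveSin ε k t).ofReal_comp.const_mul ((angularFreq k : ℂ) ^ 2)).mul_const
    (p k)).neg).add ((hasDerivAt_waveCos ε k t).ofReal_comp.mul_const (q k))
  refine d.congr_deriv ?_
  unfold freePot
  push_cast
  ring

lemma freePot_zero (ε : ℝ) (p q : Freq → ℂ) (k : Freq) : freePot ε p q k 0 = p k := by
  simp [freePot]

lemma freeVel_zero (ε : ℝ) (p q : Freq → ℂ) (k : Freq) : freeVel ε p q k 0 = q k := by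
  simp [freeVel]

lemma angularFreq_sq_mul_inv {k : Freq} (hk : k ≠ 0) :
    (angularFreq k : ℂ) ^ 2 * ((1 / angularFreq k ^ 2 : ℝ) : ℂ) = 1 := by
  have := (angularFreq_pos hk).ne'
  have h : angularFreq k ^ 2 * (1 / angularFreq k ^ 2) = 1 := by field_simp
  exact_mod_cast h

lemma sum_derivSymbol_potCoef (b : Fin 3 → Freq → ℂ) (k : Freq) :
    ∑ i, derivSymbol i k * potCoef b i k = 0 := by
  simp only [potCoef, ← mul_assoc, ← Finset.sum_mul]
  rw [sum_derivSymbol_curlSymbol k fun l => b l k, zero_mul]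

lemma sum_derivSymbol_velCoef {e : Fin 3 → Freq → ℂ} {n : Freq → ℂ} {k : Freq}
    (h : k ≠ 0 → ∑ i, derivSymbol i k * e i k = n k) :
      ∑ i, derivSymbol i k * velCoef e n i k = 0 := by
  by_cases hk : k = 0
  · simp [hk]
  have h1 := sum_derivSymbol_sq k
  have h2 := angularFreq_sq_mul_inv hk
  have h3 := h hk
  have : ∑ i, derivSymbol i k * velCoef e n i k = -(∑ i, derivSymbol i k * e i k)
      - (∑ i, derivSymbol i k * derivSymbol i k) * (((1 / angularFreq k ^ 2 : ℝ) : ℂ) * n k) := by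
    rw [Finset.sum_mul, ← Finset.sum_neg_distrib, ← Finset.sum_sub_distrib]
    refine Finset.sum_congr rfl fun i _ => ?_
    rw [velCoef]
    ring
  rw [this, h3, h1]
  linear_combination n k * h2

lemma sum_curlSymbol_potCoef {b : Fin 3 → Freq → ℂ} {k : Freq} (hk : k ≠ 0)
    (h : ∑ i, derivSymbol i k * b i k = 0) (i : Fin 3) :
      ∑ l, curlSymbol i l k * potCoef b l k = b i k := by
  simp only [potCoef, ← mul_assoc, ← Finset.sum_mul]
  rw [sum_curlSymbol_curlSymbol i k (fun l => b l k) h]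
  linear_combination b i k * angularFreq_sq_mul_inv hk

namespace AnalyticScale

variable (P : AnalyticScale) {M : Type*} [MeasurableSpace M] {μ : Measure M}

/-! ### Differential operators and time derivatives of realizations -/

lemma summable_angularFreq_sq_coef (U : CoefSpace μ) (t : ℝ) (θ : M) :
    Summable fun k => ‖(angularFreq k : ℂ) ^ 2 * P.coef U k t θ‖ :=
  P.summable_mul_coef norm_angularFreq_sq_le U t θ

lemma laplacian_realize_eq_neg (U : CoefSpace μ) (t : ℝ) (θ : M) (x : T3) :
    laplacian (P.realize U t θ) x =
      -fourierSynthesis (fun k => (angularFreq k : ℂ) ^ 2 * P.coef U k t θ) x := by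
  rw [laplacian_realize, ← fourierSynthesis_sum _ fun i _ =>
    P.summable_derivSymbol_derivSymbol_coef U t θ i i, ← fourierSynthesis_neg]
  simp only [← mul_assoc, ← Finset.sum_mul, sum_derivSymbol_sq, neg_mul]

lemma divergence_realize (U : Fin 3 → CoefSpace μ) (t : ℝ) (θ : M) (x : T3) :
    divergence (fun y i => P.realize (U i) t θ y) x =
      fourierSynthesis (fun k => ∑ i, derivSymbol i k * P.coef (U i) k t θ) x := by
  rw [fourierSynthesis_sum _ fun i _ => P.summable_derivSymbol_coef (U i) t θ i]
  exact Finset.sum_congr rfl fun i _ => congrFun (P.pderiv_realize (U i) t θ i) x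

lemma curl_realize (U : Fin 3 → CoefSpace μ) (t : ℝ) (θ : M) (x : T3) (i : Fin 3) :
    curl (fun y l => P.realize (U l) t θ y) x i =
      fourierSynthesis (fun k => ∑ l, curlSymbol i l k * P.coef (U l) k t θ) x := by
  simp only [sum_curlSymbol_mul i _ fun l => P.coef (U l) _ t θ]
  rw [curl_eq, fourierSynthesis_sub (P.summable_derivSymbol_coef _ t θ _)
    (P.summable_derivSymbol_coef _ t θ _), ← pderiv_realize, ← pderiv_realize]

lemma summable_sum_curlSymbol_coef (U : Fin 3 → CoefSpace μ) (t : ℝ) (θ : M) (i : Fin 3) :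
    Summable fun k => ‖∑ l, curlSymbol i l k * P.coef (U l) k t θ‖ := by
  simp only [sum_curlSymbol_mul i _ fun l => P.coef (U l) _ t θ]
  exact ((P.summable_derivSymbol_coef _ t θ _).add
    (P.summable_derivSymbol_coef _ t θ _)).of_nonneg_of_le
    (fun _ => norm_nonneg _) fun k => norm_sub_le _ _

lemma continuous_coef (U : CoefSpace μ) (k : Freq) (θ : M) : Continuous fun t => P.coef U k t θ :=
  (P.isCoef_coef U).cont k θ

lemma hasDerivWithinAt_realize (U : CoefSpace μ) (θ : M) {a' : Freq → ℝ → ℂ} {w : Freq → ℝ}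
    (hw : Summable w) (haw : ∀ k t, ‖a' k t‖ ≤ w k) (hc : ∀ k, Continuous (a' k))
    (h : ∀ k, ∀ t ∈ Icc 0 P.T, HasDerivWithinAt (fun s => P.coef U k s θ) (a' k t) (Icc 0 P.T) t)
    (x : T3) {t : ℝ} (ht : t ∈ Icc 0 P.T) :
    HasDerivWithinAt (fun s => P.realize U s θ x) (fourierSynthesis (fun k => a' k t) x)
      (Icc 0 P.T) t :=
  hasDerivWithinAt_fourierSynthesis P.T_pos (a := fun k s => P.coef U k s θ) h
    (fun k => (hc k).continuousOn) hw (fun k t _ => haw k t) (P.summable_coef U 0 θ) x ht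

lemma hasDerivWithinAt_realize_of_coef {U V : CoefSpace μ} {θ : M}
    (h : ∀ k, ∀ t ∈ Icc 0 P.T,
      HasDerivWithinAt (fun s => P.coef U k s θ) (P.coef V k t θ) (Icc 0 P.T) t)
    (x : T3) {t : ℝ} (ht : t ∈ Icc 0 P.T) :
    HasDerivWithinAt (fun s => P.realize U s θ x) (P.realize V t θ x) (Icc 0 P.T) t := by
  obtain ⟨w, hw, hwb⟩ := P.exists_summable_pow_mul_norm_coef_le V 0
  exact P.hasDerivWithinAt_realize U θ hw (fun k t => by simpa using hwb k t θ)
    (fun k => P.continuous_coef V k θ) h x ht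

variable {P}

lemma hasDerivWithinAt_of_clamp {f g : ℝ → ℂ} {g' : ℂ} {t : ℝ} (ht : t ∈ Icc 0 P.T)
    (hfg : ∀ s, f s = g (P.clamp s)) (hg : HasDerivAt g g' t) :
    HasDerivWithinAt f g' (Icc 0 P.T) t :=
  hg.hasDerivWithinAt.congr (fun s hs => by rw [hfg, P.clamp_of_mem hs])
    (by rw [hfg, P.clamp_of_mem ht])

lemma hasDerivWithinAt_integral_clamp {f : ℝ → ℂ} (hf : Continuous f) {t : ℝ}
    (ht : t ∈ Icc 0 P.T) :
    HasDerivWithinAt (fun s => ∫ r in (0 : ℝ)..P.clamp s, f r) (f t) (Icc 0 P.T) t :=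
  hasDerivWithinAt_of_clamp ht (fun _ => rfl) (hf.integral_hasStrictDerivAt 0 t).hasDerivAt

end AnalyticScale

namespace PicardData

variable {M : Type*} [MeasurableSpace M] {μ : Measure M}

/-! ### Potentials of a fixed point -/

/-- `D` encodes initial data with Fourier coefficients `r₀` (densities), `x₀` (velocities), `e₀`
and `b₀` (electromagnetic field); `afree` and `wfree` are the free evolutions of `A` and `ε ∂ₜA`.
The velocity datum is `1 + |k|` times that of `ξ + ε A`, minus the free part of `ε A`: in the
equation for `ξ + ε A` the term `-ε ∂ₜA` of the electric field, which is not small, is absorbed. -/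
structure Adapted (D : PicardData μ) (r₀ : M → Freq → ℂ) (x₀ : Fin 3 → M → Freq → ℂ)
    (e₀ b₀ : Fin 3 → Freq → ℂ) (afree wfree : Fin 3 → CoefSpace μ) : Prop where
  coef_rin : ∀ k t θ, D.P.coef D.rin k t θ = r₀ θ k
  coef_afree : ∀ i k t θ, D.P.coef (afree i) k t θ =
    freePot D.eps (potCoef b₀ i) (velCoef e₀ (fun k => ∫ θ, r₀ θ k ∂μ) i) k (D.P.clamp t)
  coef_wfree : ∀ i k t θ, D.P.coef (wfree i) k t θ =
    freeVel D.eps (potCoef b₀ i) (velCoef e₀ (fun k => ∫ θ, r₀ θ k ∂μ) i) k (D.P.clamp t)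
  coef_xin : ∀ i k t θ, D.P.coef (D.xin i) k t θ = ((1 + freqNorm k : ℝ) : ℂ) *
    (x₀ i θ k + D.eps * potCoef b₀ i k - D.eps * D.P.coef (afree i) k t θ)
  coef_bin : ∀ i k t θ, D.P.coef (D.bin i) k t θ =
    ∑ l, curlSymbol i l k * D.P.coef (afree l) k t θ + if k = 0 then b₀ i 0 else 0
  gauss : ∀ k, k ≠ 0 → ∑ i, derivSymbol i k * e₀ i k = ∫ θ, r₀ θ k ∂μ
  total : ∫ θ, r₀ θ 0 ∂μ = 1
  solenoidal : ∀ k, ∑ i, derivSymbol i k * b₀ i k = 0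

variable {D : PicardData μ} {r₀ : M → Freq → ℂ} {x₀ : Fin 3 → M → Freq → ℂ}
  {e₀ b₀ : Fin 3 → Freq → ℂ} {afree wfree : Fin 3 → CoefSpace μ} {u : State μ}

lemma coef_dxi (i j : Fin 3) (k : Freq) (t : ℝ) (θ : M) :
    D.P.coef (D.dxi i j u) k t θ = derivSymbol j k * D.P.coef (D.xi i u) k t θ := by
  simp [dxi, xi, mul_assoc]

lemma pderiv_xi (i j : Fin 3) (t : ℝ) (θ : M) :
    pderiv j (D.P.realize (D.xi i u) t θ) = D.P.realize (D.dxi i j u) t θ := by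
  rw [pderiv_realize]
  simp only [realize, coef_dxi]

lemma realize_flux (i : Fin 3) (t : ℝ) (θ : M) (x : T3) :
    D.P.realize (D.flux i u) t θ x =
      D.P.realize (D.velocity i u) t θ x * D.P.realize u.1 t θ x :=
  realize_mul _ _ _ _ _ _

lemma realize_xiSq (t : ℝ) (θ : M) (x : T3) :
    D.P.realize (D.xiSq u) t θ x = ∑ i, D.P.realize (D.xi i u) t θ x ^ 2 := by
  simp only [xiSq, realize_sum, realize_mul, sq]

variable [IsProbabilityMeasure μ]

/-- The vector potential. -/
def pot (D : PicardData μ) (afree : Fin 3 → CoefSpace μ) (u : State μ) (i : Fin 3) : CoefSpace μ :=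
  afree i + duhamel (isKernel_waveSin D.P D.eps_pos D.eps_le D.T_le) (D.lerayCurrent i u)

/-- The field `ε ∂ₜ A`. -/
def potVel (D : PicardData μ) (wfree : Fin 3 → CoefSpace μ) (u : State μ) (i : Fin 3) :
    CoefSpace μ :=
  wfree i + duhamel (isKernel_waveCos D.P D.eps) (D.lerayCurrent i u)

/-- The scalar potential. -/
def phi (D : PicardData μ) (u : State μ) : CoefSpace μ :=
  D.P.multiplier isSymbol_invLaplacian (D.P.average u.1)

/-- The coefficients of `ε ∂ₜ² A`; since the wave equation costs two derivatives, they are not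
given as an element of the coefficient space. -/
def potAcc (D : PicardData μ) (afree : Fin 3 → CoefSpace μ) (u : State μ) (i : Fin 3) (t : ℝ)
    (θ : M) (k : Freq) : ℂ :=
  D.P.coef (D.lerayCurrent i u) k t θ -
    ((D.eps⁻¹ : ℝ) : ℂ) * ((angularFreq k : ℂ) ^ 2 * D.P.coef (D.pot afree u i) k t θ)

lemma coef_lerayCurrent (i : Fin 3) (k : Freq) (t : ℝ) (θ : M) :
    D.P.coef (D.lerayCurrent i u) k t θ =
      ∑ j, leraySymbol i j k * ∫ θ', D.P.coef (D.flux j u) k t θ' ∂μ := by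
  simp [lerayCurrent, totalCurrent, coef_sum]

lemma coef_phi (k : Freq) (t : ℝ) (θ : M) : D.P.coef (D.phi u) k t θ =
    ((1 / angularFreq k ^ 2 : ℝ) : ℂ) * ∫ θ', D.P.coef u.1 k t θ' ∂μ := by
  simp [phi]

lemma coef_gradPhi (i : Fin 3) (k : Freq) (t : ℝ) (θ : M) :
    D.P.coef (D.gradPhi i u) k t θ = derivSymbol i k * D.P.coef (D.phi u) k t θ := by
  simp [gradPhi, phi, mul_assoc]

lemma coef_magnetic (hD : D.Adapted r₀ x₀ e₀ b₀ afree wfree) (i : Fin 3) (k : Freq) (t : ℝ)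
    (θ : M) : D.P.coef (D.magnetic i u) k t θ =
      ∑ l, curlSymbol i l k * D.P.coef (D.pot afree u l) k t θ + if k = 0 then b₀ i 0 else 0 := by
  simp only [magnetic, inducedMagnetic, pot, coef_add, coef_sum, coef_duhamel, hD.coef_bin,
    mul_add, mul_assoc, intervalIntegral.integral_const_mul, Finset.sum_add_distrib]
  ring

/-! ### Evolution of the coefficients of a fixed point -/

lemma coef_rho (hD : D.Adapted r₀ x₀ e₀ b₀ afree wfree) (hu : D.picard u = u) (k : Freq) (t : ℝ)
    (θ : M) : D.P.coef u.1 k t θ =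
      r₀ θ k - ∫ s in (0 : ℝ)..D.P.clamp t, ∑ j, derivSymbol j k * D.P.coef (D.flux j u) k s θ := by
  have h : u.1 = D.picardRho u := congrArg Prod.fst hu.symm
  rw [h, picardRho, coef_sub, coef_sum, hD.coef_rin,
    intervalIntegral.integral_finsetSum fun j _ =>
      ((D.P.continuous_coef _ k θ).const_mul _).intervalIntegrable _ _]
  simp only [coef_duhamel]

lemma coef_xi (hD : D.Adapted r₀ x₀ e₀ b₀ afree wfree) (hu : D.picard u = u) (i : Fin 3) (k : Freq)
    (t : ℝ) (θ : M) : D.P.coef (D.xi i u) k t θ =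
      x₀ i θ k + D.eps * potCoef b₀ i k - D.eps * D.P.coef (D.pot afree u i) k t θ
        - ∫ s in (0 : ℝ)..D.P.clamp t, D.P.coef (D.force i u) k s θ := by
  have h : u.2.1 i = D.picardXi i u := congrFun (congrArg (fun v : State μ => v.2.1) hu.symm) i
  have hk : (1 : ℂ) + (freqNorm k : ℂ) ≠ 0 := by
    have := freqNorm_nonneg k
    exact_mod_cast (by linarith : 0 < 1 + freqNorm k).ne'
  have e : ∀ s, (((1 + freqNorm k) * (D.eps * waveSin D.eps k (D.P.clamp t - s)) : ℝ) : ℂ) *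
      D.P.coef (D.lerayCurrent i u) k s θ = ((1 : ℂ) + freqNorm k) * D.eps *
      ((waveSin D.eps k (D.P.clamp t - s) : ℂ) * D.P.coef (D.lerayCurrent i u) k s θ) := by
    intro s
    push_cast
    ring
  rw [xi, coef_multiplier, h, picardXi, coef_sub, coef_sub, hD.coef_xin, pot, coef_add]
  simp only [coef_duhamel, e, intervalIntegral.integral_const_mul]
  push_cast
  field_simp
  ring

section InitialValues

variable (hD : D.Adapted r₀ x₀ e₀ b₀ afree wfree)

lemma clamp_zero (P : AnalyticScale) : P.clamp 0 = 0 := P.clamp_of_mem ⟨le_rfl, P.T_pos.le⟩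

include hD

lemma coef_pot_zero (i : Fin 3) (k : Freq) (θ : M) :
    D.P.coef (D.pot afree u i) k 0 θ = potCoef b₀ i k := by
  simp [pot, coef_add, hD.coef_afree, clamp_zero, freePot_zero]

lemma coef_potVel_zero (i : Fin 3) (k : Freq) (θ : M) :
    D.P.coef (D.potVel wfree u i) k 0 θ = velCoef e₀ (fun k => ∫ θ, r₀ θ k ∂μ) i k := by
  simp [potVel, coef_add, hD.coef_wfree, clamp_zero, freeVel_zero]

lemma coef_rho_zero (hu : D.picard u = u) (k : Freq) (θ : M) : D.P.coef u.1 k 0 θ = r₀ θ k := by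
  simp [coef_rho hD hu, clamp_zero]

lemma coef_xi_zero (hu : D.picard u = u) (i : Fin 3) (k : Freq) (θ : M) :
    D.P.coef (D.xi i u) k 0 θ = x₀ i θ k := by
  simp [coef_xi hD hu, clamp_zero, coef_pot_zero hD]

end InitialValues

lemma hasDerivWithinAt_coef_rho (hD : D.Adapted r₀ x₀ e₀ b₀ afree wfree) (hu : D.picard u = u)
    (k : Freq) (θ : M) {t : ℝ} (ht : t ∈ Icc 0 D.P.T) :
    HasDerivWithinAt (fun s => D.P.coef u.1 k s θ)
      (-∑ j, derivSymbol j k * D.P.coef (D.flux j u) k t θ) (Icc 0 D.P.T) t := by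
  simp only [coef_rho hD hu]
  exact (hasDerivWithinAt_integral_clamp
    (continuous_finsetSum _ fun j _ => (D.P.continuous_coef _ k θ).const_mul _) ht).const_sub _

lemma hasDerivWithinAt_coef_pot (hD : D.Adapted r₀ x₀ e₀ b₀ afree wfree)
    (i : Fin 3) (k : Freq) (θ : M) {t : ℝ} (ht : t ∈ Icc 0 D.P.T) :
    HasDerivWithinAt (fun s => D.P.coef (D.pot afree u i) k s θ)
      ((D.eps : ℂ)⁻¹ * D.P.coef (D.potVel wfree u i) k t θ) (Icc 0 D.P.T) t := by
  have hd := (hasDerivAt_freePot (ε := D.eps) (potCoef b₀ i)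
    (velCoef e₀ (fun k => ∫ θ, r₀ θ k ∂μ) i) k t).add
    (hasDerivAt_integral_waveSin (D.P.continuous_coef (D.lerayCurrent i u) k θ) D.eps k t)
  refine (hasDerivWithinAt_of_clamp ht (fun s => ?_) hd).congr_deriv ?_
  · simp [pot, coef_add, hD.coef_afree]
  · simp [potVel, coef_add, hD.coef_wfree, D.P.clamp_of_mem ht, mul_add]

lemma hasDerivWithinAt_coef_potVel (hD : D.Adapted r₀ x₀ e₀ b₀ afree wfree)
    (i : Fin 3) (k : Freq) (θ : M) {t : ℝ} (ht : t ∈ Icc 0 D.P.T) :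
    HasDerivWithinAt (fun s => D.P.coef (D.potVel wfree u i) k s θ)
      (D.potAcc afree u i t θ k) (Icc 0 D.P.T) t := by
  have hd := (hasDerivAt_freeVel (ε := D.eps) (potCoef b₀ i)
    (velCoef e₀ (fun k => ∫ θ, r₀ θ k ∂μ) i) k t).add
    (hasDerivAt_integral_waveCos (D.P.continuous_coef (D.lerayCurrent i u) k θ) D.eps k t)
  refine (hasDerivWithinAt_of_clamp ht (fun s => ?_) hd).congr_deriv ?_
  · simp [potVel, coef_add, hD.coef_wfree]
  · simp only [potAcc, pot, coef_add, hD.coef_afree, D.P.clamp_of_mem ht, coef_duhamel]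
    push_cast
    ring

lemma hasDerivWithinAt_coef_xi (hD : D.Adapted r₀ x₀ e₀ b₀ afree wfree) (hu : D.picard u = u)
    (i : Fin 3) (k : Freq) (θ : M) {t : ℝ} (ht : t ∈ Icc 0 D.P.T) :
    HasDerivWithinAt (fun s => D.P.coef (D.xi i u) k s θ)
      (D.P.coef (-(D.potVel wfree u i + D.force i u)) k t θ) (Icc 0 D.P.T) t := by
  simp only [coef_xi hD hu]
  have h0 : (D.eps : ℂ) ≠ 0 := by exact_mod_cast D.eps_pos.ne'
  have hpot := (hasDerivWithinAt_coef_pot (u := u) hD i k θ ht).const_mul (D.eps : ℂ)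
  have hforce := hasDerivWithinAt_integral_clamp (D.P.continuous_coef (D.force i u) k θ) ht
  refine ((hpot.const_sub _).sub hforce).congr_deriv ?_
  rw [coef_neg, coef_add, mul_inv_cancel_left₀ h0]
  ring

/-! ### Evolution of the functions of a fixed point -/

lemma hasDerivWithinAt_rho (hD : D.Adapted r₀ x₀ e₀ b₀ afree wfree) (hu : D.picard u = u) (θ : M)
    (x : T3) {t : ℝ} (ht : t ∈ Icc 0 D.P.T) :
    HasDerivWithinAt (fun s => D.P.realize u.1 s θ x)
      (-divergence (fun y i => D.P.realize (D.flux i u) t θ y) x) (Icc 0 D.P.T) t := by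
  choose w hw hwb using fun j => D.P.exists_summable_norm_mul_coef_le (C := 7) (n := 1)
    (p := derivSymbol j) (by simpa using norm_derivSymbol_le_mul_one_add j) (D.flux j u)
  rw [divergence_realize, ← fourierSynthesis_neg]
  refine D.P.hasDerivWithinAt_realize u.1 θ
    (a' := fun k t => -∑ j, derivSymbol j k * D.P.coef (D.flux j u) k t θ)
    (summable_sum fun j (_ : j ∈ Finset.univ) => hw j) (fun k t => ?_)
    (fun k => (continuous_finsetSum _ fun j _ => (D.P.continuous_coef _ k θ).const_mul _).neg)
    (fun k t ht => hasDerivWithinAt_coef_rho hD hu k θ ht) x ht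
  rw [norm_neg]
  exact norm_sum_le_of_le _ fun j _ => hwb j k t θ

lemma hasDerivWithinAt_xi (hD : D.Adapted r₀ x₀ e₀ b₀ afree wfree) (hu : D.picard u = u) (i : Fin 3)
    (θ : M) (x : T3) {t : ℝ} (ht : t ∈ Icc 0 D.P.T) :
    HasDerivWithinAt (fun s => D.P.realize (D.xi i u) s θ x)
      (-(D.P.realize (D.potVel wfree u i) t θ x + D.P.realize (D.force i u) t θ x))
      (Icc 0 D.P.T) t := by
  rw [← realize_add, ← realize_neg]
  exact D.P.hasDerivWithinAt_realize_of_coef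
    (fun k t ht => hasDerivWithinAt_coef_xi hD hu i k θ ht) x ht

lemma hasDerivWithinAt_pot (hD : D.Adapted r₀ x₀ e₀ b₀ afree wfree) (i : Fin 3)
    (θ : M) (x : T3) {t : ℝ} (ht : t ∈ Icc 0 D.P.T) :
    HasDerivWithinAt (fun s => D.P.realize (D.pot afree u i) s θ x)
      (D.eps⁻¹ * D.P.realize (D.potVel wfree u i) t θ x) (Icc 0 D.P.T) t := by
  rw [← realize_smul]
  refine D.P.hasDerivWithinAt_realize_of_coef (fun k t ht => ?_) x ht
  rw [coef_smul, Complex.ofReal_inv]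
  exact hasDerivWithinAt_coef_pot hD i k θ ht

lemma hasDerivWithinAt_potVel (hD : D.Adapted r₀ x₀ e₀ b₀ afree wfree) (i : Fin 3)
    (θ : M) (x : T3) {t : ℝ} (ht : t ∈ Icc 0 D.P.T) :
    HasDerivWithinAt (fun s => D.P.realize (D.potVel wfree u i) s θ x)
      (fourierSynthesis (D.potAcc afree u i t θ) x) (Icc 0 D.P.T) t := by
  obtain ⟨w, hw, hwb⟩ := D.P.exists_summable_pow_mul_norm_coef_le (D.lerayCurrent i u) 0
  obtain ⟨w', hw', hwb'⟩ :=
    D.P.exists_summable_norm_mul_coef_le norm_angularFreq_sq_le (D.pot afree u i)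
  refine D.P.hasDerivWithinAt_realize (D.potVel wfree u i) θ
    (a' := fun k t => D.potAcc afree u i t θ k) (hw.add (hw'.mul_left D.eps⁻¹)) (fun k t => ?_)
    (fun k => (D.P.continuous_coef (D.lerayCurrent i u) k θ).sub
      (((D.P.continuous_coef (D.pot afree u i) k θ).const_mul _).const_mul _))
    (fun k t ht => hasDerivWithinAt_coef_potVel hD i k θ ht) x ht
  have he : 0 ≤ D.eps⁻¹ := inv_nonneg.2 D.eps_pos.le
  refine norm_sub_le_of_le (by simpa using hwb k t θ) ?_
  rw [norm_mul, Complex.norm_of_nonneg he]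
  exact mul_le_mul_of_nonneg_left (hwb' k t θ) he

end PicardData

/-! ### A fixed point solves the Vlasov-Maxwell system -/

namespace PicardData

variable {M : Type*} [MeasurableSpace M] {μ : Measure M} [IsProbabilityMeasure μ]
  {D : PicardData μ} {r₀ : M → Freq → ℂ} {x₀ : Fin 3 → M → Freq → ℂ}
  {e₀ b₀ : Fin 3 → Freq → ℂ} {afree wfree : Fin 3 → CoefSpace μ} {u : State μ}

lemma realize_gradPhi_eq (i : Fin 3) (t : ℝ) (θ θ' : M) :
    D.P.realize (D.gradPhi i u) t θ = D.P.realize (D.gradPhi i u) t θ' := by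
  simp only [realize, coef_gradPhi, coef_phi]

lemma realize_potVel_eq (hD : D.Adapted r₀ x₀ e₀ b₀ afree wfree) (i : Fin 3) (t : ℝ) (θ θ' : M) :
    D.P.realize (D.potVel wfree u i) t θ = D.P.realize (D.potVel wfree u i) t θ' := by
  simp only [realize, potVel, coef_add, hD.coef_wfree, coef_duhamel, coef_lerayCurrent]

lemma realize_magnetic_eq (hD : D.Adapted r₀ x₀ e₀ b₀ afree wfree) (i : Fin 3) (t : ℝ)
    (θ θ' : M) : D.P.realize (D.magnetic i u) t θ = D.P.realize (D.magnetic i u) t θ' := by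
  simp only [realize, magnetic, inducedMagnetic, coef_add, coef_sum, hD.coef_bin, hD.coef_afree,
    coef_duhamel, coef_lerayCurrent]

lemma vel_realize_xi (hu : D.picard u = u) (hh : ‖u.2.2‖ ≤ 1 / 4) (i : Fin 3) (t : ℝ) (θ : M)
    (x : T3) :
    vel D.eps (fun i => D.P.realize (D.xi i u) t θ x) i = D.P.realize (D.velocity i u) t θ x := by
  have h : D.picardH u = u.2.2 := congrArg (fun v : State μ => v.2.2) hu
  have hfix := congrArg (fun U => D.P.realize U t θ x) h
  simp only [picardH, lorentzTerm, realize_smul, realize_add, realize_mul, realize_xiSq] at hfix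
  have hle := (abs_le.1 ((D.P.abs_realize_le u.2.2 t θ x).trans hh)).1
  rw [velocity, realize_add, realize_mul]
  refine vel_eq_of_lorentz (h := D.P.realize u.2.2 t θ x) ?_ (by linarith) i
  refine hfix.symm.trans ?_
  ring

lemma grad_phi (i : Fin 3) (t : ℝ) (θ : M) (x : T3) :
    grad (D.P.realize (D.phi u) t θ) x i = D.P.realize (D.gradPhi i u) t θ x := by
  rw [grad, pderiv_realize]
  simp only [realize, coef_gradPhi]

lemma realize_force (i : Fin 3) (t : ℝ) (θ : M) (x : T3) :
    D.P.realize (D.force i u) t θ x =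
      ∑ j, D.P.realize (D.velocity j u) t θ x * D.P.realize (D.dxi i j u) t θ x
        + D.P.realize (D.gradPhi i u) t θ x
        - D.eps * (D.P.realize (D.velocity (i + 1) u) t θ x *
            D.P.realize (D.magnetic (i + 2) u) t θ x
          - D.P.realize (D.velocity (i + 2) u) t θ x *
            D.P.realize (D.magnetic (i + 1) u) t θ x) := by
  simp only [force, magneticForce, realize_sub, realize_add, realize_sum, realize_mul,
    realize_smul]
  ring

lemma current_realize (hu : D.picard u = u) (hh : ‖u.2.2‖ ≤ 1 / 4) (t : ℝ) (θ₀ : M) (x : T3)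
    (i : Fin 3) :
    current μ D.eps (D.P.realize u.1 t) (fun θ x i => D.P.realize (D.xi i u) t θ x) x i =
      D.P.realize (D.totalCurrent i u) t θ₀ x := by
  simp only [totalCurrent, realize_average, current, vel_realize_xi hu hh, realize_flux]

lemma leray_current_realize (hu : D.picard u = u) (hh : ‖u.2.2‖ ≤ 1 / 4) (t : ℝ) (θ₀ : M) (x : T3)
    (i : Fin 3) :
    leray (current μ D.eps (D.P.realize u.1 t) (fun θ x i => D.P.realize (D.xi i u) t θ x)) x i =
      D.P.realize (D.lerayCurrent i u) t θ₀ x := by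
  have h : ∀ j, fourierCoef (D.P.realize (D.totalCurrent j u) t θ₀) =
      fun k => D.P.coef (D.totalCurrent j u) k t θ₀ := fun j => funext fun k =>
    fourierCoef_fourierSynthesis (D.P.summable_coef _ t θ₀) ((D.P.isCoef_coef _).herm t θ₀) k
  simp only [leray, current_realize hu hh t θ₀, h]
  rw [realize, fourierSynthesis]
  congr 1
  refine tsum_congr fun k => ?_
  rw [← sum_leraySymbol_mul i k fun j => D.P.coef (D.totalCurrent j u) k t θ₀]
  simp only [lerayCurrent, coef_sum, coef_multiplier]

lemma elec_realize (θ₀ : M) (t : ℝ) (x : T3) (i : Fin 3) :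
    elec D.eps (fun t => D.P.realize (D.phi u) t θ₀)
      (fun t x i => D.eps⁻¹ * D.P.realize (D.potVel wfree u i) t θ₀ x) t x i =
      D.P.realize (-D.gradPhi i u - D.potVel wfree u i) t θ₀ x := by
  rw [elec, grad_phi, realize_sub, realize_neg, mul_inv_cancel_left₀ D.eps_pos.ne']

lemma magn_realize {B0 : T3 → Fin 3 → ℝ}
    (hD : D.Adapted r₀ x₀ e₀ (fun i => fourierCoef fun x => B0 x i) afree wfree)
    (θ₀ : M) (t : ℝ) (x : T3) (i : Fin 3) :
    magn B0 (fun t x i => D.P.realize (D.pot afree u i) t θ₀ x) t x i =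
      D.P.realize (D.magnetic i u) t θ₀ x := by
  rw [magn, D.P.curl_realize, mean_eq_re_fourierCoef, ← fourierSynthesis_ite_zero _ x,
    ← fourierSynthesis_add (D.P.summable_sum_curlSymbol_coef _ t θ₀ i) (summable_norm_ite_zero _)]
  simp only [realize, coef_magnetic hD]

lemma hasDerivWithinAt_xi_momentum {B0 : T3 → Fin 3 → ℝ}
    (hD : D.Adapted r₀ x₀ e₀ (fun i => fourierCoef fun x => B0 x i) afree wfree)
    (hu : D.picard u = u) (hh : ‖u.2.2‖ ≤ 1 / 4) (θ₀ θ : M) {t : ℝ} (ht : t ∈ Icc 0 D.P.T)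
    (x : T3) (i : Fin 3) :
    HasDerivWithinAt (fun s => D.P.realize (D.xi i u) s θ x)
      (-(∑ j, vel D.eps (fun i => D.P.realize (D.xi i u) t θ x) j *
            pderiv j (D.P.realize (D.xi i u) t θ) x)
        + elec D.eps (fun t => D.P.realize (D.phi u) t θ₀)
            (fun t x i => D.eps⁻¹ * D.P.realize (D.potVel wfree u i) t θ₀ x) t x i
        + D.eps * crossProduct (vel D.eps fun i => D.P.realize (D.xi i u) t θ x)
            (magn B0 (fun t x i => D.P.realize (D.pot afree u i) t θ₀ x) t x) i)
      (Icc 0 D.P.T) t := by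
  refine (hasDerivWithinAt_xi hD hu i θ x ht).congr_deriv ?_
  simp only [pderiv_xi, crossProduct_eq, vel_realize_xi hu hh, elec_realize, magn_realize hD,
    realize_force, realize_sub, realize_neg]
  rw [realize_gradPhi_eq i t θ₀ θ, realize_potVel_eq hD i t θ₀ θ,
    realize_magnetic_eq hD (i + 1) t θ₀ θ, realize_magnetic_eq hD (i + 2) t θ₀ θ]
  ring

lemma integral_coef_rho_zero (hD : D.Adapted r₀ x₀ e₀ b₀ afree wfree) (hu : D.picard u = u)
    (t : ℝ) : ∫ θ, D.P.coef u.1 0 t θ ∂μ = 1 := by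
  simpa [coef_rho hD hu] using hD.total

lemma neg_laplacian_phi (hD : D.Adapted r₀ x₀ e₀ b₀ afree wfree) (hu : D.picard u = u)
    (t : ℝ) (θ₀ : M) (x : T3) :
    -laplacian (D.P.realize (D.phi u) t θ₀) x = density μ (D.P.realize u.1 t) x - 1 := by
  have hone : fourierSynthesis (fun k : Freq => if k = 0 then (1 : ℂ) else 0) x = 1 := by
    rw [fourierSynthesis_ite_zero, Complex.one_re]
  rw [D.P.laplacian_realize_eq_neg, neg_neg, density, ← realize_average (θ := θ₀), ← hone, realize,
    ← fourierSynthesis_sub (D.P.summable_coef _ t θ₀) (summable_norm_ite_zero _)]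
  congr 1
  funext k
  rw [coef_phi, coef_average, ← mul_assoc]
  split_ifs with hk
  · simp [hk, integral_coef_rho_zero hD hu]
  · rw [angularFreq_sq_mul_inv hk, one_mul, sub_zero]

lemma wave_eq (t : ℝ) (θ₀ : M) (x : T3) (i : Fin 3) :
    D.eps ^ 2 * (D.eps⁻¹ * fourierSynthesis (D.potAcc afree u i t θ₀) x)
      - laplacian (D.P.realize (D.pot afree u i) t θ₀) x =
      D.eps * D.P.realize (D.lerayCurrent i u) t θ₀ x := by
  have hs := (D.P.summable_angularFreq_sq_coef (D.pot afree u i) t θ₀).mul_left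
    ‖((D.eps⁻¹ : ℝ) : ℂ)‖
  have hacc : fourierSynthesis (D.potAcc afree u i t θ₀) x =
      D.P.realize (D.lerayCurrent i u) t θ₀ x - D.eps⁻¹ *
        fourierSynthesis
          (fun k => (angularFreq k : ℂ) ^ 2 * D.P.coef (D.pot afree u i) k t θ₀) x := by
    rw [← fourierSynthesis_const_mul, realize, ← fourierSynthesis_sub (D.P.summable_coef _ t θ₀)
      (by simpa only [norm_mul] using hs)]
    rfl
  have he : D.eps ≠ 0 := D.eps_pos.ne'
  rw [hacc, D.P.laplacian_realize_eq_neg]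
  field_simp
  ring

lemma sum_derivSymbol_coef_lerayCurrent (k : Freq) (t : ℝ) (θ : M) :
    ∑ i, derivSymbol i k * D.P.coef (D.lerayCurrent i u) k t θ = 0 := by
  simp only [coef_lerayCurrent]
  exact sum_derivSymbol_leraySymbol k _

lemma sum_derivSymbol_coef_pot (hD : D.Adapted r₀ x₀ e₀ b₀ afree wfree) (k : Freq) (t : ℝ)
    (θ : M) : ∑ i, derivSymbol i k * D.P.coef (D.pot afree u i) k t θ = 0 := by
  have hfree : ∑ i, derivSymbol i k * D.P.coef (afree i) k t θ = 0 := by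
    simp only [hD.coef_afree, freePot, mul_add, mul_left_comm (derivSymbol _ k),
      Finset.sum_add_distrib, ← Finset.mul_sum, sum_derivSymbol_potCoef,
      sum_derivSymbol_velCoef (n := fun k => ∫ θ, r₀ θ k ∂μ) (hD.gauss k), mul_zero, add_zero]
  have hduhamel : ∑ i, derivSymbol i k * ∫ s in (0 : ℝ)..D.P.clamp t,
      (waveSin D.eps k (D.P.clamp t - s) : ℂ) * D.P.coef (D.lerayCurrent i u) k s θ = 0 := by
    simp only [← intervalIntegral.integral_const_mul]
    rw [← intervalIntegral.integral_finsetSum fun i _ =>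
      ((continuous_kernel_mul (isKernel_waveSin D.P D.eps_pos D.eps_le D.T_le)
        (D.lerayCurrent i u) k t θ).const_mul _).intervalIntegrable _ _]
    simp only [mul_left_comm (derivSymbol _ k), ← Finset.mul_sum,
      sum_derivSymbol_coef_lerayCurrent, mul_zero, intervalIntegral.integral_zero]
  simp only [pot, coef_add, coef_duhamel, mul_add, Finset.sum_add_distrib, hfree, hduhamel,
    add_zero]

lemma divergence_pot (hD : D.Adapted r₀ x₀ e₀ b₀ afree wfree) (t : ℝ) (θ : M) (x : T3) :
    divergence (fun y i => D.P.realize (D.pot afree u i) t θ y) x = 0 := by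
  rw [D.P.divergence_realize]
  simp [sum_derivSymbol_coef_pot hD, fourierSynthesis]

/-! ### Initial values of a fixed point -/

lemma realize_rho_zero {f : T3 → ℝ} {θ : M} {δ : ℝ} (hδ : 1 ≤ δ) (hf : MemB δ f)
    (hD : D.Adapted r₀ x₀ e₀ b₀ afree wfree) (hu : D.picard u = u) (hr : r₀ θ = fourierCoef f) :
    D.P.realize u.1 0 θ = f := by
  simp only [realize, coef_rho_zero hD hu, hr]
  exact hf.fourierSynthesis_fourierCoef hδ

lemma realize_xi_zero {f : T3 → ℝ} {θ : M} {i : Fin 3} {δ : ℝ} (hδ : 1 ≤ δ) (hf : MemB δ f)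
    (hD : D.Adapted r₀ x₀ e₀ b₀ afree wfree) (hu : D.picard u = u) (hx : x₀ i θ = fourierCoef f) :
    D.P.realize (D.xi i u) 0 θ = f := by
  simp only [realize, coef_xi_zero hD hu, hx]
  exact hf.fourierSynthesis_fourierCoef hδ

lemma realize_potVel_zero {f : T3 → ℝ} {i : Fin 3} {δ : ℝ} (hδ : 1 ≤ δ) (hf : MemB δ f)
    (hD : D.Adapted r₀ x₀ e₀ b₀ afree wfree) (hu : D.picard u = u) (he : e₀ i = fourierCoef f)
    (θ : M) (x : T3) :
    D.P.realize (D.potVel wfree u i) 0 θ x = -f x - grad (D.P.realize (D.phi u) 0 θ) x i := by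
  rw [grad_phi, ← congrFun (hf.fourierSynthesis_fourierCoef hδ) x, realize, realize,
    ← fourierSynthesis_neg, ← fourierSynthesis_sub (by simpa using hf.summable hδ)
      (D.P.summable_coef _ 0 θ)]
  congr 1
  funext k
  simp only [coef_potVel_zero hD, coef_gradPhi, coef_phi, velCoef, coef_rho_zero hD hu, mul_assoc,
    he]

lemma curl_pot_zero {B0 : T3 → Fin 3 → ℝ} {δ : ℝ} (hδ : 1 ≤ δ) (hB : MemBVec δ B0)
    (hD : D.Adapted r₀ x₀ e₀ (fun i => fourierCoef fun x => B0 x i) afree wfree)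
    (θ : M) (x : T3) (i : Fin 3) :
    curl (fun y l => D.P.realize (D.pot afree u l) 0 θ y) x i = B0 x i - mean B0 i := by
  rw [D.P.curl_realize, ← congrFun ((hB i).fourierSynthesis_fourierCoef hδ) x,
    mean_eq_re_fourierCoef, ← fourierSynthesis_ite_zero _ x,
    ← fourierSynthesis_sub ((hB i).summable hδ) (summable_norm_ite_zero _)]
  congr 1
  funext k
  simp only [coef_pot_zero hD]
  split_ifs with hk
  · simp [hk]
  · rw [sum_curlSymbol_potCoef hk (hD.solenoidal k), sub_zero]

lemma mean_pot_zero (hD : D.Adapted r₀ x₀ e₀ b₀ afree wfree) (θ : M) (i : Fin 3) :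
    mean (fun x i => D.P.realize (D.pot afree u i) 0 θ x) i = 0 := by
  rw [mean_eq_re_fourierCoef]
  change (fourierCoef (fourierSynthesis _) 0).re = 0
  rw [fourierCoef_fourierSynthesis (D.P.summable_coef (D.pot afree u i) 0 θ)
    ((D.P.isCoef_coef _).herm 0 θ), coef_pot_zero hD]
  simp [potCoef]

theorem isSolution {δ δ' : ℝ} (hδ : 1 < δ) (hδ' : 1 ≤ δ') {ρ0 : M → T3 → ℝ}
    {ξ0 : M → T3 → Fin 3 → ℝ} {E0 B0 : T3 → Fin 3 → ℝ}
    (hρ : ∀ θ, MemB δ' (ρ0 θ)) (hξ : ∀ θ, MemBVec δ' (ξ0 θ)) (hE : MemBVec δ' E0)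
    (hB : MemBVec δ' B0)
    (hD : D.Adapted (fun θ => fourierCoef (ρ0 θ)) (fun i θ => fourierCoef fun x => ξ0 θ x i)
      (fun i => fourierCoef fun x => E0 x i) (fun i => fourierCoef fun x => B0 x i) afree wfree)
    (hb : Real.log δ ≤ D.P.b) (hu : D.picard u = u) (hh : ‖u.2.2‖ ≤ 1 / 4) (θ₀ : M) :
    IsSolution μ D.eps D.P.T δ ρ0 ξ0 E0 B0 (fun θ t => D.P.realize u.1 t θ)
      (fun θ t x i => D.P.realize (D.xi i u) t θ x) (fun t => D.P.realize (D.phi u) t θ₀)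
      (fun t x i => D.P.realize (D.pot afree u i) t θ₀ x)
      (fun t x i => D.eps⁻¹ * D.P.realize (D.potVel wfree u i) t θ₀ x)
      (fun t x i => D.eps⁻¹ * fourierSynthesis (D.potAcc afree u i t θ₀) x) where
  cont_rho θ := D.P.contInB_realize hδ hb u.1 θ _
  cont_xi θ i := D.P.contInB_realize hδ hb (D.xi i u) θ _
  cont_phi := D.P.contInB_realize hδ hb (D.phi u) θ₀ _
  cont_A i := D.P.contInB_realize hδ hb (D.pot afree u i) θ₀ _
  cont_E i := by
    simp only [elec_realize]
    exact D.P.contInB_realize hδ hb _ θ₀ _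
  cont_B i := by
    simp only [magn_realize hD]
    exact D.P.contInB_realize hδ hb _ θ₀ _
  integrable_rho t _ x := D.P.integrable_realize u.1 t x
  integrable_current t _ x i := by
    simp only [vel_realize_xi hu hh, ← realize_flux]
    exact D.P.integrable_realize (D.flux i u) t x
  mem_current t _ i := by
    simp only [current_realize hu hh t θ₀]
    exact D.P.memB_realize hδ hb _ t θ₀
  continuity θ t ht x := by
    simp only [vel_realize_xi hu hh, ← realize_flux]
    exact hasDerivWithinAt_rho hD hu θ x ht
  momentum θ t ht x i := hasDerivWithinAt_xi_momentum hD hu hh θ₀ θ ht x i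
  poisson t _ x := neg_laplacian_phi hD hu t θ₀ x
  deriv_A t ht x i := hasDerivWithinAt_pot hD i θ₀ x ht
  deriv_At t ht x i := (hasDerivWithinAt_potVel hD i θ₀ x ht).const_mul _
  wave t _ x i := by
    rw [leray_current_realize hu hh t θ₀]
    exact wave_eq t θ₀ x i
  gauge t _ x := divergence_pot hD t θ₀ x
  init_rho θ := realize_rho_zero hδ' (hρ θ) hD hu rfl
  init_xi θ := funext fun x => funext fun i =>
    congrFun (realize_xi_zero hδ' (hξ θ i) hD hu rfl) x
  init_E x i := by
    rw [mul_inv_cancel_left₀ D.eps_pos.ne']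
    exact realize_potVel_zero hδ' (hE i) hD hu rfl θ₀ x
  init_B x i := curl_pot_zero hδ' hB hD θ₀ x i
  init_mean_A i := mean_pot_zero hD θ₀ i

end PicardData

/-! ### Construction of the fixed point problem from the data -/

lemma isHermitian_ite_zero {a : Freq → ℂ} (ha : IsHermitian a) :
    IsHermitian fun k : Freq => if k = 0 then a 0 else 0 := fun k => by
  have h : a 0 = conj (a 0) := by simpa using ha 0
  by_cases hk : k = 0 <;> simp [hk, ← h]

lemma isHermitian_potCoef {b : Fin 3 → Freq → ℂ} (hb : ∀ i, IsHermitian (b i)) (i : Fin 3) :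
    IsHermitian (potCoef b i) :=
  (IsHermitian.sum fun l => (isHermitian_curlSymbol i l).mul (hb l)).mul
    (isHermitian_ofReal fun k => by simp)

lemma isHermitian_velCoef {e : Fin 3 → Freq → ℂ} {n : Freq → ℂ} (he : ∀ i, IsHermitian (e i))
    (hn : IsHermitian n) (i : Fin 3) : IsHermitian (velCoef e n i) :=
  (he i).neg.sub ((IsHermitian.mul (derivSymbol_neg i) (isHermitian_ofReal fun k => by simp)).mul
    hn)

lemma isHermitian_freePot {p q : Freq → ℂ} (hp : IsHermitian p) (hq : IsHermitian q) (ε t : ℝ) :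
    IsHermitian fun k => freePot ε p q k t :=
  ((isHermitian_ofReal fun k => by simp).mul hp).add ((isHermitian_ofReal fun k => by simp).mul hq)

lemma isHermitian_freeVel {p q : Freq → ℂ} (hp : IsHermitian p) (hq : IsHermitian q) (ε t : ℝ) :
    IsHermitian fun k => freeVel ε p q k t := by
  have h : IsHermitian fun k => (angularFreq k : ℂ) ^ 2 * (waveSin ε k t : ℂ) := fun k => by simp
  exact (h.mul hp).neg.add ((isHermitian_ofReal fun k => by simp).mul hq)

section Bounds

variable {k : Freq} {w : ℝ}

lemma angularFreq_mul_inv_sq_le (k : Freq) : angularFreq k * (1 / angularFreq k ^ 2) ≤ 1 := by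
  by_cases hk : k = 0
  · simp [hk]
  have h := one_le_angularFreq hk
  have := angularFreq_pos hk
  rw [mul_one_div, div_le_one (by positivity)]
  nlinarith

lemma norm_sum_curlSymbol_mul_le {a : Fin 3 → ℂ} (ha : ∀ l, ‖a l‖ ≤ w) (i : Fin 3) :
    ‖∑ l, curlSymbol i l k * a l‖ ≤ 3 * (angularFreq k * w) := by
  refine (norm_sum_le_of_le _ fun l _ => ?_).trans (b := ∑ _l : Fin 3, angularFreq k * w) (by simp)
  rw [norm_mul]
  exact mul_le_mul (norm_curlSymbol_le i l k) (ha l) (norm_nonneg _) (angularFreq_nonneg k)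

lemma norm_potCoef_le {b : Fin 3 → Freq → ℂ} (hb : ∀ l, ‖b l k‖ ≤ w) (i : Fin 3) :
    ‖potCoef b i k‖ ≤ 3 * w := by
  have hw : 0 ≤ w := (norm_nonneg _).trans (hb 0)
  rw [potCoef, norm_mul, Complex.norm_real, Real.norm_of_nonneg (by positivity)]
  calc _ ≤ 3 * (angularFreq k * w) * (1 / angularFreq k ^ 2) := by
        gcongr
        exact norm_sum_curlSymbol_mul_le hb i
    _ = 3 * w * (angularFreq k * (1 / angularFreq k ^ 2)) := by ring
    _ ≤ _ := mul_le_of_le_one_right (by positivity) (angularFreq_mul_inv_sq_le k)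

lemma norm_velCoef_le {e : Fin 3 → Freq → ℂ} {n : Freq → ℂ} {i : Fin 3} (he : ‖e i k‖ ≤ w)
    (hn : ‖n k‖ ≤ w) : ‖velCoef e n i k‖ ≤ 2 * w := by
  have hsymbol : ‖derivSymbol i k * ((1 / angularFreq k ^ 2 : ℝ) : ℂ)‖ ≤ 1 := by
    rw [norm_mul, Complex.norm_real, Real.norm_of_nonneg (by positivity)]
    exact (mul_le_mul_of_nonneg_right (norm_derivSymbol_le_angularFreq i k) (by positivity)).trans
      (angularFreq_mul_inv_sq_le k)
  rw [velCoef]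
  refine (norm_sub_le _ _).trans ?_
  rw [norm_neg, norm_mul _ (n k)]
  linarith [mul_le_mul hsymbol hn (norm_nonneg _) zero_le_one]

/- At the frequency `0` the factor `waveSin ε 0 t = t / ε` is not bounded uniformly in `ε`: this is
why the lifespan depends on the mean of the electric field. -/
lemma abs_waveSin_mul_norm_velCoef_le {ε t : ℝ} (hε : 0 < ε) (ht : 0 ≤ t)
    {e : Fin 3 → Freq → ℂ} {n : Freq → ℂ} {i : Fin 3} (h : e i 0 = 0 ∨ t ≤ ε)
    (he : ‖e i k‖ ≤ w) (hn : ‖n k‖ ≤ w) : |waveSin ε k t| * ‖velCoef e n i k‖ ≤ 2 * w := by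
  have hq := norm_velCoef_le he hn
  by_cases hk : k = 0
  · subst hk
    rcases h with h | h
    · have hzero : velCoef e n i 0 = 0 := by simp [velCoef, h]
      rw [hzero, norm_zero] at hq ⊢
      rwa [mul_zero]
    · have hsin : |waveSin ε 0 t| ≤ 1 := by
        rwa [waveSin, if_pos rfl, abs_of_nonneg (div_nonneg ht hε.le), div_le_one hε]
      exact (mul_le_of_le_one_left (norm_nonneg _) hsin).trans hq
  · exact (mul_le_of_le_one_left (norm_nonneg _) (abs_waveSin_le_one hk t)).trans hq

variable {ε t : ℝ} {p q : Freq → ℂ}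

lemma norm_freePot_le (hp : ‖p k‖ ≤ 3 * w) (hq : |waveSin ε k t| * ‖q k‖ ≤ 2 * w) :
    ‖freePot ε p q k t‖ ≤ 5 * w := by
  refine (norm_add_le _ _).trans ?_
  rw [norm_mul, norm_mul, Complex.norm_real, Complex.norm_real, Real.norm_eq_abs,
    Real.norm_eq_abs]
  linarith [mul_le_mul_of_nonneg_right (abs_waveCos_le ε k t) (norm_nonneg (p k))]

lemma norm_freeVel_le (hp : ‖p k‖ ≤ 3 * w) (hq : ‖q k‖ ≤ 2 * w) :
    ‖freeVel ε p q k t‖ ≤ 23 * ((1 + freqNorm k) * w) := by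
  have hω := angularFreq_nonneg k
  have hcos := mul_le_mul_of_nonneg_right (abs_waveCos_le ε k t) (norm_nonneg (q k))
  have hsin : angularFreq k * |waveSin ε k t| * (angularFreq k * ‖p k‖) ≤
      1 * (angularFreq k * (3 * w)) :=
    mul_le_mul (angularFreq_mul_abs_waveSin_le ε k t) (mul_le_mul_of_nonneg_left hp hω)
      (by positivity) zero_le_one
  have hw : 0 ≤ w := by linarith [norm_nonneg (q k)]
  have hk := mul_le_mul_of_nonneg_right (angularFreq_le_mul_one_add k) hw
  refine (norm_add_le _ _).trans ?_
  rw [norm_neg, norm_mul, norm_mul, norm_mul, norm_pow, Complex.norm_real, Complex.norm_real,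
    Complex.norm_real, Real.norm_eq_abs, Real.norm_eq_abs, Real.norm_eq_abs, abs_of_nonneg hω]
  nlinarith [mul_nonneg (freqNorm_nonneg k) hw]

lemma norm_sum_curlSymbol_mul_add_ite_le {a : Fin 3 → ℂ} {b : Freq → ℂ}
    (ha : ∀ l, ‖a l‖ ≤ 5 * w) (hb : ‖b k‖ ≤ w) (i : Fin 3) :
    ‖∑ l, curlSymbol i l k * a l + if k = 0 then b 0 else 0‖ ≤
      106 * ((1 + freqNorm k) * w) := by
  have hw : 0 ≤ w := (norm_nonneg _).trans hb
  have hmean : ‖if k = 0 then b 0 else 0‖ ≤ w := by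
    split_ifs with hk
    · rwa [← hk]
    · simpa using hw
  refine (norm_add_le _ _).trans ((add_le_add (norm_sum_curlSymbol_mul_le ha i) hmean).trans ?_)
  nlinarith [mul_le_mul_of_nonneg_right (angularFreq_le_mul_one_add k) hw,
    mul_nonneg (freqNorm_nonneg k) hw]

lemma norm_one_add_freqNorm_mul_le {G : ℝ} (hε : 0 ≤ ε) (hεG : ε * G ≤ 1) {x y z : ℂ}
    (hx : ‖x‖ ≤ w) (hy : ‖y‖ ≤ 3 * (G * w)) (hz : ‖z‖ ≤ 5 * (G * w)) :
    ‖((1 + freqNorm k : ℝ) : ℂ) * (x + ε * y - ε * z)‖ ≤ 9 * ((1 + freqNorm k) * w) := by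
  have hk := freqNorm_nonneg k
  have hsum : ‖x + ε * y - ε * z‖ ≤ 9 * w := by
    refine (norm_sub_le _ _).trans ((add_le_add_left (norm_add_le _ _) _).trans ?_)
    rw [norm_mul, norm_mul, Complex.norm_real, Real.norm_of_nonneg hε]
    have hw := mul_le_mul_of_nonneg_right hεG ((norm_nonneg _).trans hx)
    nlinarith [mul_le_mul_of_nonneg_left hy hε, mul_le_mul_of_nonneg_left hz hε]
  rw [norm_mul, Complex.norm_real, Real.norm_of_nonneg (by positivity), mul_left_comm]
  gcongr

end Bounds

lemma exists_weight_bound {a l : ℝ} (h : a < l) : ∃ K > 0, ∀ k : Freq,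
    (1 + freqNorm k) * Real.exp (-l * freqNorm k) ≤
      K * (polyWeight k * Real.exp (-a * freqNorm k)) := by
  obtain ⟨K, hK, hb⟩ := exists_pow_mul_exp_le 7 (sub_pos.2 h)
  have hp := tsum_decay_pos
  refine ⟨64 * (∑' k, decay k) * K, by positivity, fun k => ?_⟩
  have hk := freqNorm_nonneg k
  have e : Real.exp (-l * freqNorm k) =
      Real.exp (-(l - a) * freqNorm k) * Real.exp (-a * freqNorm k) := by
    rw [← Real.exp_add]
    ring_nf
  rw [e, polyWeight, decay]
  calc _ = (1 + freqNorm k) ^ 7 * Real.exp (-(l - a) * freqNorm k) *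
        Real.exp (-a * freqNorm k) * ((1 + freqNorm k) ^ 6)⁻¹ := by field_simp
    _ ≤ K * Real.exp (-a * freqNorm k) * ((1 + freqNorm k) ^ 6)⁻¹ := by
        gcongr
        exact hb _ hk
    _ = _ := by field_simp

section Data

variable {M : Type*} [MeasurableSpace M] {μ : Measure M}

lemma isCoef_const {a : M → Freq → ℂ} (hm : ∀ k, AEStronglyMeasurable (fun θ => a θ k) μ)
    (hh : ∀ θ, IsHermitian (a θ)) : IsCoef μ fun k _ θ => a θ k :=
  ⟨fun _ _ => continuous_const, fun k _ => hm k, fun _ θ => hh θ⟩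

lemma isCoef_freePot (P : AnalyticScale) {p q : Freq → ℂ} (hp : IsHermitian p) (hq : IsHermitian q)
    (ε : ℝ) : IsCoef μ fun k t (_ : M) => freePot ε p q k (P.clamp t) where
  cont k _ := (continuous_iff_continuousAt.2 fun t =>
    (hasDerivAt_freePot p q k t).continuousAt).comp P.continuous_clamp
  meas _ _ := aestronglyMeasurable_const
  herm _ _ := isHermitian_freePot hp hq ε _

lemma isCoef_freeVel (P : AnalyticScale) {p q : Freq → ℂ} (hp : IsHermitian p) (hq : IsHermitian q)
    (ε : ℝ) : IsCoef μ fun k t (_ : M) => freeVel ε p q k (P.clamp t) where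
  cont k _ := (continuous_iff_continuousAt.2 fun t =>
    (hasDerivAt_freeVel p q k t).continuousAt).comp P.continuous_clamp
  meas _ _ := aestronglyMeasurable_const
  herm _ _ := isHermitian_freeVel hp hq ε _

namespace IsCoef

variable {f g : Freq → ℝ → M → ℂ}

lemma add (hf : IsCoef μ f) (hg : IsCoef μ g) : IsCoef μ fun k t θ => f k t θ + g k t θ where
  cont k θ := (hf.cont k θ).add (hg.cont k θ)
  meas k t := (hf.meas k t).add (hg.meas k t)
  herm t θ := (hf.herm t θ).add (hg.herm t θ)

lemma sub (hf : IsCoef μ f) (hg : IsCoef μ g) : IsCoef μ fun k t θ => f k t θ - g k t θ where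
  cont k θ := (hf.cont k θ).sub (hg.cont k θ)
  meas k t := (hf.meas k t).sub (hg.meas k t)
  herm t θ := (hf.herm t θ).sub (hg.herm t θ)

lemma symbol_mul (hf : IsCoef μ f) {p : Freq → ℂ} (hp : IsHermitian p) :
    IsCoef μ fun k t θ => p k * f k t θ where
  cont k θ := continuous_const.mul (hf.cont k θ)
  meas k t := (hf.meas k t).const_mul _
  herm t θ := hp.mul (hf.herm t θ)

lemma sum {ι : Type*} {s : Finset ι} {f : ι → Freq → ℝ → M → ℂ} (hf : ∀ i, IsCoef μ (f i)) :
    IsCoef μ fun k t θ => ∑ i ∈ s, f i k t θ where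
  cont k θ := continuous_finsetSum _ fun i _ => (hf i).cont k θ
  meas k t := Finset.aestronglyMeasurable_fun_sum s fun i _ => (hf i).meas k t
  herm t θ := IsHermitian.sum fun i => (hf i).herm t θ

end IsCoef

lemma AnalyticScale.exists_coef_eq (P : AnalyticScale) {l K B : ℝ} (hK0 : 0 ≤ K)
    (hK : ∀ k : Freq, (1 + freqNorm k) * Real.exp (-l * freqNorm k) ≤
      K * (polyWeight k * Real.exp (-P.a * freqNorm k)))
    {f : Freq → ℝ → M → ℂ} (hf : IsCoef μ f) (hB : 0 ≤ B)
    (hfB : ∀ k t θ, ‖f k t θ‖ ≤ B * ((1 + freqNorm k) * Real.exp (-l * freqNorm k))) :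
    ∃ U : CoefSpace μ, P.coef U = f ∧ ‖U‖ ≤ B * K := by
  have hbound (k t θ) : ‖f k t θ‖ ≤ B * K * P.weight k t := by
    rw [mul_assoc]
    exact (hfB k t θ).trans (mul_le_mul_of_nonneg_left
      ((hK k).trans (mul_le_mul_of_nonneg_left (P.le_weight k t) hK0)) hB)
  exact ⟨P.ofCoef f hf ⟨_, hbound⟩, P.coef_ofCoef f hf _,
    P.norm_le_of_coef _ (by positivity) fun k t θ => by
      rw [coef_ofCoef]
      exact hbound k t θ⟩

/-- `r₀`, `x₀`, `e₀`, `b₀` are the Fourier coefficients of initial densities, velocities, electric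
and magnetic fields which are analytic in a strip of width `l`, with bounds `c` for the densities
and velocities and `c G` for the fields, and satisfy the Gauss laws. -/
structure IsAnalyticData (μ : Measure M) (l c G : ℝ) (r₀ : M → Freq → ℂ)
    (x₀ : Fin 3 → M → Freq → ℂ) (e₀ b₀ : Fin 3 → Freq → ℂ) : Prop where
  aesm_rho : ∀ k, AEStronglyMeasurable (fun θ => r₀ θ k) μ
  aesm_xi : ∀ i k, AEStronglyMeasurable (fun θ => x₀ i θ k) μ
  herm_rho : ∀ θ, IsHermitian (r₀ θ)
  herm_xi : ∀ i θ, IsHermitian (x₀ i θ)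
  herm_elec : ∀ i, IsHermitian (e₀ i)
  herm_magn : ∀ i, IsHermitian (b₀ i)
  rho_le : ∀ θ k, ‖r₀ θ k‖ ≤ c * Real.exp (-l * freqNorm k)
  xi_le : ∀ i θ k, ‖x₀ i θ k‖ ≤ c * Real.exp (-l * freqNorm k)
  elec_le : ∀ i k, ‖e₀ i k‖ ≤ c * G * Real.exp (-l * freqNorm k)
  magn_le : ∀ i k, ‖b₀ i k‖ ≤ c * G * Real.exp (-l * freqNorm k)
  gauss : ∀ k, k ≠ 0 → ∑ i, derivSymbol i k * e₀ i k = ∫ θ, r₀ θ k ∂μ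
  total : ∫ θ, r₀ θ 0 ∂μ = 1
  solenoidal : ∀ k, ∑ i, derivSymbol i k * b₀ i k = 0

namespace IsAnalyticData

variable {l c G : ℝ} {r₀ : M → Freq → ℂ} {x₀ : Fin 3 → M → Freq → ℂ} {e₀ b₀ : Fin 3 → Freq → ℂ}
  (h : IsAnalyticData μ l c G r₀ x₀ e₀ b₀)

include h

lemma bound_nonneg : 0 ≤ c * G :=
  nonneg_of_mul_nonneg_left ((norm_nonneg _).trans (h.elec_le 0 0)) (Real.exp_pos _)

lemma isHermitian_initPot (i : Fin 3) : IsHermitian (potCoef b₀ i) :=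
  isHermitian_potCoef h.herm_magn i

lemma isHermitian_initVel (i : Fin 3) :
    IsHermitian (velCoef e₀ (fun k => ∫ θ, r₀ θ k ∂μ) i) :=
  isHermitian_velCoef h.herm_elec (IsHermitian.integral h.herm_rho) i

lemma norm_initPot_le (i : Fin 3) (k : Freq) :
    ‖potCoef b₀ i k‖ ≤ 3 * (c * G * Real.exp (-l * freqNorm k)) :=
  norm_potCoef_le (fun j => h.magn_le j k) i

variable [IsProbabilityMeasure μ]

lemma norm_integral_rho_le (hc : 0 ≤ c) (hG : 1 ≤ G) (k : Freq) :
    ‖∫ θ, r₀ θ k ∂μ‖ ≤ c * G * Real.exp (-l * freqNorm k) := by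
  have hmean : ‖∫ θ, r₀ θ k ∂μ‖ ≤ c * Real.exp (-l * freqNorm k) := by
    simpa using norm_integral_le_of_norm_le_const (μ := μ)
      (Eventually.of_forall fun θ => h.rho_le θ k)
  exact hmean.trans (mul_le_mul_of_nonneg_right (le_mul_of_one_le_right hc hG) (Real.exp_pos _).le)

variable {ε : ℝ}

lemma norm_freePot_le (hc : 0 ≤ c) (hG : 1 ≤ G) (hε : 0 < ε) {T : ℝ}
    (hmean : (∀ i, e₀ i 0 = 0) ∨ T ≤ ε) (i : Fin 3) (k : Freq) {t : ℝ} (ht : t ∈ Icc 0 T) :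
    ‖freePot ε (potCoef b₀ i) (velCoef e₀ (fun k => ∫ θ, r₀ θ k ∂μ) i) k t‖ ≤
      5 * (c * G * Real.exp (-l * freqNorm k)) :=
  VlasovMaxwell.norm_freePot_le (h.norm_initPot_le i k) (abs_waveSin_mul_norm_velCoef_le hε ht.1
    (hmean.imp (fun he => he i) ht.2.trans) (h.elec_le i k) (h.norm_integral_rho_le hc hG k))

lemma norm_freeVel_le (hc : 0 ≤ c) (hG : 1 ≤ G) (i : Fin 3) (k : Freq) (t : ℝ) :
    ‖freeVel ε (potCoef b₀ i) (velCoef e₀ (fun k => ∫ θ, r₀ θ k ∂μ) i) k t‖ ≤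
      23 * (c * G) * ((1 + freqNorm k) * Real.exp (-l * freqNorm k)) :=
  (VlasovMaxwell.norm_freeVel_le (h.norm_initPot_le i k)
    (norm_velCoef_le (h.elec_le i k) (h.norm_integral_rho_le hc hG k))).trans_eq (by ring)

theorem exists_adapted (hc : 0 ≤ c) (hG : 1 ≤ G) (P : AnalyticScale) (hT : P.T ≤ 1) (hε : 0 < ε)
    (hε1 : ε ≤ 1) (hεG : ε * G ≤ 1) (hmean : (∀ i, e₀ i 0 = 0) ∨ P.T ≤ ε) {K : ℝ} (hK0 : 0 ≤ K)
    (hK : ∀ k : Freq, (1 + freqNorm k) * Real.exp (-l * freqNorm k) ≤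
      K * (polyWeight k * Real.exp (-P.a * freqNorm k))) :
    ∃ (D : PicardData μ) (afree wfree : Fin 3 → CoefSpace μ), D.P = P ∧ D.eps = ε ∧
      D.Adapted r₀ x₀ e₀ b₀ afree wfree ∧ ‖D.rin‖ ≤ c * K ∧ (∀ i, ‖D.xin i‖ ≤ 9 * c * K) ∧
      (∀ i, ‖D.bin i‖ ≤ 106 * (c * G) * K) ∧ ∀ i, ‖wfree i‖ ≤ 23 * (c * G) * K := by
  have := h.bound_nonneg
  have hexp (k : Freq) :
      Real.exp (-l * freqNorm k) ≤ (1 + freqNorm k) * Real.exp (-l * freqNorm k) :=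
    le_mul_of_one_le_left (Real.exp_pos _).le (by linarith [freqNorm_nonneg k])
  have hfree (i : Fin 3) (k : Freq) (t : ℝ) :=
    h.norm_freePot_le hc hG hε hmean i k (P.clamp_mem t)
  have hA (i : Fin 3) := isCoef_freePot (μ := μ) P (h.isHermitian_initPot i)
    (h.isHermitian_initVel i) ε
  have hp (i : Fin 3) : IsCoef μ fun k _ (_ : M) => potCoef b₀ i k :=
    isCoef_const (fun _ => aestronglyMeasurable_const) fun _ => h.isHermitian_initPot i
  have hzero (i : Fin 3) : IsCoef μ fun (k : Freq) _ (_ : M) => if k = 0 then b₀ i 0 else 0 :=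
    isCoef_const (fun _ => aestronglyMeasurable_const)
      fun _ => isHermitian_ite_zero (h.herm_magn i)
  have hεh : IsHermitian fun _ : Freq => (ε : ℂ) := isHermitian_ofReal fun _ => rfl
  obtain ⟨r, hr, hrK⟩ := P.exists_coef_eq hK0 hK (isCoef_const h.aesm_rho h.herm_rho) hc
    fun k _ θ => (h.rho_le θ k).trans (mul_le_mul_of_nonneg_left (hexp k) hc)
  choose a ha _ using fun i => P.exists_coef_eq hK0 hK (hA i) (B := 5 * (c * G)) (by positivity)
    fun k t _ => ((hfree i k t).trans_eq (by ring)).trans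
      (mul_le_mul_of_nonneg_left (hexp k) (by positivity))
  choose w hw hwK using fun i => P.exists_coef_eq hK0 hK
    (isCoef_freeVel (μ := μ) P (h.isHermitian_initPot i) (h.isHermitian_initVel i) ε)
    (by positivity)
    fun k t _ => h.norm_freeVel_le hc hG i k (P.clamp t)
  choose x hx hxK using fun i => P.exists_coef_eq hK0 hK
    ((((isCoef_const (h.aesm_xi i) (h.herm_xi i)).add ((hp i).symbol_mul hεh)).sub
      ((hA i).symbol_mul hεh)).symbol_mul (isHermitian_ofReal (f := fun k => 1 + freqNorm k)
        fun k => by simp)) (B := 9 * c) (by positivity)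
    fun k t θ => (norm_one_add_freqNorm_mul_le hε.le hεG (h.xi_le i θ k)
      ((h.norm_initPot_le i k).trans_eq (by ring)) ((hfree i k t).trans_eq (by ring))).trans_eq
        (by ring)
  choose b hb hbK using fun i => P.exists_coef_eq hK0 hK
    ((IsCoef.sum (s := Finset.univ) fun j => (hA j).symbol_mul (isHermitian_curlSymbol i j)).add
      (hzero i)) (B := 106 * (c * G)) (by positivity)
    fun k t _ => (norm_sum_curlSymbol_mul_add_ite_le (fun j => hfree j k t)
      (h.magn_le i k) i).trans_eq (by ring)
  refine ⟨⟨P, ε, hε, hε1, hT, r, x, b⟩, a, w, rfl, rfl, ⟨?_, ?_, ?_, ?_, ?_, h.gauss, h.total,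
    h.solenoidal⟩, hrK, hxK, hbK, hwK⟩ <;> intros <;> simp only [hr, ha, hw, hx, hb]

end IsAnalyticData

end Data

/-! ### The Gauss laws in Fourier variables -/

lemma summable_exp_neg_mul_freqNorm {l : ℝ} (hl : 0 < l) :
    Summable fun k => (1 + freqNorm k) * Real.exp (-l * freqNorm k) := by
  obtain ⟨K, _, hK⟩ := exists_weight_bound hl
  refine (summable_polyWeight.mul_left K).of_nonneg_of_le
    (fun k => mul_nonneg (by linarith [freqNorm_nonneg k]) (Real.exp_pos _).le) fun k => ?_
  simpa using hK k

section GaussLaw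

variable {δ : ℝ} {f : T3 → ℝ} {F : T3 → Fin 3 → ℝ}

lemma MemB.norm_fourierCoef_le_of_bNorm_le (hδ : 0 < δ) (hf : MemB δ f) {c : ℝ}
    (hc : bNorm δ f ≤ c) (k : Freq) :
    ‖fourierCoef f k‖ ≤ c * Real.exp (-Real.log δ * freqNorm k) :=
  (hf.norm_fourierCoef_le hδ k).trans (mul_le_mul_of_nonneg_right hc (Real.exp_pos _).le)

lemma MemB.summable_derivSymbol (hδ : 1 < δ) (hf : MemB δ f) (i : Fin 3) :
    Summable fun k => ‖derivSymbol i k * fourierCoef f k‖ := by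
  refine ((summable_exp_neg_mul_freqNorm (Real.log_pos hδ)).mul_left
    (7 * bNorm δ f)).of_nonneg_of_le (fun _ => norm_nonneg _) fun k => ?_
  have hk := freqNorm_nonneg k
  calc _ ≤ 7 * (1 + freqNorm k) * (bNorm δ f * Real.exp (-Real.log δ * freqNorm k)) := by
        rw [norm_mul]
        gcongr
        · exact norm_derivSymbol_le_mul_one_add i k
        · exact hf.norm_fourierCoef_le (by linarith) k
    _ = _ := by ring

lemma summable_sum_derivSymbol (hδ : 1 < δ) (hF : MemBVec δ F) :
    Summable fun k => ‖∑ i, derivSymbol i k * fourierCoef (fun x => F x i) k‖ :=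
  (summable_sum (s := Finset.univ) fun i _ => (hF i).summable_derivSymbol hδ i).of_nonneg_of_le
    (fun _ => norm_nonneg _) fun _ => norm_sum_le _ _

lemma divergence_eq_fourierSynthesis (hδ : 1 < δ) (hF : MemBVec δ F) :
    divergence F =
      fourierSynthesis fun k => ∑ i, derivSymbol i k * fourierCoef (fun x => F x i) k := by
  funext x
  rw [fourierSynthesis_sum _ fun i _ => (hF i).summable_derivSymbol hδ i]
  refine Finset.sum_congr rfl fun i _ => ?_
  conv_lhs => rw [← (hF i).fourierSynthesis_fourierCoef hδ.le]
  exact pderiv_fourierSynthesis ((hF i).summable hδ.le) ((hF i).summable_derivSymbol hδ i) x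

lemma fourierCoef_divergence (hδ : 1 < δ) (hF : MemBVec δ F) (k : Freq) :
    fourierCoef (divergence F) k = ∑ i, derivSymbol i k * fourierCoef (fun x => F x i) k := by
  rw [divergence_eq_fourierSynthesis hδ hF]
  exact fourierCoef_fourierSynthesis (summable_sum_derivSymbol hδ hF)
    (IsHermitian.sum fun i => isHermitian_derivSymbol_mul (isHermitian_fourierCoef _) i) k

variable {M : Type*} [MeasurableSpace M] {μ : Measure M} [IsProbabilityMeasure μ]
  {ρ : M → T3 → ℝ} {c : ℝ}

lemma fourierCoef_density_sub_one (hδ : 1 < δ)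
    (hm : ∀ x, AEStronglyMeasurable (fun θ => ρ θ x) μ)
    (hρ : ∀ θ, MemB δ (ρ θ) ∧ bNorm δ (ρ θ) ≤ c) (k : Freq) :
    fourierCoef (fun x => density μ ρ x - 1) k =
      ∫ θ, fourierCoef (ρ θ) k ∂μ - if k = 0 then 1 else 0 := by
  have hw : Summable fun k => c * Real.exp (-Real.log δ * freqNorm k) :=
    ((summable_exp_neg_mul_freqNorm (Real.log_pos hδ)).of_nonneg_of_le
      (fun _ => (Real.exp_pos _).le) fun k => le_mul_of_one_le_left (Real.exp_pos _).le
        (by linarith [freqNorm_nonneg k])).mul_left c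
  have hbound (θ : M) := (hρ θ).1.norm_fourierCoef_le_of_bNorm_le (one_pos.trans hδ) (hρ θ).2
  have hs : Summable fun k => ‖∫ θ, fourierCoef (ρ θ) k ∂μ‖ :=
    hw.of_nonneg_of_le (fun _ => norm_nonneg _) fun k => by
      simpa using norm_integral_le_of_norm_le_const (μ := μ)
        (Eventually.of_forall fun θ => hbound θ k)
  have hdensity (x : T3) : density μ ρ x - 1 =
      fourierSynthesis (fun k => ∫ θ, fourierCoef (ρ θ) k ∂μ - if k = 0 then 1 else 0) x := by
    rw [fourierSynthesis_sub hs (summable_norm_ite_zero 1), fourierSynthesis_ite_zero,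
      ← integral_fourierSynthesis (fun k => aestronglyMeasurable_fourierCoef
        (fun θ => (hρ θ).1.1) hm k) hw hbound, density, Complex.one_re]
    simp only [(hρ _).1.fourierSynthesis_fourierCoef hδ.le]
  simp only [hdensity]
  refine fourierCoef_fourierSynthesis ?_ ((IsHermitian.integral fun θ =>
    isHermitian_fourierCoef (ρ θ)).sub (isHermitian_ite_zero (a := fun _ => 1) fun k => by simp)) k
  exact (hs.add (summable_norm_ite_zero 1)).of_nonneg_of_le (fun _ => norm_nonneg _)
    fun k => norm_sub_le _ _

theorem isAnalyticData_fourierCoef {G : ℝ} (hδ : 1 < δ) {ξ : M → T3 → Fin 3 → ℝ}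
    {E B : T3 → Fin 3 → ℝ} (hρm : ∀ x, AEStronglyMeasurable (fun θ => ρ θ x) μ)
    (hξm : ∀ x i, AEStronglyMeasurable (fun θ => ξ θ x i) μ)
    (hρ : ∀ θ, MemB δ (ρ θ) ∧ bNorm δ (ρ θ) ≤ c)
    (hξ : ∀ θ, MemBVec δ (ξ θ) ∧ bNormVec δ (ξ θ) ≤ c) (hE : MemBVec δ E) (hB : MemBVec δ B)
    (hEB : bNormVec δ E + bNormVec δ B ≤ c * G)
    (hdivE : ∀ x, divergence E x = density μ ρ x - 1) (hdivB : ∀ x, divergence B x = 0) :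
    IsAnalyticData μ (Real.log δ) c G (fun θ => fourierCoef (ρ θ))
      (fun i θ => fourierCoef fun x => ξ θ x i) (fun i => fourierCoef fun x => E x i)
      (fun i => fourierCoef fun x => B x i) := by
  have hδ0 : 0 < δ := one_pos.trans hδ
  have hgauss (k : Freq) : ∑ i, derivSymbol i k * fourierCoef (fun x => E x i) k =
      ∫ θ, fourierCoef (ρ θ) k ∂μ - if k = 0 then 1 else 0 := by
    rw [← fourierCoef_divergence hδ hE, ← fourierCoef_density_sub_one hδ hρm hρ, funext hdivE]
  exact
    { aesm_rho := aestronglyMeasurable_fourierCoef (fun θ => (hρ θ).1.1) hρm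
      aesm_xi := fun i => aestronglyMeasurable_fourierCoef (fun θ => ((hξ θ).1 i).1) (hξm · i)
      herm_rho := fun _ => isHermitian_fourierCoef _
      herm_xi := fun _ _ => isHermitian_fourierCoef _
      herm_elec := fun _ => isHermitian_fourierCoef _
      herm_magn := fun _ => isHermitian_fourierCoef _
      rho_le := fun θ => (hρ θ).1.norm_fourierCoef_le_of_bNorm_le hδ0 (hρ θ).2
      xi_le := fun i θ => ((hξ θ).1 i).norm_fourierCoef_le_of_bNorm_le hδ0
        ((bNorm_le_bNormVec hδ0 _ i).trans (hξ θ).2)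
      elec_le := fun i => (hE i).norm_fourierCoef_le_of_bNorm_le hδ0
        ((bNorm_le_bNormVec hδ0 _ i).trans (by linarith [bNormVec_nonneg hδ0 B]))
      magn_le := fun i => (hB i).norm_fourierCoef_le_of_bNorm_le hδ0
        ((bNorm_le_bNormVec hδ0 _ i).trans (by linarith [bNormVec_nonneg hδ0 E]))
      gauss := fun k hk => by simpa [hk] using hgauss k
      total := sub_eq_zero.1 (by simpa using (hgauss 0).symm)
      solenoidal := fun k => by
        rw [← fourierCoef_divergence hδ hB, funext hdivB]
        simp [fourierCoef, mFourierCoeff_eq_integral_volume] }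

end GaussLaw

/-! ### Solutions for small times and small `ε` -/

section Data

variable {M : Type*} [MeasurableSpace M] {μ : Measure M} [IsProbabilityMeasure μ]

namespace PicardData

variable {D : PicardData μ} {afree wfree : Fin 3 → CoefSpace μ} {u : State μ} {R Q N : ℝ}

lemma norm_elec_le (hS : Small D R Q) (hu : u ∈ domain μ R) (hw : ∀ i, ‖wfree i‖ ≤ N)
    (i : Fin 3) : ‖-D.gradPhi i u - D.potVel wfree u i‖ ≤ Q ^ 3 + (N + Q ^ 11) := by
  refine (norm_sub_le _ _).trans (add_le_add ?_ ((norm_add_le _ _).trans (add_le_add (hw i) ?_)))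
  · rw [norm_neg]
    exact (tame_gradPhi hS i).bound u hu
  · refine (norm_duhamel_apply_le _ _).trans (le_trans ?_ ((tame_lerayCurrent hS i).bound u hu))
    rw [one_mul]
    exact mul_le_of_le_one_left (norm_nonneg _) hS.gain_le_one

lemma norm_magnetic_le (hS : Small D R Q) (hu : u ∈ domain μ R) (hbin : ∀ i, ‖D.bin i‖ ≤ N)
    (i : Fin 3) : ‖D.magnetic i u‖ ≤ N + Q ^ 14 :=
  (norm_add_le _ _).trans (add_le_add (hbin i) ((tame_inducedMagnetic hS i).bound u hu))

theorem exists_isSolution {G δ δ' : ℝ} (hS : Small D Q Q) (hδ : 1 < δ) (hδ' : 1 ≤ δ')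
    {ρ0 : M → T3 → ℝ} {ξ0 : M → T3 → Fin 3 → ℝ} {E0 B0 : T3 → Fin 3 → ℝ}
    (hρ : ∀ θ, MemB δ' (ρ0 θ)) (hξ : ∀ θ, MemBVec δ' (ξ0 θ)) (hE : MemBVec δ' E0)
    (hB : MemBVec δ' B0)
    (hD : D.Adapted (fun θ => fourierCoef (ρ0 θ)) (fun i θ => fourierCoef fun x => ξ0 θ x i)
      (fun i => fourierCoef fun x => E0 x i) (fun i => fourierCoef fun x => B0 x i) afree wfree)
    (hb : Real.log δ ≤ D.P.b) (hbin : ∀ i, ‖D.bin i‖ ≤ Q * G) (hw : ∀ i, ‖wfree i‖ ≤ Q * G)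
    (hG : 1 ≤ G) :
    ∃ (ρ : M → ℝ → T3 → ℝ) (ξ : M → ℝ → T3 → Fin 3 → ℝ)
      (φ : ℝ → T3 → ℝ) (A At Att : ℝ → T3 → Fin 3 → ℝ),
      IsSolution μ D.eps D.P.T δ ρ0 ξ0 E0 B0 ρ ξ φ A At Att ∧
      (∀ θ θ' t t', bNorm δ (ρ θ t) + bNormVec δ (ξ θ' t') ≤ Q ^ 16) ∧
      ∀ t t', bNormVec δ (elec D.eps φ At t) + bNormVec δ (magn B0 A t') ≤ Q ^ 16 * G := by
  obtain ⟨θ₀⟩ := nonempty_of_isProbabilityMeasure μ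
  obtain ⟨u, hu, hfix⟩ := exists_fixedPoint hS
  have hQ := hS.le_Q
  have hpow {m n : ℕ} (hmn : m ≤ n) : Q ^ m ≤ Q ^ n := pow_le_pow_right₀ (by linarith) hmn
  have hQ16 : 64 * Q ^ 14 ≤ Q ^ 16 := by
    calc 64 * Q ^ 14 ≤ Q ^ 2 * Q ^ 14 := by gcongr; nlinarith
      _ = Q ^ 16 := by ring
  have hQ14 : Q ≤ Q ^ 14 := le_self_pow₀ (by linarith) (by norm_num)
  refine ⟨_, _, _, _, _, _, isSolution hδ hδ' hρ hξ hE hB hD hb hfix hu.2.2 θ₀,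
    fun θ θ' t t' => ?_, fun t t' => ?_⟩
  · have h := bNormVec_le fun i => (D.P.bNorm_realize_le hδ hb (D.xi i u) t' θ').trans
      ((tame_xi hS i).bound u hu)
    linarith [(D.P.bNorm_realize_le hδ hb u.1 t θ).trans hu.1, hpow (show 2 ≤ 14 by norm_num)]
  · have hElec := bNormVec_le fun i => (D.P.bNorm_realize_le hδ hb _ t θ₀).trans
      (norm_elec_le hS hu hw i)
    have hMagn := bNormVec_le fun i => (D.P.bNorm_realize_le hδ hb _ t' θ₀).trans
      (norm_magnetic_le hS hu hbin i)
    simp only [bNormVec, elec_realize, magn_realize hD] at hElec hMagn ⊢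
    have hQG := mul_le_mul_of_nonneg_right hQ14 (zero_le_one.trans hG)
    have hQ16G := mul_le_mul_of_nonneg_right hQ16 (zero_le_one.trans hG)
    have hG14 := le_mul_of_one_le_right (pow_nonneg (by linarith : 0 ≤ Q) 14) hG
    linarith [hpow (show 3 ≤ 14 by norm_num), hpow (show 11 ≤ 14 by norm_num)]

end PicardData

theorem IsAnalyticData.exists_small {l c G : ℝ} {r₀ : M → Freq → ℂ} {x₀ : Fin 3 → M → Freq → ℂ}
    {e₀ b₀ : Fin 3 → Freq → ℂ} (h : IsAnalyticData μ l c G r₀ x₀ e₀ b₀) (hc : 0 ≤ c) (hG : 1 ≤ G)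
    (P : AnalyticScale) (hT : P.T ≤ 1) {ε : ℝ} (hε : 0 < ε) (hε1 : ε ≤ 1) (hεG : ε * G ≤ 1)
    (hmean : (∀ i, e₀ i 0 = 0) ∨ P.T ≤ ε) {K : ℝ} (hK0 : 0 ≤ K)
    (hK : ∀ k : Freq, (1 + freqNorm k) * Real.exp (-l * freqNorm k) ≤
      K * (polyWeight k * Real.exp (-P.a * freqNorm k)))
    {Q : ℝ} (hQ : 106 * (c * K) + 8 ≤ Q) (hgain : P.gain * Q ^ 30 ≤ 1) (hεQ : ε * Q ^ 30 ≤ 1) :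
    ∃ (D : PicardData μ) (afree wfree : Fin 3 → CoefSpace μ), D.P = P ∧ D.eps = ε ∧
      D.Adapted r₀ x₀ e₀ b₀ afree wfree ∧ D.Small Q Q ∧ (∀ i, ‖D.bin i‖ ≤ Q * G) ∧
      ∀ i, ‖wfree i‖ ≤ Q * G := by
  obtain ⟨D, afree, wfree, rfl, rfl, hD, hr, hx, hb, hw⟩ :=
    h.exists_adapted hc hG P hT hε hε1 hεG hmean hK0 hK
  have hcK : 0 ≤ c * K := mul_nonneg hc hK0
  have hQG := mul_le_mul_of_nonneg_right hQ (zero_le_one.trans hG)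
  have hcKG : 0 ≤ c * K * G := mul_nonneg hcK (zero_le_one.trans hG)
  refine ⟨D, afree, wfree, rfl, rfl, hD, ?_, fun i => ?_, fun i => ?_⟩
  · exact
    { le_Q := by linarith
      R_le := le_rfl
      R_nonneg := by linarith
      rin_le := by linarith
      xin_le := fun i => by linarith [hx i]
      bin_le := fun i => by
        rw [norm_smul, Real.norm_of_nonneg hε.le]
        nlinarith [mul_le_mul_of_nonneg_left (hb i) hε.le]
      gain_le := hgain
      eps_small := by nlinarith [pow_nonneg (by linarith : 0 ≤ Q) 30] }
  · linarith [hb i]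
  · linarith [hw i]

end Data

/-! ### Choice of the parameters -/

lemma exists_analyticScale {a b q : ℝ} (hb : 0 < b) (hab : b < a) (hq : 1 ≤ q) :
    ∃ T₀ > 0, ∀ ε ∈ Ioc (0 : ℝ) 1, ∀ p : Prop, ∃ P : AnalyticScale, P.a = a ∧ P.b = b ∧
      P.T ≤ 1 ∧ P.gain * q ≤ 1 ∧ (p → T₀ ≤ P.T) ∧ (p ∨ P.T ≤ ε) := by
  have hmin : 0 < min 1 (a - b) := lt_min one_pos (sub_pos.2 hab)
  obtain ⟨T₀, hT₀, hT₀q⟩ : ∃ T₀ > 0, 2 * q * T₀ = min 1 (a - b) :=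
    ⟨min 1 (a - b) / (2 * q), by positivity, by field_simp⟩
  have hmin1 := min_le_left 1 (a - b)
  have hmin2 := min_le_right 1 (a - b)
  have hT₀1 : T₀ ≤ 1 := by nlinarith
  refine ⟨T₀, hT₀, fun ε hε p => ?_⟩
  obtain ⟨T, hT, hTT₀, hp, hpε⟩ : ∃ T > 0, T ≤ T₀ ∧ (p → T₀ ≤ T) ∧ (p ∨ T ≤ ε) := by
    by_cases h : p
    · exact ⟨T₀, hT₀, le_rfl, fun _ => le_rfl, Or.inl h⟩
    · exact ⟨T₀ * ε, mul_pos hT₀ hε.1, mul_le_of_le_one_right hT₀.le hε.2, fun h' => absurd h' h,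
        Or.inr (mul_le_of_le_one_left hε.1.le hT₀1)⟩
  have hqT := mul_le_mul_of_nonneg_left hTT₀ (by linarith : 0 ≤ 2 * q)
  refine ⟨⟨a, b, 2 * q, T, hb, by linarith, hT, by linarith⟩, rfl, rfl, hTT₀.trans hT₀1, ?_, hp,
    hpε⟩
  rw [gain, add_mul]
  have : 1 / (2 * q) * q = 1 / 2 := by field_simp
  linarith

lemma mul_rpow_neg_le_one {ε γ : ℝ} (hε : ε ∈ Ioc (0 : ℝ) 1) (hγ : γ ≤ 1) :
    ε * ε ^ (-γ) ≤ 1 := by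
  have h := Real.rpow_add hε.1 1 (-γ)
  rw [Real.rpow_one] at h
  exact h ▸ Real.rpow_le_one hε.1.le hε.2 (by linarith)

end VlasovMaxwell

end

theorem theorem2 {M : Type*} [MeasurableSpace M] (μ : Measure M) [IsProbabilityMeasure μ]
    (δ₀ δ₁ C₀ γ : ℝ) (hδ₁ : 1 < δ₁) (hδ : δ₁ < δ₀) (hC₀ : 0 < C₀)
    (hγ : γ ∈ Icc (0 : ℝ) 1)
    (ρ0 : M → T3 → ℝ) (ξ0 : M → T3 → Fin 3 → ℝ) (E0 B0 : ℝ → T3 → Fin 3 → ℝ)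
    (hρmeas : ∀ x, AEStronglyMeasurable (fun θ => ρ0 θ x) μ)
    (hξmeas : ∀ x i, AEStronglyMeasurable (fun θ => ξ0 θ x i) μ)
    (hρ : ∀ θ, MemB δ₀ (ρ0 θ) ∧ bNorm δ₀ (ρ0 θ) ≤ C₀)
    (hξ : ∀ θ, MemBVec δ₀ (ξ0 θ) ∧ bNormVec δ₀ (ξ0 θ) ≤ C₀)
    (hE : ∀ ε ∈ Ioc (0 : ℝ) 1, MemBVec δ₀ (E0 ε))
    (hB : ∀ ε ∈ Ioc (0 : ℝ) 1, MemBVec δ₀ (B0 ε))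
    (hEB : ∀ ε ∈ Ioc (0 : ℝ) 1,
      bNormVec δ₀ (E0 ε) + bNormVec δ₀ (B0 ε) ≤ C₀ * ε ^ (-γ))
    (hdivE : ∀ ε ∈ Ioc (0 : ℝ) 1, ∀ x, divergence (E0 ε) x = density μ ρ0 x - 1)
    (hdivB : ∀ ε ∈ Ioc (0 : ℝ) 1, ∀ x, divergence (B0 ε) x = 0) :
    ∃ ε₀ > 0, ∃ C > 0, ∃ T₀ > 0, ∀ ε ∈ Ioc (0 : ℝ) ε₀,
      ∃ T > 0, ((∀ i, mean (E0 ε) i = 0) → T₀ ≤ T) ∧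
        ∃ (ρ : M → ℝ → T3 → ℝ) (ξ : M → ℝ → T3 → Fin 3 → ℝ)
          (φ : ℝ → T3 → ℝ) (A At Att : ℝ → T3 → Fin 3 → ℝ),
          IsSolution μ ε T δ₁ ρ0 ξ0 (E0 ε) (B0 ε) ρ ξ φ A At Att ∧
          (∀ θ θ', ∀ t ∈ Icc 0 T, ∀ t' ∈ Icc 0 T,
            bNorm δ₁ (ρ θ t) + bNormVec δ₁ (ξ θ' t') ≤ C) ∧
          (∀ t ∈ Icc 0 T, ∀ t' ∈ Icc 0 T,
            bNormVec δ₁ (elec ε φ At t) + bNormVec δ₁ (magn (B0 ε) A t') ≤ C * ε ^ (-γ)) := by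
  obtain ⟨a, hba, hal⟩ := exists_between (Real.log_lt_log (by linarith) hδ)
  obtain ⟨K, hK0, hK⟩ := exists_weight_bound hal
  have hCK := mul_pos hC₀ hK0
  obtain ⟨Q, hQ1, hQ⟩ : ∃ Q, 1 ≤ Q ∧ 106 * (C₀ * K) + 8 ≤ Q := ⟨_, by linarith, le_rfl⟩
  have hQ30 : 1 ≤ Q ^ 30 := one_le_pow₀ hQ1
  obtain ⟨T₀, hT₀, hscale⟩ := exists_analyticScale (Real.log_pos hδ₁) hba hQ30
  refine ⟨1 / Q ^ 30, by positivity, Q ^ 16, by positivity, T₀, hT₀, fun ε hε => ?_⟩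
  have hεQ : ε * Q ^ 30 ≤ 1 := (le_div_iff₀ (by positivity)).1 hε.2
  have hε1 : ε ∈ Ioc (0 : ℝ) 1 := ⟨hε.1, hε.2.trans ((div_le_one (by positivity)).2 hQ30)⟩
  have hG : 1 ≤ ε ^ (-γ) :=
    Real.one_le_rpow_of_pos_of_le_one_of_nonpos hε1.1 hε1.2 (neg_nonpos.2 hγ.1)
  obtain ⟨P, rfl, hPb, hT1, hgain, hTmean, hTε⟩ := hscale ε hε1 (∀ i, mean (E0 ε) i = 0)
  have hdata := isAnalyticData_fourierCoef (hδ₁.trans hδ) hρmeas hξmeas hρ hξ (hE ε hε1)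
    (hB ε hε1) (hEB ε hε1) (hdivE ε hε1) (hdivB ε hε1)
  obtain ⟨D, afree, wfree, rfl, rfl, hD, hsmall, hbin, hw⟩ :=
    hdata.exists_small hC₀.le hG P hT1 hε1.1 hε1.2 (mul_rpow_neg_le_one hε1 hγ.2)
      (hTε.imp_left fun h i => by rw [← mean_eq_fourierCoef, h i, Complex.ofReal_zero])
      hK0.le hK hQ hgain hεQ
  obtain ⟨ρ, ξ, φ, A, At, Att, hsol, hρξ, hEB'⟩ := D.exists_isSolution hsmall hδ₁
    (hδ₁.trans hδ).le (fun θ => (hρ θ).1) (fun θ => (hξ θ).1) (hE _ hε1) (hB _ hε1) hD hPb.ge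
    hbin hw hG
  exact ⟨D.P.T, D.P.T_pos, hTmean, ρ, ξ, φ, A, At, Att, hsol,
    fun θ θ' t _ t' _ => hρξ θ θ' t t', fun t _ t' _ => hEB' t t'⟩
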